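/- Let $M=\begin{pmatrix}a&b\\c&d\end{pmatrix}\in GL(2,\mathbb Z)$ be hyperbolic (no eigenvalue of modulus $1$) with positive trace $r=a+d>0$, let $T$ be the automorphism of $\mathbb T^2=\mathbb R^2/\mathbb Z^2$ given by $M$, and put $\sigma=\det M$, $D=r^2-4\sigma$, $\lambda=\frac{r+\sqrt D}{2}$ and $$f_T(x,y)=bx^2-(a-d)xy-cy^2 .$$ Let $\widetilde{\mathfrak X}$ be the additive semigroup of two-sided sequences $\varepsilon=(\varepsilon_n)_{n\in\mathbb Z}$ of nonnegative integers for which $\sum_{n\ge1}\varepsilon_n\lambda^{-n}$ and $\sum_{n\ge1}\varepsilon_{-n}\lambda^{-n}$ converge, with the topology of the distance $\sum_{n\in\mathbb Z}|\varepsilon_n-\varepsilon_n'|\lambda^{-|n|}$ (on sets of sequences with uniformly bounded terms this is the product topology), and let $(\tau\varepsilon)_n=\varepsilon_{n+1}$ be the shift. An *arithmetic coding* of $T$ is a pair $(\varphi,\mathfrak X)$ where - $\varphi:\widetilde{\mathfrak X}\to\mathbb T^2$ is a continuous semigroup homomorphism with $\varphi\tau=T\varphi$; - $\mathfrak X\subset\widetilde{\mathfrak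 X}$ is closed and shift-invariant ($\tau\mathfrak X=\mathfrak X$), and it is total: if $\varepsilon\in\mathfrak X$, $\varepsilon'\in\widetilde{\mathfrak X}$, and there is $N\in\mathbb Z$ such that for every $k\in\mathbb Z$ the sequence $(\varepsilon'_k,\varepsilon'_{k+1},\dots)$ is lexicographically less than $(\varepsilon_N,\varepsilon_{N+1},\dots)$, then $\varepsilon'\in\mathfrak X$; - $\varphi|_{\mathfrak X}$ is surjective, and it is one-to-one on the set of sequences in $\mathfrak X$ with finitely many nonzero terms. Then: 1. For every arithmetic coding $(\varphi,\mathfrak X)$ of $T$ there is $K\in\mathbb N$, depending on $\varphi$ only, such that Lebesgue almost every point of $\mathbb T^2$ has exactly $K$ preimages in $\mathfrak X$ under $\varphi$; $K$ is called the number of preimages of the coding. 2. Arithmetic codings of $T$ exist, and the minimal possible number $m(T)$ of preimages of an arithmetic coding of $T$ is $$m(T)=\min\{|f_T(u,v)|:(u,v)\in\mathbb Z^2\setminus\{(0,0)\}\}.$$ 3. The minimal arithmetic codings (those whose number of preimages is $m(T)$) are parametrized by the solutions $(u,v)\in\mathbb Z^2$ of $f_T(u,v)=\pm m(T)$. Precisely,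 for $(u,v)\in\mathbb Z^2$ put $$\begin{pmatrix}n\\k\end{pmatrix}=-\det M\cdot M\begin{pmatrix}-v\\u\end{pmatrix},\qquad \mathbf t_{u,v}=\left(\frac{-v+n\lambda}{\sqrt D},\ \frac{u+k\lambda}{\sqrt D}\right)\in\mathbb R^2 .$$ For every $(u,v)\in\mathbb Z^2$ the limit $$\varphi_{u,v}(\varepsilon)=\lim_{N\to\infty}\left(\Big(\sum_{n=-N}^{N}\varepsilon_n\lambda^{-n}\Big)\mathbf t_{u,v}\ \bmod\ \mathbb Z^2\right)$$ exists for all $\varepsilon\in\widetilde{\mathfrak X}$ and defines a semigroup homomorphism, and $(u,v)\mapsto\varphi_{u,v}$ is a bijection from the set of integer solutions of $f_T(u,v)=\pm m(T)$ onto the set of maps $\varphi$ of minimal arithmetic codings $(\varphi,\mathfrak X)$ of $T$. -/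

import Mathlib

open Topology

noncomputable section

namespace ArithCoding

/-- The discriminant `r ^ 2 - 4 σ` of the characteristic polynomial `x ^ 2 - r x + σ`. -/
def disc (M : Matrix (Fin 2) (Fin 2) ℤ) : ℤ := M.trace ^ 2 - 4 * M.det

/-- The eigenvalue `(r + √D) / 2` of `M`. -/
def eigen (M : Matrix (Fin 2) (Fin 2) ℤ) : ℝ := ((M.trace : ℝ) + √(disc M : ℝ)) / 2

/-- No eigenvalue of `M` lies on the unit circle. -/
def IsHyperbolic (M : Matrix (Fin 2) (Fin 2) ℤ) : Prop :=
  ∀ z ∈ spectrum ℂ (M.map (Int.cast : ℤ → ℂ)), ‖z‖ ≠ 1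

/-- The map of the torus `ℝ² / ℤ²` induced by the integral matrix `M`. -/
def toralMap (M : Matrix (Fin 2) (Fin 2) ℤ) (x : UnitAddTorus (Fin 2)) : UnitAddTorus (Fin 2) :=
  fun i => ∑ j, M i j • x j

/-- The quadratic form `b x ^ 2 - (a - d) x y - c y ^ 2` associated with the matrix
with rows `(a, b)` and `(c, d)`. -/
def assocForm (M : Matrix (Fin 2) (Fin 2) ℤ) (x y : ℤ) : ℤ :=
  M 0 1 * x ^ 2 - (M 0 0 - M 1 1) * (x * y) - M 1 0 * y ^ 2

/-- The additive semigroup of the two-sided sequences of nonnegative integers for which both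
series `∑_{n ≥ 1} ε_n λ ^ (-n)` and `∑_{n ≥ 1} ε_{-n} λ ^ (-n)` converge. -/
def PrimarySeq (lam : ℝ) : AddSubmonoid (ℤ → ℕ) where
  carrier := {e | Summable (fun n : ℕ => (e ((n : ℤ) + 1) : ℝ) / lam ^ (n + 1)) ∧
    Summable (fun n : ℕ => (e (-((n : ℤ) + 1)) : ℝ) / lam ^ (n + 1))}
  zero_mem' := by
    constructor <;> simp
  add_mem' := by
    rintro a b ⟨ha, ha'⟩ ⟨hb, hb'⟩
    constructor
    · refine (ha.add hb).congr fun n => ?_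
      simp [add_div]
    · refine (ha'.add hb').congr fun n => ?_
      simp only [Pi.add_apply, Nat.cast_add, add_div]

theorem summable_weighted {lam : ℝ} (e : PrimarySeq lam) :
    Summable (fun n : ℤ => (e.1 n : ℝ) / lam ^ n.natAbs) := by
  apply Summable.of_nat_of_neg_add_one
  · rw [← summable_nat_add_iff 1]
    refine e.2.1.congr fun n => ?_
    have : ((n + 1 : ℕ) : ℤ).natAbs = n + 1 := by omega
    rw [this]; push_cast; rfl
  · refine e.2.2.congr fun n => ?_
    have : (-((n : ℤ) + 1)).natAbs = n + 1 := by omega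
    rw [this]

/-- The sequence `n ↦ ε_n λ ^ (-|n|)` as an element of `ℓ¹(ℤ)`. -/
def weighted {lam : ℝ} (e : PrimarySeq lam) : lp (fun _ : ℤ => ℝ) 1 :=
  ⟨fun n => (e.1 n : ℝ) / lam ^ n.natAbs, by
    apply memℓp_gen
    refine (summable_weighted e).norm.congr fun n => ?_
    simp⟩

/-- The topology on `PrimarySeq lam` of the distance `∑_n |ε_n - ε'_n| λ ^ (-|n|)`. For `λ > 1` it
is the product (weak) topology on every set of sequences with uniformly bounded terms.
(For the product topology on all of `PrimarySeq lam`, every continuous shift-equivariant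
homomorphism to the torus would vanish.) -/
@[reducible]
def seqTopology (lam : ℝ) : TopologicalSpace (PrimarySeq lam) :=
  TopologicalSpace.induced weighted inferInstance

/-- The two-sided shift `(τ ε)_n = ε_{n + 1}`. -/
def shift {lam : ℝ} (e : PrimarySeq lam) : PrimarySeq lam :=
  ⟨fun n => e.1 (n + 1), by
    obtain ⟨h1, h2⟩ := e.2
    rcases eq_or_ne lam 0 with rfl | h0
    · constructor <;> simp
    constructor
    · refine (((summable_nat_add_iff 1).2 h1).mul_left lam).congr fun n => ?_
      push_cast
      rw [pow_succ lam (n + 1)]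
      field_simp
    · rw [← summable_nat_add_iff 1]
      refine (h2.mul_left lam⁻¹).congr fun n => ?_
      have : -(((n + 1 : ℕ) : ℤ) + 1) + 1 = -((n : ℤ) + 1) := by push_cast; ring
      beta_reduce
      rw [this, pow_succ lam (n + 1)]
      field_simp⟩

/-- A sequence is finite if it has only finitely many nonzero terms. -/
def IsFinite {lam : ℝ} (e : PrimarySeq lam) : Prop := (Function.support e.1).Finite

/-- The one-sided sequence `(ε_N, ε_{N+1}, …)`. -/
def tail {lam : ℝ} (e : PrimarySeq lam) (N : ℤ) : ℕ → ℕ := fun k => e.1 (N + k)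

/-- The strict lexicographic order on one-sided sequences. -/
def LexLess (x y : ℕ → ℕ) : Prop := ∃ n, (∀ k < n, x k = y k) ∧ x n < y n

/-- Together with a sequence `ε`, the set contains each sequence `ε'` all of whose tails are
lexicographically less than one and the same tail of `ε`. -/
def IsTotal {lam : ℝ} (X : Set (PrimarySeq lam)) : Prop :=
  ∀ e ∈ X, ∀ e' : PrimarySeq lam, (∃ N : ℤ, ∀ k : ℤ, LexLess (tail e' k) (tail e N)) → e' ∈ X

/-- The pair `(φ, X)` is an arithmetic coding of the toral automorphism with matrix `M`. -/
structure IsArithmeticCoding (M : Matrix (Fin 2) (Fin 2) ℤ)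
    (φ : PrimarySeq (eigen M) →+ UnitAddTorus (Fin 2)) (X : Set (PrimarySeq (eigen M))) :
    Prop where
  continuous : Continuous[seqTopology (eigen M), inferInstance] φ
  equivariant : ∀ e, φ (shift e) = toralMap M (φ e)
  closed : IsClosed[seqTopology (eigen M)] X
  shift_invariant : ∀ e, shift e ∈ X ↔ e ∈ X
  total : IsTotal X
  surjective : ∀ x, ∃ e ∈ X, φ e = x
  injective_finite : Set.InjOn φ {e | e ∈ X ∧ IsFinite e}

/-- Almost every point of the torus has exactly `K` preimages in `X` under `φ`. -/
def IsKToOne {lam : ℝ} (φ : PrimarySeq lam →+ UnitAddTorus (Fin 2)) (X : Set (PrimarySeq lam))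
    (K : ℕ) : Prop :=
  ∀ᵐ x : UnitAddTorus (Fin 2), {e | e ∈ X ∧ φ e = x}.encard = K

/-- The possible numbers of preimages of arithmetic codings. -/
def preimageNumbers (M : Matrix (Fin 2) (Fin 2) ℤ) : Set ℕ :=
  {K | ∃ φ X, IsArithmeticCoding M φ X ∧ IsKToOne φ X K}

/-- The minimal possible number `m(T)` of preimages of an arithmetic coding. -/
def minPreimages (M : Matrix (Fin 2) (Fin 2) ℤ) : ℕ := sInf (preimageNumbers M)

/-- An arithmetic coding with the minimal possible number of preimages. -/
def IsMinimalCoding (M : Matrix (Fin 2) (Fin 2) ℤ)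
    (φ : PrimarySeq (eigen M) →+ UnitAddTorus (Fin 2)) (X : Set (PrimarySeq (eigen M))) : Prop :=
  IsArithmeticCoding M φ X ∧ IsKToOne φ X (minPreimages M)

/-- The homoclinic point `((-v + n λ) / √D, (u + k λ) / √D)` with parameters `(u, v)`, in
coordinates of the plane, where `(n, k) = - det M • M (-v, u)`. -/
def homoclinicPoint (M : Matrix (Fin 2) (Fin 2) ℤ) (u v : ℤ) : Fin 2 → ℝ := fun i =>
  (((![-v, u] i : ℤ) : ℝ) + (((-M.det) • M.mulVec ![-v, u]) i : ℤ) * eigen M) / √(disc M : ℝ)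

/-- `φ ε = (∑_n ε_n λ ^ (-n)) t mod ℤ²` for all `ε`: the symmetric partial sums
`(∑_{|n| ≤ N} ε_n λ ^ (-n)) t`, reduced modulo `ℤ²`, converge to `φ ε` on the torus. -/
def IsGivenBySeries {lam : ℝ} (φ : PrimarySeq lam → UnitAddTorus (Fin 2)) (t : Fin 2 → ℝ) :
    Prop :=
  ∀ e : PrimarySeq lam, Filter.Tendsto
    (fun (N : ℕ) (i : Fin 2) =>
      (((∑ n ∈ Finset.Icc (-(N : ℤ)) N, (e.1 n : ℝ) * lam ^ (-n)) * t i : ℝ) : UnitAddCircle))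
    Filter.atTop (𝓝 (φ e))

end ArithCoding

end

noncomputable section

namespace ArithCoding

/-! Write μ for the conjugate of λ, so that λ + μ = r and λμ = ±1, and put w = (-v, u).

Which maps occur. By continuity, a coding map is determined by its values on the sequences with a
single 1, hence by one point of the torus. Evaluating the map on the constant sequence 1 shows that
the orbit of this point tends to 0 in both time directions. Such homoclinic points are the
intersections, modulo ℤ², of the two eigenlines through 0, and these are exactly the projections of
the vectors t = t_{u,v} (`exists_eq_proj_homoclinicPoint`, `exists_eq_phi`). If t' is the Galois
conjugate of t, then t + t' is integral, so λ^(-n) t ≡ -μ^(-n) t' for n ≤ 0. Thus φ_{u,v}(ε) is the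
class of x t - y t', where x is the value in base λ of the future of ε and y the value in base μ of
its past.

How many preimages. In the coordinates (x, y) the vectors (ξ, -ξ') with ξ ∈ ℤ[λ] form a lattice Λ
that corresponds to ℤw + ℤMw, of index |f(u, v)| in ℤ² (`card_quotient`). Call a sequence admissible
if none of its tails exceeds d, the quasi-greedy expansion of 1 in base λ. The pairs (x, y) of
admissible sequences lie in an L-shaped region which is a fundamental domain of Λ and is preserved
by (x, y) ↦ (λx - k, μy + k), k = ⌊λx⌋. Hence a generic class modulo Λ has exactly one admissible
code (`existsUnique_code`), and a generic point of the torus has |f(u, v)| of them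
(`encard_preimage`). Generic means that the coordinates are transcendental.

Why the set 𝔛 is irrelevant. If a sequence of 𝔛 has a tail beyond d and is not eventually zero,
totality puts into 𝔛 two distinct finite sequences of equal value, against injectivity. If the tails
of 𝔛 stay away from d, the futures form a null set, against surjectivity; otherwise totality and
closedness put all admissible sequences into 𝔛. So 𝔛 is the admissible set up to eventually zero
sequences, which have algebraic futures (`admissible_or_eventually_zero`, `admissibleSet_subset`,
`isKToOne`). -/

/-! ### The eigenvalue and its conjugate. -/

/-- The conjugate `(r - √D) / 2` of the eigenvalue `(r + √D) / 2`. -/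
def conjEigen (M : Matrix (Fin 2) (Fin 2) ℤ) : ℝ := M.trace - eigen M

theorem sqrt_disc_eq (M : Matrix (Fin 2) (Fin 2) ℤ) :
    √(disc M : ℝ) = eigen M - conjEigen M := by
  simp only [conjEigen, eigen]; ring

theorem eigen_add_conjEigen (M : Matrix (Fin 2) (Fin 2) ℤ) :
    eigen M + conjEigen M = M.trace := by
  simp [conjEigen]

/-- A rational root of a monic integral polynomial is an integer dividing the constant term, here a
unit, so it cannot exceed 1. -/
theorem irrational_of_quadratic {x : ℝ} {a b : ℤ} (hb : IsUnit b) (hx : 1 < x)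
    (h : x ^ 2 = a * x - b) : Irrational x := by
  rintro ⟨q, rfl⟩
  have h2 : q ^ 2 = a * q - b := by
    apply Rat.cast_injective (α := ℝ)
    push_cast
    exact h
  have hint : IsIntegral ℤ q := by
    refine ⟨Polynomial.X ^ 2 - (Polynomial.C a * Polynomial.X - Polynomial.C b), ?_, ?_⟩
    · apply Polynomial.monic_X_pow_sub
      refine (Polynomial.degree_sub_le _ _).trans_lt (max_lt ?_ ?_)
      · exact (Polynomial.degree_C_mul_X_le _).trans_lt (by norm_num)
      · exact Polynomial.degree_C_le.trans_lt (by norm_num)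
    · rw [Polynomial.eval₂_sub, Polynomial.eval₂_sub, Polynomial.eval₂_mul, Polynomial.eval₂_C,
        Polynomial.eval₂_C, Polynomial.eval₂_pow, Polynomial.eval₂_X, h2]
      simp
  obtain ⟨n, rfl⟩ := IsIntegrallyClosed.isIntegral_iff.1 hint
  have h3 : n ^ 2 = a * n - b := by
    simp only [algebraMap_int_eq, eq_intCast] at h2
    exact_mod_cast h2
  have h4 : n ∣ b := ⟨a - n, by linarith⟩
  have h5 := Int.isUnit_iff.1 (isUnit_of_dvd_unit h4 hb)
  have h6 : (1 : ℝ) < n := by simpa using hx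
  have h7 : 1 < n := by exact_mod_cast h6
  omega

section

variable {M : Matrix (Fin 2) (Fin 2) ℤ}

/-- With determinant 1, trace 1 gives the primitive sixth roots of unity as eigenvalues and trace 2
the eigenvalue 1, all of modulus 1. -/
theorem three_le_trace (hhyp : IsHyperbolic M) (htr : 0 < M.trace) (h : M.det = 1) :
    3 ≤ M.trace := by
  by_contra hlt
  have key : ∀ z : ℂ, z ^ 2 - M.trace * z + 1 = 0 → ‖z‖ ≠ 1 := by
    intro z hz
    apply hhyp
    rw [Matrix.mem_spectrum_iff_isRoot_charpoly, Matrix.charpoly_fin_two, Polynomial.IsRoot]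
    have h1 : (M.map (Int.cast : ℤ → ℂ)).trace = (M.trace : ℂ) := by
      simp [Matrix.trace_fin_two]
    have h2 : (M.map (Int.cast : ℤ → ℂ)).det = 1 := by
      rw [Matrix.det_fin_two] at h ⊢
      simp only [Matrix.map_apply]
      exact_mod_cast h
    simp [h1, h2, hz]
  have : M.trace = 1 ∨ M.trace = 2 := by omega
  rcases this with h1 | h1
  · have hs : (√3 : ℝ) ^ 2 = 3 := Real.sq_sqrt (by norm_num)
    refine key ⟨1 / 2, √3 / 2⟩ ?_ ?_
    · rw [h1]
      apply Complex.ext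
      · simp [pow_two]; nlinarith
      · simp [pow_two]; ring
    · rw [← sq_eq_sq₀ (norm_nonneg _) zero_le_one, ← Complex.normSq_eq_norm_sq,
        Complex.normSq_mk]
      nlinarith
  · refine key 1 ?_ (by simp)
    rw [h1]; norm_num

theorem disc_pos (hdet : IsUnit M.det) (hhyp : IsHyperbolic M) (htr : 0 < M.trace) :
    0 < disc M := by
  rcases Int.isUnit_iff.1 hdet with h | h
  · have := three_le_trace hhyp htr h
    rw [disc, h]; nlinarith
  · rw [disc, h]; nlinarith

theorem eigen_mul_conjEigen (hdet : IsUnit M.det) (hhyp : IsHyperbolic M) (htr : 0 < M.trace) :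
    eigen M * conjEigen M = M.det := by
  have h := disc_pos hdet hhyp htr
  have hs : √(disc M : ℝ) ^ 2 = disc M := Real.sq_sqrt (by exact_mod_cast h.le)
  have : eigen M * conjEigen M = ((M.trace : ℝ) ^ 2 - √(disc M : ℝ) ^ 2) / 4 := by
    simp only [conjEigen, eigen]; ring
  rw [this, hs, disc]; push_cast; ring

theorem one_lt_eigen (hdet : IsUnit M.det) (hhyp : IsHyperbolic M) (htr : 0 < M.trace) :
    1 < eigen M := by
  have h := disc_pos hdet hhyp htr
  rcases Int.isUnit_iff.1 hdet with h1 | h1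
  · have h3 : (3 : ℝ) ≤ M.trace := by exact_mod_cast three_le_trace hhyp htr h1
    have := Real.sqrt_nonneg (disc M : ℝ)
    rw [eigen]; linarith
  · have h3 : (1 : ℝ) ≤ M.trace := by exact_mod_cast htr
    have : (1 : ℝ) < √(disc M : ℝ) := by
      rw [Real.lt_sqrt (by norm_num)]
      have : 1 < disc M := by rw [disc, h1]; nlinarith
      simpa using (by exact_mod_cast this : (1 : ℝ) < disc M)
    rw [eigen]; linarith

theorem eigen_sq (hdet : IsUnit M.det) (hhyp : IsHyperbolic M) (htr : 0 < M.trace) :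
    eigen M ^ 2 = M.trace * eigen M - M.det := by
  rw [← eigen_mul_conjEigen hdet hhyp htr, ← eigen_add_conjEigen]; ring

theorem irrational_eigen (hdet : IsUnit M.det) (hhyp : IsHyperbolic M) (htr : 0 < M.trace) :
    Irrational (eigen M) :=
  irrational_of_quadratic hdet (one_lt_eigen hdet hhyp htr) (eigen_sq hdet hhyp htr)

end

/-- A rational combination `p + q x` of `1` and an irrational number vanishes only trivially. -/
theorem eq_zero_of_add_mul_irrational {x : ℝ} (hx : Irrational x) {p q : ℚ}
    (h : (p : ℝ) + q * x = 0) : p = 0 ∧ q = 0 := by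
  have hq : q = 0 := by
    by_contra hq
    apply hx
    refine ⟨-p / q, ?_⟩
    have : (q : ℝ) ≠ 0 := by exact_mod_cast hq
    push_cast
    field_simp
    linarith
  subst hq
  simpa using h

theorem eq_zero_of_intCast_add_mul_irrational {x : ℝ} (hx : Irrational x) {p q : ℤ}
    (h : (p : ℝ) + q * x = 0) : p = 0 ∧ q = 0 := by
  have := eq_zero_of_add_mul_irrational hx (p := p) (q := q) (by exact_mod_cast h)
  exact_mod_cast this

/-! ### Values of the future and of the past. -/

/-- The value `∑_{n ≥ 1} ε_n λ ^ (-n)` of the future of a sequence. -/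
def future (lam : ℝ) (e : ℤ → ℕ) : ℝ := ∑' n : ℤ, if 0 < n then (e n : ℝ) * lam ^ (-n) else 0

/-- The value `∑_{n ≤ 0} ε_n μ ^ (-n)` of the past of a sequence. -/
def past (mu : ℝ) (e : ℤ → ℕ) : ℝ := ∑' n : ℤ, if n ≤ 0 then (e n : ℝ) * mu ^ (-n) else 0

section Series

variable {lam mu : ℝ}

theorem norm_future_term_le (hlam : 1 < lam) (k : ℕ) (n : ℤ) :
    ‖(if 0 < n then (k : ℝ) * lam ^ (-n) else 0)‖ ≤ k / lam ^ n.natAbs := by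
  have h0 : 0 < lam := by linarith
  split_ifs with h
  · lift n to ℕ using h.le
    rw [Real.norm_of_nonneg (by positivity)]
    simp [div_eq_mul_inv]
  · simp only [norm_zero]; positivity

theorem norm_past_term_le (hlam : 1 < lam) (hmu : |mu| = lam⁻¹) (k : ℕ) (n : ℤ) :
    ‖(if n ≤ 0 then (k : ℝ) * mu ^ (-n) else 0)‖ ≤ k / lam ^ n.natAbs := by
  have h0 : 0 < lam := by linarith
  split_ifs with h
  · obtain ⟨m, rfl⟩ : ∃ m : ℕ, n = -m := ⟨n.natAbs, by omega⟩
    simp [hmu, div_eq_mul_inv]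
  · simp only [norm_zero]; positivity

theorem summable_future (hlam : 1 < lam) (e : PrimarySeq lam) :
    Summable fun n : ℤ => if 0 < n then (e.1 n : ℝ) * lam ^ (-n) else 0 :=
  (summable_weighted e).of_norm_bounded fun n => norm_future_term_le hlam _ n

theorem summable_past (hlam : 1 < lam) (hmu : |mu| = lam⁻¹) (e : PrimarySeq lam) :
    Summable fun n : ℤ => if n ≤ 0 then (e.1 n : ℝ) * mu ^ (-n) else 0 :=
  (summable_weighted e).of_norm_bounded fun n => norm_past_term_le hlam hmu _ n

theorem future_add (hlam : 1 < lam) (e e' : PrimarySeq lam) :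
    future lam (e + e').1 = future lam e.1 + future lam e'.1 := by
  rw [future, future, future, ← (summable_future hlam e).tsum_add (summable_future hlam e')]
  congr 1; ext n
  split_ifs
  · simp [add_mul]
  · simp

theorem past_add (hlam : 1 < lam) (hmu : |mu| = lam⁻¹) (e e' : PrimarySeq lam) :
    past mu (e + e').1 = past mu e.1 + past mu e'.1 := by
  rw [past, past, past, ← (summable_past hlam hmu e).tsum_add (summable_past hlam hmu e')]
  congr 1; ext n
  split_ifs
  · simp [add_mul]
  · simp

theorem future_zero : future lam (0 : ℤ → ℕ) = 0 := by simp [future]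

theorem past_zero : past mu (0 : ℤ → ℕ) = 0 := by simp [past]

theorem future_nonneg (hlam : 1 < lam) (e : ℤ → ℕ) : 0 ≤ future lam e := by
  refine tsum_nonneg fun n => ?_
  split_ifs <;> positivity

/-- Under the shift the digit in position 1 passes from the future to the past. Together with
`past_shift` this gives (x, y) ↦ (λx - ε₁, μy + ε₁). -/
theorem future_shift (hlam : 1 < lam) (e : PrimarySeq lam) :
    future lam (shift e).1 = lam * future lam e.1 - e.1 1 := by
  have h0 : lam ≠ 0 := by linarith
  have h1 : future lam (shift e).1 =
      ∑' n : ℤ, if 1 < n then (e.1 n : ℝ) * lam ^ (-n + 1) else 0 := by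
    rw [future, ← (Equiv.addRight (1 : ℤ)).tsum_eq
      (fun n => if 1 < n then (e.1 n : ℝ) * lam ^ (-n + 1) else 0)]
    congr 1; ext n
    simp [shift]
  have h2 : ∀ n : ℤ, (if 1 < n then (e.1 n : ℝ) * lam ^ (-n + 1) else 0) =
      lam * (if 0 < n then (e.1 n : ℝ) * lam ^ (-n) else 0) - if n = 1 then (e.1 1 : ℝ) else 0 := by
    intro n
    rcases lt_trichotomy n 1 with h | rfl | h
    · rw [if_neg (by omega), if_neg (by omega), if_neg (by omega)]; simp
    · simp; field_simp; simp
    · rw [if_pos h, if_pos (by omega), if_neg (by omega), zpow_add₀ h0]; simp; ring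
  rw [h1, tsum_congr h2, Summable.tsum_sub ((summable_future hlam e).mul_left _)
    (hasSum_ite_eq 1 _).summable, tsum_mul_left, tsum_ite_eq, future]

theorem past_shift (hlam : 1 < lam) (hmu : |mu| = lam⁻¹) (e : PrimarySeq lam) :
    past mu (shift e).1 = mu * past mu e.1 + e.1 1 := by
  have h0 : mu ≠ 0 := by
    rintro rfl
    have : 0 < lam⁻¹ := by positivity
    simp at hmu; linarith
  have h1 : past mu (shift e).1 =
      ∑' n : ℤ, if n ≤ 1 then (e.1 n : ℝ) * mu ^ (-n + 1) else 0 := by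
    rw [past, ← (Equiv.addRight (1 : ℤ)).tsum_eq
      (fun n => if n ≤ 1 then (e.1 n : ℝ) * mu ^ (-n + 1) else 0)]
    congr 1; ext n
    simp [shift]
  have h2 : ∀ n : ℤ, (if n ≤ 1 then (e.1 n : ℝ) * mu ^ (-n + 1) else 0) =
      mu * (if n ≤ 0 then (e.1 n : ℝ) * mu ^ (-n) else 0) + if n = 1 then (e.1 1 : ℝ) else 0 := by
    intro n
    rcases lt_trichotomy n 1 with h | rfl | h
    · rw [if_pos h.le, if_pos (by omega), if_neg (by omega), zpow_add₀ h0]; simp; ring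
    · simp
    · rw [if_neg (by omega), if_neg (by omega), if_neg (by omega)]; simp
  rw [h1, tsum_congr h2, Summable.tsum_add ((summable_past hlam hmu e).mul_left _)
    (hasSum_ite_eq 1 _).summable, tsum_mul_left, tsum_ite_eq, past]

/-- A bounded sequence as an element of `PrimarySeq lam`. -/
def ofBounded (hlam : 1 < lam) (e : ℤ → ℕ) (B : ℕ) (h : ∀ n, e n ≤ B) : PrimarySeq lam :=
  ⟨e, by
    have key : ∀ f : ℕ → ℕ, (∀ n, f n ≤ B) → Summable fun n => (f n : ℝ) / lam ^ (n + 1) := by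
      intro f hf
      have hg : Summable fun n : ℕ => (B : ℝ) * (lam⁻¹) ^ (n + 1) :=
        ((summable_nat_add_iff 1).2 (summable_geometric_of_lt_one (by positivity)
          (inv_lt_one_of_one_lt₀ hlam))).mul_left _
      refine hg.of_nonneg_of_le (fun n => by positivity) fun n => ?_
      rw [inv_pow, ← div_eq_mul_inv]
      gcongr
      exact_mod_cast hf n
    exact ⟨key (fun n => e (n + 1)) fun n => h _, key (fun n => e (-(n + 1))) fun n => h _⟩⟩

/-- A sequence with finitely many nonzero terms as an element of `PrimarySeq lam`. -/
def ofFinite (lam : ℝ) (e : ℤ → ℕ) (h : (Function.support e).Finite) : PrimarySeq lam :=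
  ⟨e, by
    constructor
    · refine summable_of_hasFiniteSupport ((h.preimage
        (f := fun n : ℕ => (n : ℤ) + 1) fun a _ b _ hab => by simpa using hab).subset ?_)
      intro n hn
      simp only [Set.mem_preimage, Function.mem_support] at hn ⊢
      rintro h0
      exact hn (by simp [h0])
    · refine summable_of_hasFiniteSupport ((h.preimage
        (f := fun n : ℕ => -((n : ℤ) + 1)) fun a _ b _ hab => by simpa using hab).subset ?_)
      intro n hn
      simp only [Set.mem_preimage, Function.mem_support] at hn ⊢
      rintro h0
      exact hn (by rw [h0]; simp)⟩

/-- The sequence whose only nonzero term is a `1` in position `n`. -/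
def unit (lam : ℝ) (n : ℤ) : PrimarySeq lam :=
  ofFinite lam (Pi.single n 1) ((Set.finite_singleton n).subset Pi.support_single_subset)

theorem shift_iterate_apply (e : PrimarySeq lam) (k : ℕ) (n : ℤ) :
    (shift^[k] e).1 n = e.1 (n + k) := by
  induction k generalizing e n with
  | zero => simp
  | succ k ih =>
    rw [Function.iterate_succ_apply, ih]
    simp only [shift]
    push_cast
    ring_nf

theorem future_eq_shift_iterate (hlam : 1 < lam) (e : PrimarySeq lam) (k : ℕ) :
    future lam (shift^[k + 1] e).1 = lam * future lam (shift^[k] e).1 - e.1 (k + 1) := by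
  rw [Function.iterate_succ_apply', future_shift hlam, shift_iterate_apply]
  ring_nf

theorem future_unit (n : ℤ) : future lam (unit lam n).1 = if 0 < n then lam ^ (-n) else 0 := by
  rw [future, tsum_eq_single n]
  · simp [unit, ofFinite]
  · intro m hm
    simp [unit, ofFinite, hm]

theorem past_unit (n : ℤ) : past mu (unit lam n).1 = if n ≤ 0 then mu ^ (-n) else 0 := by
  rw [past, tsum_eq_single n]
  · simp [unit, ofFinite]
  · intro m hm
    simp [unit, ofFinite, hm]

/-! ### The topology -/

theorem weighted_apply (e : PrimarySeq lam) (n : ℤ) :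
    weighted e n = (e.1 n : ℝ) / lam ^ n.natAbs := rfl

theorem norm_weighted_sub (e e' : PrimarySeq lam) :
    HasSum (fun n : ℤ => |(e.1 n : ℝ) - e'.1 n| / |lam| ^ n.natAbs)
      ‖weighted e - weighted e'‖ := by
  have := lp.hasSum_norm (p := 1) (by norm_num) (weighted e - weighted e')
  simp only [ENNReal.toReal_one, Real.rpow_one] at this
  refine this.congr_fun ?_ |> fun h => h
  intro n
  simp [weighted_apply, ← sub_div]

theorem tendsto_iff_weighted {α : Type*} {l : Filter α} {f : α → PrimarySeq lam}
    {e : PrimarySeq lam} :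
    Filter.Tendsto f l (@nhds _ (seqTopology lam) e) ↔
      Filter.Tendsto (fun a => weighted (f a)) l (𝓝 (weighted e)) := by
  rw [@nhds_induced, Filter.tendsto_comap_iff]; rfl

theorem continuous_of_abs_sub_le {g : PrimarySeq lam → ℝ}
    (h : ∀ e e', |g e - g e'| ≤ ‖weighted e - weighted e'‖) :
    Continuous[seqTopology lam, inferInstance] g := by
  let _ := seqTopology lam
  refine continuous_iff_continuousAt.2 fun e => ?_
  rw [ContinuousAt, tendsto_iff_norm_sub_tendsto_zero]
  have h1 : Filter.Tendsto (fun a : PrimarySeq lam => weighted a) (𝓝 e) (𝓝 (weighted e)) :=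
    tendsto_iff_weighted.1 Filter.tendsto_id
  exact squeeze_zero (fun _ => norm_nonneg _) (fun a => h a e)
    (tendsto_iff_norm_sub_tendsto_zero.1 h1)

theorem continuous_future (hlam : 1 < lam) :
    Continuous[seqTopology lam, inferInstance] fun e : PrimarySeq lam => future lam e.1 := by
  refine continuous_of_abs_sub_le fun e e' => ?_
  rw [future, future, ← (summable_future hlam e).tsum_sub (summable_future hlam e')]
  rw [← Real.norm_eq_abs]
  refine tsum_of_norm_bounded (norm_weighted_sub e e') fun n => ?_
  have h0 : 0 < lam := by linarith
  split_ifs with h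
  · lift n to ℕ using h.le
    rw [← sub_mul, norm_mul]
    simp [abs_of_pos h0, div_eq_mul_inv]
  · simp only [sub_zero, norm_zero]; positivity

theorem continuous_past (hlam : 1 < lam) (hmu : |mu| = lam⁻¹) :
    Continuous[seqTopology lam, inferInstance] fun e : PrimarySeq lam => past mu e.1 := by
  refine continuous_of_abs_sub_le fun e e' => ?_
  rw [past, past, ← (summable_past hlam hmu e).tsum_sub (summable_past hlam hmu e')]
  rw [← Real.norm_eq_abs]
  refine tsum_of_norm_bounded (norm_weighted_sub e e') fun n => ?_
  have h0 : 0 < lam := by linarith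
  split_ifs with h
  · obtain ⟨m, rfl⟩ : ∃ m : ℕ, n = -m := ⟨n.natAbs, by omega⟩
    rw [← sub_mul, norm_mul]
    simp [abs_of_pos h0, hmu, div_eq_mul_inv]
  · simp only [sub_zero, norm_zero]; positivity

theorem continuous_coord (hlam : 1 < lam) (n : ℤ) :
    Continuous[seqTopology lam, inferInstance] fun e : PrimarySeq lam => e.1 n := by
  let _ := seqTopology lam
  rw [Nat.isClosedEmbedding_coe_real.continuous_iff]
  have h0 : lam ≠ 0 := by linarith
  have h1 : Continuous[seqTopology lam, inferInstance]
      fun e : PrimarySeq lam => (e.1 n : ℝ) / lam ^ n.natAbs := by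
    refine continuous_of_abs_sub_le fun e e' => ?_
    exact lp.norm_apply_le_norm one_ne_zero (weighted e - weighted e') n
  have h2 := h1.mul_const (lam ^ n.natAbs)
  refine h2.congr fun e => ?_
  field_simp
  rfl

/-- The restriction of a sequence to a finite set of positions. -/
def restrict (e : PrimarySeq lam) (s : Finset ℤ) : PrimarySeq lam :=
  ofFinite lam (fun n => if n ∈ s then e.1 n else 0)
    (s.finite_toSet.subset fun n hn => by
      by_contra h
      simp_all)

theorem restrict_apply (e : PrimarySeq lam) (s : Finset ℤ) (n : ℤ) :
    (restrict e s).1 n = if n ∈ s then e.1 n else 0 := rfl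

theorem isFinite_ofFinite {e : ℤ → ℕ} (h : (Function.support e).Finite) :
    IsFinite (ofFinite lam e h) := h

theorem restrict_eq_sum (e : PrimarySeq lam) (s : Finset ℤ) :
    restrict e s = ∑ n ∈ s, e.1 n • unit lam n := by
  apply Subtype.ext
  ext m
  simp [restrict_apply, unit, ofFinite, Finset.sum_apply, Pi.single_apply]

theorem tendsto_restrict (e : PrimarySeq lam) :
    Filter.Tendsto (restrict e) Filter.atTop (@nhds _ (seqTopology lam) e) := by
  rw [tendsto_iff_weighted]
  have := lp.hasSum_single (p := 1) (by norm_num) (weighted e)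
  refine Filter.Tendsto.congr (fun s => ?_) this
  ext m
  rw [lp.coeFn_sum, Finset.sum_apply]
  simp only [lp.single_apply, weighted_apply, restrict_apply]
  split_ifs with h <;> simp [h, Pi.single_apply]

/-- Every sequence is the limit of its finite truncations in the weighted topology, so a continuous
homomorphism is determined by its values on the sequences `unit`. -/
theorem hasSum_of_continuous {A : Type*} [AddCommMonoid A] [TopologicalSpace A]
    {φ : PrimarySeq lam →+ A} (hφ : Continuous[seqTopology lam, inferInstance] φ)
    (e : PrimarySeq lam) : HasSum (fun n => e.1 n • φ (unit lam n)) (φ e) := by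
  have h1 : Filter.Tendsto φ (@nhds _ (seqTopology lam) e) (𝓝 (φ e)) :=
    @Continuous.tendsto _ _ (seqTopology lam) _ _ hφ e
  refine (h1.comp (tendsto_restrict e)).congr fun s => ?_
  simp [restrict_eq_sum]

end Series

/-! ### Admissible sequences and the numeration system. -/

/-- No tail of the sequence is lexicographically greater than `d`. -/
def IsAdmissible (d : ℕ → ℕ) (e : ℤ → ℕ) : Prop := ∀ N : ℤ, ¬ LexLess d fun k => e (N + k)

theorem IsAdmissible.le {d : ℕ → ℕ} {e : ℤ → ℕ} (h : IsAdmissible d e) (n : ℤ) : e n ≤ d 0 := by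
  by_contra hlt
  exact h n ⟨0, by simp, by simpa using hlt⟩

theorem IsAdmissible.comp_add {d : ℕ → ℕ} {e : ℤ → ℕ} (h : IsAdmissible d e) (m : ℤ) :
    IsAdmissible d fun n => e (n + m) := by
  intro N hN
  apply h (N + m)
  convert hN using 3
  ring

theorem isAdmissible_shift {lam : ℝ} {d : ℕ → ℕ} {e : PrimarySeq lam} :
    IsAdmissible d (shift e).1 ↔ IsAdmissible d e.1 := by
  refine ⟨fun h => ?_, fun h => h.comp_add 1⟩
  have := h.comp_add (-1)
  simpa [shift] using this

theorem IsAdmissible.exists_shift_eq {lam : ℝ} (hlam : 1 < lam) {d : ℕ → ℕ} {e : PrimarySeq lam}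
    (h : IsAdmissible d e.1) :
    ∃ e' : PrimarySeq lam, IsAdmissible d e'.1 ∧ shift e' = e := by
  refine ⟨ofBounded hlam (fun n => e.1 (n + -1)) (d 0) fun n => h.le _, h.comp_add (-1), ?_⟩
  apply Subtype.ext
  ext n
  simp [shift, ofBounded]

/-- The interior of the L-shaped domain of the natural extension, in the coordinates given by the
value of the future and the value of the past. -/
def InDomain (lam : ℝ) (r c : ℕ) (x y : ℝ) : Prop :=
  (0 < x ∧ x < 1) ∧ ((r : ℝ) - 1 - c < y ∧ y < lam) ∧ y ≠ lam - 1 ∧ (lam - 1 < y → x < lam - c)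

/-- The expansions in base `λ` for a quadratic unit `λ > 1` with conjugate `μ`. Here `d` is the
quasi-greedy expansion of `1`, and `D i` is the value of its `i`-th tail. -/
structure Numeration (lam mu : ℝ) (r c : ℕ) (d : ℕ → ℕ) (D : ℕ → ℝ) : Prop where
  one_lt : 1 < lam
  irrational : Irrational lam
  add_eq : lam + mu = r
  norm_unit : ∃ s : ℤ, s * s = 1 ∧ lam * mu = s
  abs_conj : |mu| = lam⁻¹
  digit_zero : d 0 = c
  value_zero : D 0 = 1
  value_succ : ∀ i, D (i + 1) = lam * D i - d i
  value_pos : ∀ i, 0 < D i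
  value_le : ∀ i, D i ≤ 1
  digit_lt : (c : ℝ) < lam
  lt_digit : lam < c + 1
  conj_lt : mu < c
  region : ∀ e : PrimarySeq lam, IsAdmissible d e.1 →
    future lam e.1 ≤ 1 ∧ (r : ℝ) - 1 - c ≤ past mu e.1 ∧ past mu e.1 ≤ lam ∧
      (lam - 1 < past mu e.1 → future lam e.1 ≤ lam - c)
  step : ∀ x y : ℝ, ∀ k : ℤ, InDomain lam r c x y → (k : ℝ) < lam * x → lam * x < k + 1 →
    InDomain lam r c (lam * x - k) (mu * y + k)
  collision : ∀ (e : ℤ → ℕ) (N : ℤ), LexLess d (fun k => e (N + k)) →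
    (∃ N₀ : ℤ, ∀ n ≥ N₀, e n = 0) ∨
    ∃ (N' : ℤ) (g h : PrimarySeq lam), IsFinite g ∧ IsFinite h ∧ g ≠ h ∧
      (∀ k, LexLess (tail g k) fun n => e (N' + n)) ∧
      (∀ k, LexLess (tail h k) fun n => e (N' + n)) ∧
      future lam g.1 = future lam h.1 ∧ past mu g.1 = past mu h.1

theorem le_of_forall_le_add_div_pow {lam x y B : ℝ} (hlam : 1 < lam)
    (h : ∀ n : ℕ, x ≤ y + B / lam ^ n) : x ≤ y := by
  have h1 : Filter.Tendsto (fun n : ℕ => y + B / lam ^ n) Filter.atTop (𝓝 (y + 0)) :=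
    ((tendsto_const_nhds (x := B)).div_atTop
      (tendsto_pow_atTop_atTop_of_one_lt hlam)).const_add y
  rw [add_zero] at h1
  exact ge_of_tendsto' h1 h

/-- Used to prove sharp bounds for a whole shift-invariant family at once: a crude bound with error
`B` improves to error `B / λ` after one shift, hence to `B / λ ^ n`, and
`le_of_forall_le_add_div_pow` removes the error. -/
theorem forall_div_pow_of_contraction {lam B : ℝ} (hlam : 1 < lam) {p : ℝ → Prop} (hB : 0 ≤ B)
    (h : p B) (hstep : ∀ c, 0 ≤ c → p c → p (c / lam)) (n : ℕ) : p (B / lam ^ n) := by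
  induction n with
  | zero => simpa using h
  | succ n ih =>
    have := hstep _ (by positivity) ih
    rwa [div_div, ← pow_succ] at this

theorem exists_bound {lam mu : ℝ} (hlam : 1 < lam) (hmu : |mu| = lam⁻¹) (c : ℕ) :
    ∃ B : ℝ, 0 ≤ B ∧ ∀ e : ℤ → ℕ, (∀ n, e n ≤ c) → future lam e ≤ B ∧ |past mu e| ≤ B := by
  have h0 : 0 < lam := by linarith
  have hs := (summable_weighted (ofBounded hlam (fun _ => c) c fun _ => le_rfl)).hasSum
  refine ⟨_, hs.nonneg fun n => by positivity, fun e he => ⟨(le_abs_self _).trans ?_, ?_⟩⟩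
  · rw [← Real.norm_eq_abs]
    refine tsum_of_norm_bounded hs fun n => (norm_future_term_le hlam _ n).trans ?_
    simp only [ofBounded]
    gcongr
    exact_mod_cast he n
  · rw [← Real.norm_eq_abs]
    refine tsum_of_norm_bounded hs fun n => (norm_past_term_le hlam hmu _ n).trans ?_
    simp only [ofBounded]
    gcongr
    exact_mod_cast he n

/-! ### Units of norm `-1` -/

section NormNegOne

/-- The quasi-greedy expansion of `1` for `λ ^ 2 = r λ + 1`. -/
def digitsNeg (r : ℕ) (i : ℕ) : ℕ := if Even i then r else 0

theorem IsAdmissible.eq_zero_of_digitsNeg {r : ℕ} {e : ℤ → ℕ} (h : IsAdmissible (digitsNeg r) e)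
    {n : ℤ} (hn : e n = r) : e (n + 1) = 0 := by
  by_contra hlt
  refine h n ⟨1, ?_, ?_⟩
  · intro k hk
    obtain rfl : k = 0 := by omega
    simp [digitsNeg, hn]
  · simpa [digitsNeg, Nat.pos_iff_ne_zero] using hlt

variable {lam mu : ℝ} {r : ℕ}

/-- The bounds reproduce themselves under one shift, with the error divided by λ. Past and future
interact in one way only: y > λ - 1 forces the digit in position 0 to be r, the next digit is then
0, and x ≤ λ⁻¹ = λ - r. -/
theorem region_neg (hlam : 1 < lam) (hmul : lam * mu = -1) (hadd : lam + mu = r)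
    {e : PrimarySeq lam} (he : IsAdmissible (digitsNeg r) e.1) :
    future lam e.1 ≤ 1 ∧ (r : ℝ) - 1 - r ≤ past mu e.1 ∧ past mu e.1 ≤ lam ∧
      (lam - 1 < past mu e.1 → future lam e.1 ≤ lam - r) := by
  have h0 : 0 < lam := by linarith
  have hmu : mu = -lam⁻¹ := by field_simp; linarith
  have habs : |mu| = lam⁻¹ := by rw [hmu, abs_neg, abs_of_pos (by positivity)]
  have hli : lam - r = lam⁻¹ := by linarith
  obtain ⟨B, hB, hbd⟩ := exists_bound hlam habs r
  have hle : ∀ e : PrimarySeq lam, IsAdmissible (digitsNeg r) e.1 → ∀ n, e.1 n ≤ r :=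
    fun e he n => he.le n
  have hQ : ∀ n : ℕ, ∀ e : PrimarySeq lam, IsAdmissible (digitsNeg r) e.1 →
      -1 - B / lam ^ n ≤ past mu e.1 ∧ past mu e.1 ≤ lam + B / lam ^ n := by
    refine forall_div_pow_of_contraction (p := fun c => ∀ e : PrimarySeq lam,
      IsAdmissible (digitsNeg r) e.1 → -1 - c ≤ past mu e.1 ∧ past mu e.1 ≤ lam + c) hlam hB ?_ ?_
    · intro e he
      have := abs_le.1 (hbd e.1 (hle e he)).2
      constructor <;> linarith
    · intro c hc ih e he
      obtain ⟨e', he', rfl⟩ := he.exists_shift_eq hlam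
      obtain ⟨h1, h2⟩ := ih e' he'
      have h3 : (e'.1 1 : ℝ) ≤ r := by exact_mod_cast hle e' he' 1
      rw [past_shift hlam habs, hmu]
      have h4 : lam⁻¹ * past mu e'.1 ≤ lam⁻¹ * (lam + c) := by gcongr
      have h5 : lam⁻¹ * (-1 - c) ≤ lam⁻¹ * past mu e'.1 := by gcongr
      have h6 : lam⁻¹ * (lam + c) = 1 + c / lam := by field_simp
      have h7 : lam⁻¹ * (-1 - c) = -lam⁻¹ - c / lam := by field_simp
      rw [h6] at h4
      rw [h7] at h5
      rw [hmu] at h4 h5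
      constructor
      · have : (0 : ℝ) ≤ e'.1 1 := by positivity
        linarith
      · linarith
  -- The bound 1 alone does not reproduce itself when the next digit is r; the sharper bound after a
  -- digit r, where a 0 is forced, closes the induction.
  have hP : ∀ n : ℕ, ∀ e : PrimarySeq lam, IsAdmissible (digitsNeg r) e.1 →
      future lam e.1 ≤ 1 + B / lam ^ n ∧ (e.1 0 = r → future lam e.1 ≤ lam⁻¹ + B / lam ^ n) := by
    refine forall_div_pow_of_contraction (p := fun c => ∀ e : PrimarySeq lam,
      IsAdmissible (digitsNeg r) e.1 → future lam e.1 ≤ 1 + c ∧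
        (e.1 0 = r → future lam e.1 ≤ lam⁻¹ + c)) hlam hB ?_ ?_
    · intro e he
      have h1 := (hbd e.1 (hle e he)).1
      have : 0 < lam⁻¹ := by positivity
      constructor
      · linarith
      · intro _; linarith
    · intro c hc ih e he
      obtain ⟨h1, h2⟩ := ih (shift e) (isAdmissible_shift.2 he)
      rw [future_shift hlam] at h1 h2
      have hshift : (shift e).1 0 = e.1 1 := rfl
      rw [hshift] at h2
      have h4 : lam⁻¹ + c / lam = (1 + c) / lam := by field_simp
      have h5 : 1 + c / lam = (lam + c) / lam := by field_simp
      constructor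
      · rw [h5, le_div_iff₀ h0]
        rcases (hle e he 1).lt_or_eq with h | h
        · have : (e.1 1 : ℝ) + 1 ≤ r := by exact_mod_cast h
          have : 0 < lam⁻¹ := by positivity
          linarith
        · have := h2 h
          rw [h] at this
          linarith
      · intro h
        have h6 : e.1 1 = 0 := by simpa using he.eq_zero_of_digitsNeg h
        rw [h6] at h1
        rw [h4, le_div_iff₀ h0]
        push_cast at h1
        linarith
  have hQlow : ∀ e : PrimarySeq lam, IsAdmissible (digitsNeg r) e.1 → -1 ≤ past mu e.1 :=
    fun e he => le_of_forall_le_add_div_pow hlam fun n => by linarith [(hQ n e he).1]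
  have hPup : ∀ e : PrimarySeq lam, IsAdmissible (digitsNeg r) e.1 → future lam e.1 ≤ 1 :=
    fun e he => le_of_forall_le_add_div_pow hlam fun n => (hP n e he).1
  refine ⟨hPup e he, by linarith [hQlow e he],
    le_of_forall_le_add_div_pow hlam fun n => (hQ n e he).2, fun h => ?_⟩
  have he0 : e.1 0 = r := by
    by_contra hne
    have hlt : e.1 0 < r := lt_of_le_of_ne (hle e he 0) hne
    obtain ⟨e', he', rfl⟩ := he.exists_shift_eq hlam
    have h1 : (e'.1 1 : ℝ) + 1 ≤ r := by exact_mod_cast hlt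
    rw [past_shift hlam habs] at h
    have h2 : lam⁻¹ * (-1) ≤ lam⁻¹ * past mu e'.1 := by gcongr; exact hQlow e' he'
    have h3 : mu * past mu e'.1 = -(lam⁻¹ * past mu e'.1) := by
      linear_combination past mu e'.1 * hmu
    linarith
  rw [hli]
  exact le_of_forall_le_add_div_pow hlam fun n => (hP n e he).2 he0

/-- The strips of the lower rectangle with digit k < r go to the lower rectangle, the strip with k =
r goes to the upper one, and the upper rectangle returns to the lower one with digit 0. -/
theorem step_neg (hlam : 1 < lam) (hmul : lam * mu = -1) (hadd : lam + mu = r)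
    {x y : ℝ} {k : ℤ} (h : InDomain lam r r x y) (hk : (k : ℝ) < lam * x)
    (hk' : lam * x < k + 1) : InDomain lam r r (lam * x - k) (mu * y + k) := by
  have h0 : 0 < lam := by linarith
  have hmu0 : mu < 0 := by nlinarith
  have hmu1 : -1 < mu := by nlinarith
  obtain ⟨⟨hx0, hx1⟩, ⟨hy0, hy1⟩, hne, himp⟩ := h
  have hk0 : 0 ≤ k := by
    have : (-1 : ℝ) < k := by nlinarith
    have : -1 < k := by exact_mod_cast this
    omega
  have hkr : k ≤ r := by
    have h1 : (k : ℝ) < r + 1 := by nlinarith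
    have : k < r + 1 := by exact_mod_cast h1
    omega
  have hk0' : (0 : ℝ) ≤ k := by exact_mod_cast hk0
  rcases lt_or_gt_of_ne hne with hlt | hgt
  · have hup : mu * y < -mu := by nlinarith
    have hlow : -1 - mu < mu * y := by nlinarith
    rcases hkr.lt_or_eq with hkr | hkr
    · have hkr' : (k : ℝ) + 1 ≤ r := by exact_mod_cast hkr
      have : mu * y + k < lam - 1 := by linarith
      exact ⟨⟨by linarith, by linarith⟩, ⟨by linarith, by linarith⟩, this.ne, fun h => by linarith⟩
    · have hkr' : (k : ℝ) = r := by exact_mod_cast hkr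
      have : lam - 1 < mu * y + k := by linarith
      refine ⟨⟨by linarith, by linarith⟩, ⟨by linarith, by linarith⟩, this.ne', fun _ => ?_⟩
      rw [hkr']
      nlinarith
  · have hx := himp hgt
    have hk1 : k = 0 := by
      have h1 : (k : ℝ) < 1 := by nlinarith
      have : k < 1 := by exact_mod_cast h1
      omega
    subst hk1
    push_cast at *
    have hlow : -1 < mu * y := by nlinarith
    have hup : mu * y < -1 - mu := by nlinarith
    exact ⟨⟨by linarith, by linarith⟩, ⟨by linarith, by linarith⟩, by linarith, fun h => by linarith⟩

theorem isFinite_unit (n : ℤ) : IsFinite (unit lam n) := isFinite_ofFinite _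

theorem IsFinite.add {e e' : PrimarySeq lam} (h : IsFinite e) (h' : IsFinite e') :
    IsFinite (e + e') :=
  (h.union h').subset fun n hn => by
    by_contra h0
    simp_all [Function.mem_support]

theorem IsFinite.nsmul {e : PrimarySeq lam} (h : IsFinite e) (n : ℕ) : IsFinite (n • e) := by
  refine Set.Finite.subset h fun k hk => ?_
  simp only [Function.mem_support] at hk ⊢
  rintro h0
  simp [h0] at hk

theorem unit_apply (n m : ℤ) : (unit lam n).1 m = if m = n then 1 else 0 := by
  simp [unit, ofFinite, Pi.single_apply]

theorem nsmul_apply (k : ℕ) (e : PrimarySeq lam) (m : ℤ) : (k • e).1 m = k * e.1 m := by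
  simp

theorem add_apply (e e' : PrimarySeq lam) (m : ℤ) : (e + e').1 m = e.1 m + e'.1 m := rfl

theorem future_nsmul (hlam : 1 < lam) (k : ℕ) (e : PrimarySeq lam) :
    future lam (k • e).1 = k * future lam e.1 := by
  induction k with
  | zero => simp [future]
  | succ k ih => rw [succ_nsmul, future_add hlam, ih]; push_cast; ring

theorem past_eq_zero {e : ℤ → ℕ} (h : ∀ n ≤ 0, e n = 0) : past mu e = 0 := by
  have h1 : ∀ n : ℤ, (if n ≤ 0 then (e n : ℝ) * mu ^ (-n) else 0) = 0 := by
    intro n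
    split_ifs with hn
    · simp [h n hn]
    · rfl
  rw [past, tsum_congr h1, tsum_zero]

/-- The two finite sequences are the sides of λ⁻¹ = r λ⁻² + λ⁻³, placed in positive positions so
that the pasts vanish. A tail beyond r 0 r 0 … yields a digit above r, or a digit r followed by a
nonzero one; the tail from there exceeds all tails of both sequences unless it is exactly r 1 0 0 ….
-/
theorem collision_neg (hr : 0 < r) (hlam : 1 < lam) (hmul : lam * mu = -1) (hadd : lam + mu = r)
    (e : ℤ → ℕ) (N : ℤ) (hlex : LexLess (digitsNeg r) (fun k => e (N + k))) :
    (∃ N₀ : ℤ, ∀ n ≥ N₀, e n = 0) ∨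
    ∃ (N' : ℤ) (g h : PrimarySeq lam), IsFinite g ∧ IsFinite h ∧ g ≠ h ∧
      (∀ k, LexLess (tail g k) fun n => e (N' + n)) ∧
      (∀ k, LexLess (tail h k) fun n => e (N' + n)) ∧
      future lam g.1 = future lam h.1 ∧ past mu g.1 = past mu h.1 := by
  obtain ⟨N', hN'⟩ : ∃ N' : ℤ, r < e N' ∨ (e N' = r ∧ 0 < e (N' + 1)) := by
    obtain ⟨i, hi, hlt⟩ := hlex
    rcases Nat.even_or_odd i with h | h
    · exact ⟨N + i, Or.inl (by simpa [digitsNeg, h] using hlt)⟩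
    · obtain ⟨j, rfl⟩ := h
      refine ⟨N + (2 * j : ℕ), Or.inr ⟨?_, ?_⟩⟩
      · have := hi (2 * j) (by omega)
        simpa [digitsNeg] using this.symm
      · have h1 : ¬ Even (2 * j + 1) := by simp
        rw [digitsNeg, if_neg h1] at hlt
        convert hlt using 2
        push_cast; ring
  by_cases hz : ∃ N₀ : ℤ, ∀ n ≥ N₀, e n = 0
  · exact Or.inl hz
  push Not at hz
  have h0 : 0 < lam := by linarith
  have hone : ∀ f : ℕ → ℕ, f 0 ≤ 1 → (∀ n, 0 < n → f n = 0) → LexLess f fun n => e (N' + n) := by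
    intro f hf hf'
    by_cases h1 : f 0 < e N'
    · exact ⟨0, by simp, by simpa using h1⟩
    · rcases hN' with h2 | ⟨h2, h3⟩
      · omega
      · refine ⟨1, fun k hk => ?_, ?_⟩
        · obtain rfl : k = 0 := by omega
          simp only [Nat.cast_zero, add_zero]
          omega
        · rw [hf' 1 one_pos]; simpa using h3
  have hg : ∀ m, (r • unit lam 2 + unit lam 3).1 m =
      (if m = 2 then r else 0) + if m = 3 then 1 else 0 := by
    intro m
    rw [add_apply, nsmul_apply, unit_apply, unit_apply]
    simp
  refine Or.inr ⟨N', r • unit lam 2 + unit lam 3, unit lam 1,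
    ((isFinite_unit 2).nsmul r).add (isFinite_unit 3), isFinite_unit 1, ?_, ?_, ?_, ?_, ?_⟩
  · intro h
    have := congr_arg (fun f => f.1 1) h
    simp only [hg, unit_apply] at this
    norm_num at this
  · intro k
    rcases eq_or_ne k 2 with rfl | hk2
    · rcases hN' with h2 | ⟨h2, h3⟩
      · exact ⟨0, by simp, by simpa [tail, hg] using h2⟩
      · by_cases h4 : 1 < e (N' + 1)
        · refine ⟨1, fun k hk => ?_, ?_⟩
          · obtain rfl : k = 0 := by omega
            simp [tail, hg, h2]
          · simpa [tail, hg] using h4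
        -- Here the tail of `e` begins with r 1, as does that of the finite sequence; the next
        -- nonzero digit of `e` decides the comparison.
        · have h5 : ∃ m : ℕ, 2 ≤ m ∧ e (N' + m) ≠ 0 := by
            obtain ⟨n, hn, hne⟩ := hz (N' + 2)
            refine ⟨(n - N').toNat, by omega, ?_⟩
            convert hne using 2
            omega
          classical
          obtain ⟨h6, h7⟩ := Nat.find_spec h5
          refine ⟨Nat.find h5, fun k hk => ?_, ?_⟩
          · have h8 := Nat.find_min h5 hk
            rcases k with _ | _ | k
            · simp [tail, hg, h2]
            · have : e (N' + 1) = 1 := by omega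
              simp [tail, hg, this]
            · have : e (N' + (k + 2 : ℕ)) = 0 := by
                by_contra h9
                exact h8 ⟨by omega, h9⟩
              change (r • unit lam 2 + unit lam 3).1 (2 + (k + 2 : ℕ)) = e (N' + (k + 2 : ℕ))
              rw [this, hg]
              rw [if_neg (by omega), if_neg (by omega)]
          · simp only [tail, hg]
            rw [if_neg (by omega), if_neg (by omega)]
            omega
    · by_cases hk3 : k = 3
      · subst hk3
        apply hone
        · simp [tail, hg]
        · intro n hn
          simp only [tail, hg]
          rw [if_neg (by omega), if_neg (by omega)]
      · refine ⟨0, by simp, ?_⟩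
        simp only [tail, hg]
        rw [if_neg (by simpa using hk2), if_neg (by simpa using hk3)]
        simp only [Nat.cast_zero, add_zero]
        omega
  · intro k
    rcases eq_or_ne k 1 with rfl | hk1
    · apply hone
      · simp [tail, unit_apply]
      · intro n hn
        simp only [tail, unit_apply]
        rw [if_neg (by omega)]
    · refine ⟨0, by simp, ?_⟩
      simp only [tail, unit_apply]
      rw [if_neg (by simpa using hk1)]
      simp only [Nat.cast_zero, add_zero]
      omega
  · rw [future_add hlam, future_nsmul hlam, future_unit, future_unit, future_unit]
    norm_num
    have h1 : lam ^ 2 = r * lam + 1 := by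
      rw [← hadd]; nlinarith
    field_simp
    linarith
  · rw [past_eq_zero, past_eq_zero]
    · intro n hn
      rw [unit_apply, if_neg (by omega)]
    · intro n hn
      rw [hg, if_neg (by omega), if_neg (by omega)]

theorem numeration_neg (hr : 0 < r) (hlam : 1 < lam) (hirr : Irrational lam)
    (hmul : lam * mu = -1) (hadd : lam + mu = r) :
    Numeration lam mu r r (digitsNeg r) fun i => if Even i then 1 else lam⁻¹ := by
  have h0 : 0 < lam := by linarith
  have hmu : mu = -lam⁻¹ := by field_simp; linarith
  have hli : lam⁻¹ < 1 := inv_lt_one_of_one_lt₀ hlam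
  have hli0 : 0 < lam⁻¹ := by positivity
  have hr1 : (1 : ℝ) ≤ r := by exact_mod_cast hr
  refine ⟨hlam, hirr, hadd, ⟨-1, by norm_num, by simpa using hmul⟩, ?_, by simp [digitsNeg], by simp, ?_, ?_, ?_, by linarith,
    by linarith, by linarith, fun e he => region_neg hlam hmul hadd he,
    fun x y k => step_neg hlam hmul hadd, collision_neg hr hlam hmul hadd⟩
  · rw [hmu, abs_neg, abs_of_pos hli0]
  · intro i
    rcases Nat.even_or_odd i with h | h
    · have h1 : ¬ Even (i + 1) := by rw [Nat.even_add_one]; simpa using h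
      rw [if_neg h1, if_pos h, digitsNeg, if_pos h]; linarith
    · have h1 : Even (i + 1) := h.add_one
      have h2 : ¬ Even i := by simpa using h
      rw [if_pos h1, if_neg h2, digitsNeg, if_neg h2]; field_simp; simp
  · intro i
    split_ifs
    · exact one_pos
    · exact hli0
  · intro i
    split_ifs
    · exact le_rfl
    · exact hli.le

end NormNegOne

/-! ### Units of norm `1` -/

section NormOne

/-- The quasi-greedy expansion of `1` for `λ ^ 2 = r λ - 1`. -/
def digitsPos (r : ℕ) (i : ℕ) : ℕ := if i = 0 then r - 1 else r - 2

/-- The nonpositive positions end with the word `(r - 1) (r - 2) ⋯ (r - 2)`. -/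
def EndsCritical (r : ℕ) (e : ℤ → ℕ) : Prop :=
  ∃ j : ℕ, e (-j) = r - 1 ∧ ∀ i < j, e (-i) = r - 2

variable {lam mu : ℝ} {r : ℕ}

/-- Otherwise the tail starting at the digit r - 1 agrees with `d` up to position 0 and then exceeds
it. -/
theorem IsAdmissible.le_of_endsCritical {e : ℤ → ℕ} (h : IsAdmissible (digitsPos r) e)
    (hc : EndsCritical r e) : e 1 ≤ r - 2 := by
  by_contra hlt
  obtain ⟨j, hj, hj'⟩ := hc
  refine h (-j) ⟨j + 1, ?_, ?_⟩
  · intro k hk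
    rcases k with _ | k
    · simp [digitsPos, hj]
    · have := hj' (j - (k + 1)) (by omega)
      rw [digitsPos, if_neg (by omega), ← this]
      congr 1
      push_cast [Nat.cast_sub (show k + 1 ≤ j by omega)]
      ring
  · rw [digitsPos, if_neg (by omega)]
    simpa using hlt

theorem endsCritical_shift {e : PrimarySeq lam} :
    EndsCritical r (shift e).1 ↔ e.1 1 = r - 1 ∨ (e.1 1 = r - 2 ∧ EndsCritical r e.1) := by
  constructor
  · rintro ⟨j, hj, hj'⟩
    rcases j with _ | j
    · left; simpa [shift] using hj
    · right
      refine ⟨by simpa [shift] using hj' 0 (by omega), j, ?_, fun i hi => ?_⟩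
      · rw [← hj]; simp only [shift]; push_cast; ring_nf
      · rw [← hj' (i + 1) (by omega)]; simp only [shift]; push_cast; ring_nf
  · rintro (h | ⟨h, j, hj, hj'⟩)
    · exact ⟨0, by simpa [shift] using h, by simp⟩
    · refine ⟨j + 1, ?_, fun i hi => ?_⟩
      · rw [← hj]; simp only [shift]; push_cast; ring_nf
      · rcases i with _ | i
        · simpa [shift] using h
        · rw [← hj' i (by omega)]; simp only [shift]; push_cast; ring_nf

/-- The contraction argument of `region_neg`, with `EndsCritical` as the state linking past and
future: a past that is not critical has y ≤ λ - 1, while a critical past forces x ≤ 1 - μ = λ - (r -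
1). -/
theorem region_pos (hr : 3 ≤ r) (hlam : 1 < lam) (hmul : lam * mu = 1) (hadd : lam + mu = r)
    {e : PrimarySeq lam} (he : IsAdmissible (digitsPos r) e.1) :
    future lam e.1 ≤ 1 ∧ (r : ℝ) - 1 - (r - 1 : ℕ) ≤ past mu e.1 ∧ past mu e.1 ≤ lam ∧
      (lam - 1 < past mu e.1 → future lam e.1 ≤ lam - (r - 1 : ℕ)) := by
  have h0 : 0 < lam := by linarith
  have hmu : mu = lam⁻¹ := by field_simp; linarith
  have hmu0 : 0 < mu := by rw [hmu]; positivity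
  have habs : |mu| = lam⁻¹ := by rw [hmu, abs_of_pos (by positivity)]
  have hc : ((r - 1 : ℕ) : ℝ) = r - 1 := by push_cast [Nat.cast_sub (show 1 ≤ r by omega)]; ring
  rw [hc]
  obtain ⟨B, hB, hbd⟩ := exists_bound hlam habs (r - 1)
  have hle : ∀ e : PrimarySeq lam, IsAdmissible (digitsPos r) e.1 → ∀ n, e.1 n ≤ r - 1 :=
    fun e he n => he.le n
  have hdiv : ∀ x : ℝ, x / lam = mu * x := fun x => by rw [hmu]; field_simp
  have hQ : ∀ n : ℕ, ∀ e : PrimarySeq lam, IsAdmissible (digitsPos r) e.1 →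
      past mu e.1 ≤ lam + B / lam ^ n ∧
        (¬ EndsCritical r e.1 → past mu e.1 ≤ lam - 1 + B / lam ^ n) := by
    refine forall_div_pow_of_contraction (p := fun c => ∀ e : PrimarySeq lam,
      IsAdmissible (digitsPos r) e.1 → past mu e.1 ≤ lam + c ∧
        (¬ EndsCritical r e.1 → past mu e.1 ≤ lam - 1 + c)) hlam hB ?_ ?_
    · intro e he
      have := abs_le.1 (hbd e.1 (hle e he)).2
      constructor
      · linarith
      · intro; linarith
    · intro c hc ih e he
      obtain ⟨e', he', rfl⟩ := he.exists_shift_eq hlam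
      obtain ⟨h1, h2⟩ := ih e' he'
      rw [past_shift hlam habs, endsCritical_shift, hdiv]
      have h4 : mu * past mu e'.1 ≤ mu * (lam + c) := by gcongr
      have h3 := hle e' he' 1
      rcases Nat.lt_or_ge (e'.1 1) (r - 2) with hlt | hge
      · have h5 : (e'.1 1 : ℝ) + 3 ≤ r := by exact_mod_cast (by omega : e'.1 1 + 3 ≤ r)
        constructor
        · nlinarith
        · intro; nlinarith
      · rcases hge.eq_or_lt with heq | hlt
        · have h5 : (e'.1 1 : ℝ) + 2 = r := by exact_mod_cast (by omega : e'.1 1 + 2 = r)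
          constructor
          · nlinarith
          · intro hn
            have h6 : ¬ EndsCritical r e'.1 := fun h => hn (Or.inr ⟨heq.symm, h⟩)
            have h7 : mu * past mu e'.1 ≤ mu * (lam - 1 + c) := by gcongr; exact h2 h6
            nlinarith
        · have heq : e'.1 1 = r - 1 := by omega
          have h5 : (e'.1 1 : ℝ) + 1 = r := by exact_mod_cast (by omega : e'.1 1 + 1 = r)
          constructor
          · have h6 : ¬ EndsCritical r e'.1 := fun h => by
              have := he'.le_of_endsCritical h
              omega
            have h7 : mu * past mu e'.1 ≤ mu * (lam - 1 + c) := by gcongr; exact h2 h6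
            nlinarith
          · intro hn
            exact absurd (Or.inl heq) hn
  have hP : ∀ n : ℕ, ∀ e : PrimarySeq lam, IsAdmissible (digitsPos r) e.1 →
      future lam e.1 ≤ 1 + B / lam ^ n ∧
        (EndsCritical r e.1 → future lam e.1 ≤ 1 - mu + B / lam ^ n) := by
    refine forall_div_pow_of_contraction (p := fun c => ∀ e : PrimarySeq lam,
      IsAdmissible (digitsPos r) e.1 → future lam e.1 ≤ 1 + c ∧
        (EndsCritical r e.1 → future lam e.1 ≤ 1 - mu + c)) hlam hB ?_ ?_
    · intro e he
      have h1 := (hbd e.1 (hle e he)).1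
      have : mu ≤ 1 := by nlinarith
      constructor
      · linarith
      · intro _; linarith
    · intro c hc ih e he
      obtain ⟨h1, h2⟩ := ih (shift e) (isAdmissible_shift.2 he)
      rw [future_shift hlam] at h1 h2
      rw [endsCritical_shift] at h2
      have h3 := hle e he 1
      have h4 : 1 + c / lam = (lam + c) / lam := by field_simp
      have h5 : 1 - mu + c / lam = (lam - 1 + c) / lam := by rw [hmu]; field_simp
      rw [h4, h5, le_div_iff₀ h0, le_div_iff₀ h0]
      rcases Nat.lt_or_ge (e.1 1) (r - 2) with hlt | hge
      · have h5 : (e.1 1 : ℝ) + 3 ≤ r := by exact_mod_cast (by omega : e.1 1 + 3 ≤ r)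
        have : mu ≤ 1 := by nlinarith
        constructor
        · linarith
        · intro; linarith
      · rcases hge.eq_or_lt with heq | hlt
        · have h5 : (e.1 1 : ℝ) + 2 = r := by exact_mod_cast (by omega : e.1 1 + 2 = r)
          have : mu ≤ 1 := by nlinarith
          constructor
          · linarith
          · intro hn
            have := h2 (Or.inr ⟨heq.symm, hn⟩)
            linarith
        · have heq : e.1 1 = r - 1 := by omega
          have h5 : (e.1 1 : ℝ) + 1 = r := by exact_mod_cast (by omega : e.1 1 + 1 = r)
          constructor
          · have := h2 (Or.inl heq)
            linarith
          · intro hn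
            have := he.le_of_endsCritical hn
            omega
  refine ⟨le_of_forall_le_add_div_pow hlam fun n => (hP n e he).1, ?_,
    le_of_forall_le_add_div_pow hlam fun n => (hQ n e he).1, fun h => ?_⟩
  · have : 0 ≤ past mu e.1 := tsum_nonneg fun n => by split_ifs <;> positivity
    linarith
  · have hcrit : EndsCritical r e.1 := by
      by_contra hn
      have := le_of_forall_le_add_div_pow hlam fun n => (hQ n e he).2 hn
      linarith
    have := le_of_forall_le_add_div_pow hlam fun n => (hP n e he).2 hcrit
    linarith

/-- In the lower rectangle only the strip with digit r - 1 goes to the upper one. In the upper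
rectangle the digit is at most r - 2, and its strip with digit r - 2 stays in the upper rectangle.
-/
theorem step_pos (hr : 3 ≤ r) (hlam : 1 < lam) (hmul : lam * mu = 1) (hadd : lam + mu = r)
    {x y : ℝ} {k : ℤ} (h : InDomain lam r (r - 1) x y) (hk : (k : ℝ) < lam * x)
    (hk' : lam * x < k + 1) : InDomain lam r (r - 1) (lam * x - k) (mu * y + k) := by
  have h0 : 0 < lam := by linarith
  have hmu0 : 0 < mu := by
    by_contra hn
    nlinarith
  have hmu1 : mu < 1 := by nlinarith
  have hc : ((r - 1 : ℕ) : ℝ) = r - 1 := by push_cast [Nat.cast_sub (show 1 ≤ r by omega)]; ring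
  rw [InDomain, hc] at h ⊢
  obtain ⟨⟨hx0, hx1⟩, ⟨hy0, hy1⟩, hne, himp⟩ := h
  have hk0 : 0 ≤ k := by
    have : (-1 : ℝ) < k := by nlinarith
    have : -1 < k := by exact_mod_cast this
    omega
  have hkr : k ≤ r - 1 := by
    have h1 : (k : ℝ) < r := by nlinarith
    have : k < r := by exact_mod_cast h1
    omega
  have hk0' : (0 : ℝ) ≤ k := by exact_mod_cast hk0
  have hy0' : 0 < mu * y := by apply mul_pos hmu0; linarith
  rcases lt_or_gt_of_ne hne with hlt | hgt
  · have hup : mu * y < 1 - mu := by nlinarith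
    rcases hkr.lt_or_eq with hkr | hkr
    · have hkr' : (k : ℝ) + 2 ≤ r := by exact_mod_cast (by omega : k + 2 ≤ r)
      have : mu * y + k < lam - 1 := by linarith
      exact ⟨⟨by linarith, by linarith⟩, ⟨by linarith, by linarith⟩, this.ne, fun h => by linarith⟩
    · have hkr' : (k : ℝ) + 1 = r := by exact_mod_cast (by omega : k + 1 = r)
      have : lam - 1 < mu * y + k := by linarith
      refine ⟨⟨by linarith, by linarith⟩, ⟨by linarith, by linarith⟩, this.ne', fun _ => ?_⟩
      nlinarith
  · have hx := himp hgt
    have hup : mu * y < 1 := by nlinarith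
    have hlow : 1 - mu < mu * y := by nlinarith
    have hlx : lam * x < lam - 1 := by nlinarith
    have hkr2 : k ≤ r - 2 := by
      have h1 : (k : ℝ) < r - 1 := by linarith
      have : (k : ℝ) + 1 < r := by linarith
      have : k + 1 < r := by exact_mod_cast this
      omega
    rcases hkr2.lt_or_eq with hkr | hkr
    · have hkr' : (k : ℝ) + 3 ≤ r := by exact_mod_cast (by omega : k + 3 ≤ r)
      have : mu * y + k < lam - 1 := by linarith
      exact ⟨⟨by linarith, by linarith⟩, ⟨by linarith, by linarith⟩, this.ne, fun h => by linarith⟩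
    · have hkr' : (k : ℝ) + 2 = r := by exact_mod_cast (by omega : k + 2 = r)
      have : lam - 1 < mu * y + k := by linarith
      exact ⟨⟨by linarith, by linarith⟩, ⟨by linarith, by linarith⟩, this.ne', fun _ => by linarith⟩

/-- The sequence with the word `(r - 1) (r - 2) ⋯ (r - 2) (r - 1)` in the positions `2, …, j + 3`. -/
def criticalSeq (lam : ℝ) (r j : ℕ) : PrimarySeq lam :=
  ofFinite lam (fun n => if n = 2 ∨ n = j + 3 then r - 1
    else if 2 < n ∧ n < j + 3 then r - 2 else 0) <| (Set.finite_Icc (2 : ℤ) (j + 3)).subset <| by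
      intro n hn
      simp only [Function.mem_support, ne_eq] at hn
      rw [Set.mem_Icc]
      by_contra h
      rw [if_neg (by omega), if_neg (by omega)] at hn
      exact hn rfl

theorem criticalSeq_apply (j : ℕ) (n : ℤ) : (criticalSeq lam r j).1 n =
    if n = 2 ∨ n = j + 3 then r - 1 else if 2 < n ∧ n < j + 3 then r - 2 else 0 := rfl

/-- The right-hand side is the value of a 1 in position 1 and a 1 in position j + 4, so this is a
carry rule for the word (r - 1)(r - 2)…(r - 2)(r - 1). It is computed from the last digit backwards:
1 - μ is the value of the infinite tail of digits r - 2, and the correction caused by the final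
digit is multiplied by μ at each step. -/
theorem future_criticalSeq (hr : 3 ≤ r) (hlam : 1 < lam) (hmul : lam * mu = 1)
    (hadd : lam + mu = r) (j : ℕ) :
    future lam (criticalSeq lam r j).1 = lam⁻¹ + lam⁻¹ ^ (j + 4) := by
  have h0 : 0 < lam := by linarith
  set g := criticalSeq lam r j with hg
  have hmu : mu = lam⁻¹ := by field_simp; linarith
  rw [← hmu]
  have h2 : ((r - 2 : ℕ) : ℝ) = r - 2 := by push_cast [Nat.cast_sub (show 2 ≤ r by omega)]; ring
  have h1 : ((r - 1 : ℕ) : ℝ) = r - 1 := by push_cast [Nat.cast_sub (show 1 ≤ r by omega)]; ring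
  have key : ∀ i ≤ j, future lam (shift^[i + 2] g).1 = 1 - mu + mu ^ (j - i + 2) := by
    intro i hi
    induction hi using Nat.decreasingInduction with
    | self =>
      have h3 := future_eq_shift_iterate hlam g (j + 2)
      have h4 : future lam (shift^[j + 2 + 1] g).1 = 0 := by
        rw [future, tsum_congr, tsum_zero]
        intro n
        split_ifs with hn
        · rw [shift_iterate_apply, hg, criticalSeq_apply, if_neg (by push_cast; omega),
            if_neg (by push_cast; omega)]
          simp
        · rfl
      rw [h4, hg, criticalSeq_apply, if_pos (by push_cast; right; ring), h1, ← hg] at h3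
      have h5 : lam * future lam (shift^[j + 2] g).1 = lam * (1 - mu + mu ^ 2) := by nlinarith
      simpa using mul_left_cancel₀ h0.ne' h5
    | of_succ i hi ih =>
      have h3 := future_eq_shift_iterate hlam g (i + 2)
      rw [show i + 2 + 1 = i + 1 + 2 by ring, ih, hg, criticalSeq_apply,
        if_neg (by push_cast; omega), if_pos (by push_cast; omega), h2, ← hg] at h3
      have h6 : mu ^ (j - i + 2) = mu * mu ^ (j - (i + 1) + 2) := by
        rw [← pow_succ']; congr 1; omega
      have h5 : lam * future lam (shift^[i + 2] g).1 = lam * (1 - mu + mu ^ (j - i + 2)) := by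
        rw [h6]
        linear_combination -h3 + (1 - mu ^ (j - (i + 1) + 2)) * hmul - hadd
      exact mul_left_cancel₀ h0.ne' h5
  have h3 := future_eq_shift_iterate hlam g 1
  have h4 := future_eq_shift_iterate hlam g 0
  have h5 := key 0 (Nat.zero_le _)
  rw [hg, criticalSeq_apply, if_pos (Or.inl (by norm_num)), h1, ← hg] at h3
  rw [hg, criticalSeq_apply, if_neg (by rw [Nat.cast_zero]; omega), if_neg (by norm_num), ← hg] at h4
  simp only [Nat.cast_zero, sub_zero, Function.iterate_zero, id_eq, zero_add, tsub_zero] at h3 h4 h5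
  simp only [Nat.reduceAdd] at h3
  rw [h5, h4] at h3
  have h7 : future lam g.1 = mu ^ 2 * (lam * (lam * future lam g.1)) := by
    linear_combination -(future lam g.1 * (1 + lam * mu)) * hmul
  rw [h7, show lam * (lam * future lam g.1) = r - mu + mu ^ (j + 2) by linarith]
  rw [← hadd]
  linear_combination mu * hmul

/-- A tail beyond `d` starts with r - 1, then j digits r - 2, then a digit at least r - 1, unless it
has a digit at least r where it starts or j = 0 is taken. The carry rule `future_criticalSeq` for
this j supplies the two finite sequences; a tail that is not eventually zero is strictly beyond the
finite critical word. -/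
theorem collision_pos (hr : 3 ≤ r) (hlam : 1 < lam) (hmul : lam * mu = 1) (hadd : lam + mu = r)
    (e : ℤ → ℕ) (N : ℤ) (hlex : LexLess (digitsPos r) (fun k => e (N + k))) :
    (∃ N₀ : ℤ, ∀ n ≥ N₀, e n = 0) ∨
    ∃ (N' : ℤ) (g h : PrimarySeq lam), IsFinite g ∧ IsFinite h ∧ g ≠ h ∧
      (∀ k, LexLess (tail g k) fun n => e (N' + n)) ∧
      (∀ k, LexLess (tail h k) fun n => e (N' + n)) ∧
      future lam g.1 = future lam h.1 ∧ past mu g.1 = past mu h.1 := by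
  obtain ⟨j, hj⟩ : ∃ j : ℕ, r ≤ e N ∨ (e N = r - 1 ∧ (∀ i : ℕ, 0 < i → i ≤ j → e (N + i) = r - 2) ∧
      r - 1 ≤ e (N + j + 1)) := by
    obtain ⟨i, hi, hlt⟩ := hlex
    rcases i with _ | j
    · refine ⟨0, Or.inl ?_⟩
      simp only [digitsPos, Nat.cast_zero, add_zero, if_true] at hlt
      omega
    · refine ⟨j, Or.inr ⟨?_, fun i hi0 hij => ?_, ?_⟩⟩
      · simpa [digitsPos] using (hi 0 (by omega)).symm
      · have := hi i (by omega)
        rw [digitsPos, if_neg (by omega)] at this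
        exact this.symm
      · rw [digitsPos, if_neg (by omega)] at hlt
        push_cast at hlt
        rw [← add_assoc] at hlt
        omega
  by_cases hz : ∃ N₀ : ℤ, ∀ n ≥ N₀, e n = 0
  · exact Or.inl hz
  push Not at hz
  have h0 : 0 < lam := by linarith
  have hN0 : r - 1 ≤ e N := by omega
  have hN1 : r - 1 < e N ∨ 0 < e (N + 1) := by
    rcases hj with h | ⟨_, h2, h3⟩
    · left; omega
    · right
      rcases Nat.eq_zero_or_pos j with rfl | hj0
      · simp only [Nat.cast_zero, add_zero] at h3
        omega
      · have := h2 1 one_pos hj0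
        simp only [Nat.cast_one] at this
        omega
  have hzero : ∀ f : ℕ → ℕ, f 0 < r - 1 → LexLess f fun n => e (N + n) := by
    intro f hf
    exact ⟨0, by simp, by simpa using hf.trans_le hN0⟩
  refine Or.inr ⟨N, criticalSeq lam r j, unit lam 1 + unit lam (j + 4), isFinite_ofFinite _,
    (isFinite_unit 1).add (isFinite_unit _), ?_, ?_, ?_, ?_, ?_⟩
  · intro h
    have := congr_arg (fun f => f.1 1) h
    simp only [criticalSeq_apply, add_apply, unit_apply] at this
    rw [if_neg (by omega), if_neg (by omega), if_pos trivial] at this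
    omega
  · intro k
    by_cases hk2 : k = 2
    · subst hk2
      rcases hj with h2 | ⟨h2, h3, h4⟩
      · refine ⟨0, by simp, ?_⟩
        simp only [tail, criticalSeq_apply]
        rw [if_pos (by simp)]
        simp only [Nat.cast_zero, add_zero]
        omega
      · have hag : ∀ i ≤ j, tail (criticalSeq lam r j) 2 i = e (N + i) := by
          intro i hi
          simp only [tail, criticalSeq_apply]
          rcases Nat.eq_zero_or_pos i with rfl | hi0
          · rw [if_pos (by simp)]; simp [h2]
          · rw [if_neg (by omega), if_pos (by omega), h3 i hi0 hi]
        have hlast : tail (criticalSeq lam r j) 2 (j + 1) = r - 1 := by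
          simp only [tail, criticalSeq_apply]
          rw [if_pos (by push_cast; omega)]
        have hafter : ∀ i > j + 1, tail (criticalSeq lam r j) 2 i = 0 := by
          intro i hi
          simp only [tail, criticalSeq_apply]
          rw [if_neg (by omega), if_neg (by omega)]
        have hcast : e (N + (j + 1 : ℕ)) = e (N + j + 1) := by congr 1; push_cast; ring
        rcases h4.lt_or_eq with h4 | h4
        · refine ⟨j + 1, fun i hi => hag i (by omega), ?_⟩
          rw [hlast]
          exact h4.trans_eq hcast.symm
        · have h5 : ∃ m : ℕ, j + 2 ≤ m ∧ e (N + m) ≠ 0 := by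
            obtain ⟨n, hn, hne⟩ := hz (N + (j + 2))
            refine ⟨(n - N).toNat, by omega, ?_⟩
            convert hne using 2
            omega
          classical
          obtain ⟨h6, h7⟩ := Nat.find_spec h5
          refine ⟨Nat.find h5, fun i hi => ?_, ?_⟩
          · have h8 := Nat.find_min h5 hi
            rcases lt_trichotomy i (j + 1) with hij | rfl | hij
            · exact hag i (by omega)
            · rw [hlast, h4]; exact hcast.symm
            · rw [hafter i hij]
              by_contra h9
              exact h8 ⟨by omega, fun h => h9 h.symm⟩
          · rw [hafter _ (by omega)]
            exact Nat.pos_of_ne_zero h7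
    · by_cases hkj : k = j + 3
      · subst hkj
        have hf0 : tail (criticalSeq lam r j) (j + 3) 0 = r - 1 := by
          simp only [tail, criticalSeq_apply]
          rw [if_pos (by simp)]
        rcases hN1 with h2 | h2
        · exact ⟨0, by simp, by rw [hf0]; simpa using h2⟩
        · rcases hN0.lt_or_eq with h3 | h3
          · exact ⟨0, by simp, by rw [hf0]; simpa using h3⟩
          · refine ⟨1, fun i hi => ?_, ?_⟩
            · obtain rfl : i = 0 := by omega
              rw [hf0]; simpa using h3
            · simp only [tail, criticalSeq_apply]
              rw [if_neg (by push_cast; omega), if_neg (by push_cast; omega)]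
              simpa using h2
      · apply hzero
        simp only [tail, criticalSeq_apply, Nat.cast_zero, add_zero]
        rw [if_neg (by omega)]
        split_ifs <;> omega
  · intro k
    apply hzero
    simp only [tail, add_apply, unit_apply]
    split_ifs <;> omega
  · rw [future_criticalSeq hr hlam hmul hadd, future_add hlam, future_unit, future_unit,
      if_pos one_pos, if_pos (by omega)]
    rw [zpow_neg, zpow_neg, zpow_one, inv_pow]
    norm_cast
  · rw [past_eq_zero, past_eq_zero]
    · intro n hn
      rw [add_apply, unit_apply, unit_apply, if_neg (by omega), if_neg (by omega)]
    · intro n hn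
      rw [criticalSeq_apply, if_neg (by omega), if_neg (by omega)]

theorem numeration_pos (hr : 3 ≤ r) (hlam : 1 < lam) (hirr : Irrational lam)
    (hmul : lam * mu = 1) (hadd : lam + mu = r) :
    Numeration lam mu r (r - 1) (digitsPos r) fun i => if i = 0 then 1 else 1 - mu := by
  have h0 : 0 < lam := by linarith
  have hmu : mu = lam⁻¹ := by field_simp; linarith
  have hmu1 : mu < 1 := by rw [hmu]; exact inv_lt_one_of_one_lt₀ hlam
  have hmu0 : 0 < mu := by rw [hmu]; positivity
  have h2 : ((r - 2 : ℕ) : ℝ) = r - 2 := by push_cast [Nat.cast_sub (show 2 ≤ r by omega)]; ring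
  have h1 : ((r - 1 : ℕ) : ℝ) = r - 1 := by push_cast [Nat.cast_sub (show 1 ≤ r by omega)]; ring
  have hr3 : (3 : ℝ) ≤ r := by exact_mod_cast hr
  refine ⟨hlam, hirr, hadd, ⟨1, by norm_num, by simpa using hmul⟩, ?_, by simp [digitsPos], by simp, ?_, ?_, ?_, by rw [h1]; linarith,
    by rw [h1]; linarith, by rw [h1]; linarith, fun e he => region_pos hr hlam hmul hadd he,
    fun x y k => step_pos hr hlam hmul hadd, collision_pos hr hlam hmul hadd⟩
  · rw [hmu, abs_of_pos (by positivity)]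
  · intro i
    rcases Nat.eq_zero_or_pos i with rfl | h
    · simp only [zero_add, one_ne_zero, if_false, if_true, digitsPos, h1]; linarith
    · rw [if_neg (by omega), if_neg (by omega), digitsPos, if_neg (by omega), h2]
      linear_combination hmul - hadd
  · intro i
    split_ifs
    · exact one_pos
    · linarith
  · intro i
    split_ifs
    · exact le_rfl
    · linarith

end NormOne

/-! ### The L-shaped fundamental domain -/

section FundamentalDomain

variable {κ H : ℝ}

theorem floor_sub_eq (hκ0 : 0 < κ) (hκ1 : κ < 1) (a : ℝ) :
    (⌊a - κ⌋ : ℝ) = ⌊a⌋ - if a - ⌊a⌋ < κ then 1 else 0 := by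
  have h1 := Int.floor_le a
  have h2 := Int.lt_floor_add_one a
  split_ifs with h
  · have : ⌊a - κ⌋ = ⌊a⌋ - 1 := by
      rw [Int.floor_eq_iff]; push_cast; constructor <;> linarith
    rw [this]; push_cast; ring
  · have : ⌊a - κ⌋ = ⌊a⌋ := by
      rw [Int.floor_eq_iff]; constructor <;> linarith
    rw [this]; ring

/-- The lattice is generated by (1, -1) and (κ, H). For given n the horizontal condition forces m =
-⌊x + nκ⌋, and the height is then y + ⌊x + nκ⌋ + nH. From n - 1 to n it grows by H, plus 1 exactly
when the new abscissa is less than κ: this is the height of the L over the new point, so the least n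
with nonnegative height works. -/
theorem exists_mem_tile (hκ0 : 0 < κ) (hκ1 : κ < 1) (hH : 0 < H) (x y : ℝ) :
    ∃ m n : ℤ, (0 ≤ x + m + n * κ ∧ x + m + n * κ < 1) ∧ 0 ≤ y - m + n * H ∧
      y - m + n * H < H + if x + m + n * κ < κ then 1 else 0 := by
  obtain ⟨N, hN, hmax⟩ := Int.exists_greatest_of_bdd
    (P := fun n : ℤ => y + ⌊x + n * κ⌋ + n * H < 0)
    ⟨⌈(1 - x - y) / (κ + H)⌉, fun n hn => by
      have h1 := Int.lt_floor_add_one (x + n * κ)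
      have h2 : (n : ℝ) * (κ + H) < 1 - x - y := by linarith
      have h3 : (n : ℝ) < (1 - x - y) / (κ + H) := by rwa [lt_div_iff₀ (by linarith)]
      have h4 : (n : ℝ) ≤ ⌈(1 - x - y) / (κ + H)⌉ := h3.le.trans (Int.le_ceil _)
      exact_mod_cast h4⟩
    ⟨⌊-(x + y) / (κ + H)⌋ - 1, by
      have h1 := Int.floor_le (-(x + y) / (κ + H))
      rw [le_div_iff₀ (by linarith)] at h1
      have h2 := Int.floor_le (x + ((⌊-(x + y) / (κ + H)⌋ - 1 : ℤ) : ℝ) * κ)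
      push_cast at h2 ⊢
      linarith⟩
  have hN1 : ¬ y + ⌊x + (N + 1 : ℤ) * κ⌋ + (N + 1 : ℤ) * H < 0 := fun h => by
    have := hmax _ h
    omega
  have h3 := floor_sub_eq hκ0 hκ1 (x + (N + 1 : ℤ) * κ)
  have h4 : x + (N + 1 : ℤ) * κ - κ = x + N * κ := by push_cast; ring
  rw [h4] at h3
  have h1 := Int.floor_le (x + (N + 1 : ℤ) * κ)
  have h2 := Int.lt_floor_add_one (x + (N + 1 : ℤ) * κ)
  rw [h3] at hN
  refine ⟨-⌊x + (N + 1 : ℤ) * κ⌋, N + 1, ⟨?_, ?_⟩, ?_, ?_⟩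
  · push_cast at *; linarith
  · push_cast at *; linarith
  · push_cast at *; linarith
  · have h5 : x + ((-⌊x + (N + 1 : ℤ) * κ⌋ : ℤ) : ℝ) + (N + 1 : ℤ) * κ =
      x + (N + 1 : ℤ) * κ - ⌊x + (N + 1 : ℤ) * κ⌋ := by push_cast; ring
    rw [h5]
    push_cast at *
    linarith

/-- If n < n', the height at n' exceeds that at n by at least the last jump, which is the full
height of the L over the point for n'. -/
theorem tile_le (hκ0 : 0 < κ) (hκ1 : κ < 1) (hH : 0 < H) {x y : ℝ} {m n m' n' : ℤ}
    (hx : 0 ≤ x + m + n * κ ∧ x + m + n * κ < 1) (hy : 0 ≤ y - m + n * H)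
    (hx' : 0 ≤ x + m' + n' * κ ∧ x + m' + n' * κ < 1)
    (hy' : y - m' + n' * H < H + if x + m' + n' * κ < κ then 1 else 0) : n' ≤ n := by
  by_contra hlt
  have hm : ⌊x + n * κ⌋ = -m := by
    rw [Int.floor_eq_iff]; push_cast; constructor <;> linarith
  have hm' : ⌊x + n' * κ⌋ = -m' := by
    rw [Int.floor_eq_iff]; push_cast; constructor <;> linarith
  have h3 := floor_sub_eq hκ0 hκ1 (x + n' * κ)
  rw [hm'] at h3
  have h5 : x + n' * κ - ((-m' : ℤ) : ℝ) = x + m' + n' * κ := by push_cast; ring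
  rw [h5] at h3
  have hn : (n : ℝ) ≤ n' - 1 := by
    have : n ≤ n' - 1 := by omega
    exact_mod_cast this
  have h6 : ⌊x + n * κ⌋ ≤ ⌊x + n' * κ - κ⌋ := by
    apply Int.floor_le_floor
    nlinarith
  rw [hm] at h6
  have h7 : ((-m : ℤ) : ℝ) ≤ ⌊x + n' * κ - κ⌋ := by exact_mod_cast h6
  push_cast at *
  nlinarith

theorem tile_unique (hκ0 : 0 < κ) (hκ1 : κ < 1) (hH : 0 < H) {x y : ℝ} {m n m' n' : ℤ}
    (hx : 0 ≤ x + m + n * κ ∧ x + m + n * κ < 1) (hy : 0 ≤ y - m + n * H)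
    (hy1 : y - m + n * H < H + if x + m + n * κ < κ then 1 else 0)
    (hx' : 0 ≤ x + m' + n' * κ ∧ x + m' + n' * κ < 1) (hy' : 0 ≤ y - m' + n' * H)
    (hy1' : y - m' + n' * H < H + if x + m' + n' * κ < κ then 1 else 0) : m = m' ∧ n = n' := by
  obtain rfl : n = n' := le_antisymm (tile_le hκ0 hκ1 hH hx' hy' hx hy1)
    (tile_le hκ0 hκ1 hH hx hy hx' hy1')
  refine ⟨?_, rfl⟩
  have h1 : (m : ℝ) < m' + 1 := by linarith
  have h2 : (m' : ℝ) < m + 1 := by linarith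
  have h1 : m < m' + 1 := by exact_mod_cast h1
  have h2 : m' < m + 1 := by exact_mod_cast h2
  omega

end FundamentalDomain

/-! ### Generic points and their codes. -/

/-- Transcendental coordinates serve as genericity: the sides of the L and the jumps of the digit
function sit at algebraic values, and the condition is stable under the lattice translations and the
shift. -/
theorem transcendental_of_linear {x a b : ℝ} (ha : IsAlgebraic ℚ a) (hb : IsAlgebraic ℚ b)
    {z : ℝ} (hx : Transcendental ℚ x) (h : x = a * z + b) : Transcendental ℚ z := by
  intro hz
  apply hx
  rw [h]
  exact (ha.mul hz).add hb

theorem isAlgebraic_zpow {x : ℝ} (hx : IsAlgebraic ℚ x) (n : ℤ) : IsAlgebraic ℚ (x ^ n) := by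
  cases n with
  | ofNat n => simpa using hx.pow n
  | negSucc n => rw [zpow_negSucc]; exact (hx.pow _).inv

/-- Identifies bounded orbits of an expanding recursion. It is applied to digit sequences, to
recover prescribed coordinates, and to lifted orbits on the torus, to show that they are
eigenvectors. -/
theorem eq_zero_of_bounded_of_expanding {lam B : ℝ} (hlam : 1 < lam) {f : ℕ → ℝ}
    (hf : ∀ n, |f (n + 1)| = lam * |f n|) (hB : ∀ n, |f n| ≤ B) : f 0 = 0 := by
  have h1 : ∀ n, |f n| = lam ^ n * |f 0| := by
    intro n
    induction n with
    | zero => simp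
    | succ n ih => rw [hf, ih]; ring
  have h2 : |f 0| ≤ 0 := by
    refine le_of_forall_le_add_div_pow (B := B) hlam fun n => ?_
    have h3 := hB n
    rw [h1] at h3
    rw [zero_add, le_div_iff₀ (by positivity)]
    linarith
  simpa using h2

namespace Numeration

variable {lam mu : ℝ} {r c : ℕ} {d : ℕ → ℕ} {D : ℕ → ℝ}

theorem lam_pos (hN : Numeration lam mu r c d D) : 0 < lam := by linarith [hN.one_lt]

theorem isAlgebraic_lam (hN : Numeration lam mu r c d D) : IsAlgebraic ℚ lam := by
  obtain ⟨s, -, hs⟩ := hN.norm_unit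
  refine ⟨Polynomial.X ^ 2 - (Polynomial.C (r : ℚ) * Polynomial.X - Polynomial.C (s : ℚ)), ?_, ?_⟩
  · apply Polynomial.Monic.ne_zero
    apply Polynomial.monic_X_pow_sub
    refine (Polynomial.degree_sub_le _ _).trans_lt (max_lt ?_ ?_)
    · exact (Polynomial.degree_C_mul_X_le _).trans_lt (by norm_num)
    · exact Polynomial.degree_C_le.trans_lt (by norm_num)
  · simp only [map_sub, map_pow, map_mul, Polynomial.aeval_X, Polynomial.aeval_C]
    simp
    rw [← hs, ← hN.add_eq]
    ring

theorem isAlgebraic_mu (hN : Numeration lam mu r c d D) : IsAlgebraic ℚ mu := by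
  rw [show mu = r - lam by linarith [hN.add_eq]]
  exact (isAlgebraic_natCast r).sub hN.isAlgebraic_lam

theorem mu_ne_zero (hN : Numeration lam mu r c d D) : mu ≠ 0 := by
  rintro rfl
  have h := hN.abs_conj
  have : 0 < lam⁻¹ := by have := hN.lam_pos; positivity
  rw [abs_zero] at h
  linarith

theorem isAlgebraic_lattice (hN : Numeration lam mu r c d D) (p q : ℤ) :
    IsAlgebraic ℚ (p + q * lam) :=
  (isAlgebraic_intCast p).add ((isAlgebraic_intCast q).mul hN.isAlgebraic_lam)

theorem isAlgebraic_lattice_conj (hN : Numeration lam mu r c d D) (p q : ℤ) :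
    IsAlgebraic ℚ (p + q * mu) :=
  (isAlgebraic_intCast p).add ((isAlgebraic_intCast q).mul hN.isAlgebraic_mu)

theorem transcendental_add (hN : Numeration lam mu r c d D) {x : ℝ} (hx : Transcendental ℚ x)
    (p q : ℤ) : Transcendental ℚ (x + (p + q * lam)) :=
  transcendental_of_linear isAlgebraic_one (hN.isAlgebraic_lattice p q).neg hx (by ring)

theorem transcendental_sub (hN : Numeration lam mu r c d D) {y : ℝ} (hy : Transcendental ℚ y)
    (p q : ℤ) : Transcendental ℚ (y - (p + q * mu)) :=
  transcendental_of_linear isAlgebraic_one (hN.isAlgebraic_lattice_conj p q) hy (by ring)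

theorem inDomain_of_tile (hN : Numeration lam mu r c d D) {x y : ℝ} (hx : Transcendental ℚ x)
    (hy : Transcendental ℚ y) (h1 : 0 ≤ x) (h2 : x < 1) (h3 : 0 ≤ y - (r - 1 - c))
    (h4 : y - (r - 1 - c) < (c - mu) + if x < lam - c then 1 else 0) : InDomain lam r c x y := by
  have hadd := hN.add_eq
  have hx0 : x ≠ 0 := by rintro rfl; exact hx isAlgebraic_zero
  have hy0 : y ≠ (r : ℝ) - 1 - c := by
    rintro rfl
    exact hy (((isAlgebraic_natCast r).sub isAlgebraic_one).sub (isAlgebraic_natCast c))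
  have hy1 : y ≠ lam - 1 := by
    rintro rfl
    exact hy (hN.isAlgebraic_lam.sub isAlgebraic_one)
  refine ⟨⟨lt_of_le_of_ne h1 hx0.symm, h2⟩, ⟨lt_of_le_of_ne (by linarith) hy0.symm, ?_⟩, hy1, ?_⟩
  · split_ifs at h4 <;> linarith
  · intro h
    by_contra hn
    rw [if_neg hn] at h4
    linarith

theorem tile_of_inDomain (hN : Numeration lam mu r c d D) {x y : ℝ} (h : InDomain lam r c x y) :
    (0 ≤ x ∧ x < 1) ∧ 0 ≤ y - (r - 1 - c) ∧
      y - (r - 1 - c) < (c - mu) + if x < lam - c then 1 else 0 := by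
  have hadd := hN.add_eq
  obtain ⟨⟨hx0, hx1⟩, ⟨hy0, hy1⟩, hne, himp⟩ := h
  refine ⟨⟨hx0.le, hx1⟩, by linarith, ?_⟩
  split_ifs with h
  · linarith
  · have : y ≤ lam - 1 := by
      by_contra hn
      exact h (himp (by linarith))
    have := lt_of_le_of_ne this hne
    linarith

/-- Writing p + qλ = (p + qc) + q(λ - c) identifies Λ with the lattice of the L-shaped tile for κ =
λ - c and H = c - μ. -/
theorem exists_inDomain (hN : Numeration lam mu r c d D) {x y : ℝ} (hx : Transcendental ℚ x)
    (hy : Transcendental ℚ y) :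
    ∃ p q : ℤ, InDomain lam r c (x + (p + q * lam)) (y - (p + q * mu)) := by
  have h1 := hN.digit_lt
  have h2 := hN.lt_digit
  have h3 := hN.conj_lt
  obtain ⟨m, n, ⟨ha, hb⟩, hc, hd⟩ := exists_mem_tile (κ := lam - c) (H := c - mu) (by linarith)
    (by linarith) (by linarith) x (y - (r - 1 - c))
  have e1 : x + ((m - n * c : ℤ) + n * lam) = x + m + n * (lam - c) := by push_cast; ring
  have e2 : y - ((m - n * c : ℤ) + n * mu) - (r - 1 - c) =
    y - (r - 1 - c) - m + n * (c - mu) := by push_cast; ring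
  refine ⟨m - n * c, n, hN.inDomain_of_tile (hN.transcendental_add hx _ _)
    (hN.transcendental_sub hy _ _) ?_ ?_ ?_ ?_⟩
  · rw [e1]; exact ha
  · rw [e1]; exact hb
  · rw [e2]; exact hc
  · rw [e1, e2]; exact hd

theorem eq_zero_of_inDomain (hN : Numeration lam mu r c d D) {x y : ℝ} {p q : ℤ}
    (h : InDomain lam r c x y) (h' : InDomain lam r c (x + (p + q * lam)) (y - (p + q * mu))) :
    p = 0 ∧ q = 0 := by
  have h1 := hN.digit_lt
  have h2 := hN.lt_digit
  have h3 := hN.conj_lt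
  obtain ⟨ha, hb, hc⟩ := hN.tile_of_inDomain h
  obtain ⟨ha', hb', hc'⟩ := hN.tile_of_inDomain h'
  have e1 : x + (p + q * lam) = x + (p + q * c : ℤ) + q * (lam - c) := by push_cast; ring
  have e2 : y - (p + q * mu) - (r - 1 - c) =
    y - (r - 1 - c) - (p + q * c : ℤ) + q * (c - mu) := by push_cast; ring
  rw [e1] at ha' hc'
  rw [e2] at hb' hc'
  have := tile_unique (κ := lam - c) (H := c - mu) (x := x) (y := y - (r - 1 - c)) (m := 0) (n := 0)
    (m' := p + q * c) (n' := q) (by linarith) (by linarith) (by linarith) (by simpa using ha)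
    (by simpa using hb) (by simpa using hc) ha' hb' hc'
  obtain ⟨h4, rfl⟩ := this
  simp at h4
  exact ⟨h4.symm, rfl⟩

theorem eq_of_inDomain (hN : Numeration lam mu r c d D) {x y x' y' : ℝ} {p q : ℤ}
    (h : InDomain lam r c x y) (h' : InDomain lam r c x' y')
    (hx : x' = x + (p + q * lam)) (hy : y' = y - (p + q * mu)) : x = x' ∧ y = y' := by
  subst hx hy
  obtain ⟨rfl, rfl⟩ := hN.eq_zero_of_inDomain h h'
  simp

/-- Translates of a bounded sequence. -/
def translate (hN : Numeration lam mu r c d D) (e : ℤ → ℕ) (he : ∀ n, e n ≤ c) (m : ℤ) :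
    PrimarySeq lam :=
  ofBounded hN.one_lt (fun n => e (n + m)) c fun _ => he _

theorem shift_translate (hN : Numeration lam mu r c d D) (e : ℤ → ℕ) (he : ∀ n, e n ≤ c) (m : ℤ) :
    shift (hN.translate e he m) = hN.translate e he (m + 1) := by
  apply Subtype.ext
  ext n
  simp only [shift, translate, ofBounded]
  ring_nf

theorem inDomain_of_isAdmissible (hN : Numeration lam mu r c d D) {e : PrimarySeq lam}
    (he : IsAdmissible d e.1) (hx : Transcendental ℚ (future lam e.1))
    (hy : Transcendental ℚ (past mu e.1)) : InDomain lam r c (future lam e.1) (past mu e.1) := by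
  obtain ⟨h1, h2, h3, h4⟩ := hN.region e he
  have key : ∀ {x a : ℝ}, Transcendental ℚ x → IsAlgebraic ℚ a → x ≠ a := by
    rintro x a hx ha rfl; exact hx ha
  have hl := hN.isAlgebraic_lam
  refine ⟨⟨lt_of_le_of_ne (future_nonneg hN.one_lt _) (key hx isAlgebraic_zero).symm,
    lt_of_le_of_ne h1 (key hx isAlgebraic_one)⟩, ⟨lt_of_le_of_ne h2 (key hy
      (((isAlgebraic_natCast r).sub isAlgebraic_one).sub (isAlgebraic_natCast c))).symm,
    lt_of_le_of_ne h3 (key hy hl)⟩, key hy (hl.sub isAlgebraic_one), fun h =>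
    lt_of_le_of_ne (h4 h) (key hx (hl.sub (isAlgebraic_natCast c)))⟩

theorem transcendental_shift (hN : Numeration lam mu r c d D) {e : PrimarySeq lam} :
    (Transcendental ℚ (future lam (shift e).1) ↔ Transcendental ℚ (future lam e.1)) ∧
      (Transcendental ℚ (past mu (shift e).1) ↔ Transcendental ℚ (past mu e.1)) := by
  rw [future_shift hN.one_lt, past_shift hN.one_lt hN.abs_conj]
  have hl := hN.isAlgebraic_lam
  have hm := hN.isAlgebraic_mu
  have hd := isAlgebraic_natCast (R := ℚ) (A := ℝ) (e.1 1)
  have h0 := hN.lam_pos.ne'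
  have h1 := hN.mu_ne_zero
  refine ⟨⟨fun h => transcendental_of_linear hl hd.neg h (by ring),
    fun h => transcendental_of_linear hl.inv (hl.inv.mul hd) h (by field_simp; ring)⟩,
    ⟨fun h => transcendental_of_linear hm hd h (by ring),
    fun h => transcendental_of_linear hm.inv (hm.inv.mul hd).neg h (by field_simp; ring)⟩⟩

/-- A common value of future and past determines the two digits next to the origin. -/
theorem digits_eq (hN : Numeration lam mu r c d D) {e e' : PrimarySeq lam}
    (he : IsAdmissible d e.1) (he' : IsAdmissible d e'.1)
    (hx : Transcendental ℚ (future lam e.1)) (hy : Transcendental ℚ (past mu e.1))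
    (hxx : future lam e.1 = future lam e'.1) (hyy : past mu e.1 = past mu e'.1) :
    e.1 1 = e'.1 1 ∧ e.1 0 = e'.1 0 := by
  have hlam := hN.one_lt
  have h0 := hN.lam_pos.ne'
  have hm0 := hN.mu_ne_zero
  obtain ⟨s, hs, hls⟩ := hN.norm_unit
  constructor
  · have h1 := hN.inDomain_of_isAdmissible (isAdmissible_shift.2 he)
      (hN.transcendental_shift.1.2 hx) (hN.transcendental_shift.2.2 hy)
    have h2 := hN.inDomain_of_isAdmissible (isAdmissible_shift.2 he')
      (hN.transcendental_shift.1.2 (hxx ▸ hx)) (hN.transcendental_shift.2.2 (hyy ▸ hy))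
    -- The shifted points differ by the vector of Λ with ξ = ε₁ - ε'₁, and both lie in the
    -- fundamental domain.
    have h3 := (hN.eq_of_inDomain h1 h2 (p := e.1 1 - e'.1 1) (q := 0)
      (by rw [future_shift hlam, future_shift hlam, hxx]; push_cast; ring)
      (by rw [past_shift hlam hN.abs_conj, past_shift hlam hN.abs_conj, hyy]; push_cast; ring)).1
    rw [future_shift hlam, future_shift hlam, hxx] at h3
    have : (e.1 1 : ℝ) = e'.1 1 := by linarith
    exact_mod_cast this
  · obtain ⟨f, hf, rfl⟩ := he.exists_shift_eq hlam
    obtain ⟨f', hf', rfl⟩ := he'.exists_shift_eq hlam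
    rw [hN.transcendental_shift.1] at hx
    rw [hN.transcendental_shift.2] at hy
    have hx' : Transcendental ℚ (future lam f'.1) :=
      hN.transcendental_shift.1.1 (hxx ▸ hN.transcendental_shift.1.2 hx)
    have hy' : Transcendental ℚ (past mu f'.1) :=
      hN.transcendental_shift.2.1 (hyy ▸ hN.transcendental_shift.2.2 hy)
    rw [future_shift hlam, future_shift hlam] at hxx
    rw [past_shift hlam hN.abs_conj, past_shift hlam hN.abs_conj] at hyy
    have h1 := hN.inDomain_of_isAdmissible hf hx hy
    have h2 := hN.inDomain_of_isAdmissible hf' hx' hy'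
    have hadd := hN.add_eq
    have hs' : (s : ℝ) * s = 1 := by exact_mod_cast hs
    -- The futures of `f` and `f'` differ by λ⁻¹ times the difference of the digits in position 1,
    -- and λ⁻¹ = sμ = s(r - λ) lies in ℤ[λ].
    have h3 := (hN.eq_of_inDomain h1 h2 (p := s * r * (f'.1 1 - f.1 1))
      (q := -s * (f'.1 1 - f.1 1)) (by
        apply mul_left_cancel₀ h0
        push_cast
        linear_combination -hxx + s * lam * ((f'.1 1 : ℝ) - f.1 1) * hadd -
          s * ((f'.1 1 : ℝ) - f.1 1) * hls - ((f'.1 1 : ℝ) - f.1 1) * hs') (by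
        apply mul_left_cancel₀ hm0
        push_cast
        linear_combination -hyy - s * mu * ((f'.1 1 : ℝ) - f.1 1) * hadd +
          s * ((f'.1 1 : ℝ) - f.1 1) * hls + ((f'.1 1 : ℝ) - f.1 1) * hs')).1
    rw [h3] at hxx
    have : (f.1 1 : ℝ) = f'.1 1 := by linarith
    have : f.1 1 = f'.1 1 := by exact_mod_cast this
    simpa [shift] using this

/-- Once the digits at the origin agree, the hypotheses pass to both the shifted and the unshifted
sequences, so agreement spreads in both directions. -/
theorem eq_of_future_eq (hN : Numeration lam mu r c d D) {e e' : PrimarySeq lam}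
    (he : IsAdmissible d e.1) (he' : IsAdmissible d e'.1)
    (hx : Transcendental ℚ (future lam e.1)) (hy : Transcendental ℚ (past mu e.1))
    (hxx : future lam e.1 = future lam e'.1) (hyy : past mu e.1 = past mu e'.1) : e = e' := by
  have hlam := hN.one_lt
  have hfwd : ∀ n : ℕ, ∀ e e' : PrimarySeq lam, IsAdmissible d e.1 → IsAdmissible d e'.1 →
      Transcendental ℚ (future lam e.1) → Transcendental ℚ (past mu e.1) →
      future lam e.1 = future lam e'.1 → past mu e.1 = past mu e'.1 →
      e.1 (n + 1) = e'.1 (n + 1) := by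
    intro n
    induction n with
    | zero =>
      intro e e' he he' hx hy hxx hyy
      simpa using (hN.digits_eq he he' hx hy hxx hyy).1
    | succ n ih =>
      intro e e' he he' hx hy hxx hyy
      have h1 := (hN.digits_eq he he' hx hy hxx hyy).1
      have := ih (shift e) (shift e') (isAdmissible_shift.2 he) (isAdmissible_shift.2 he')
        (hN.transcendental_shift.1.2 hx) (hN.transcendental_shift.2.2 hy)
        (by rw [future_shift hlam, future_shift hlam, hxx, h1])
        (by rw [past_shift hlam hN.abs_conj, past_shift hlam hN.abs_conj, hyy, h1])
      simpa [shift] using this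
  have hbwd : ∀ n : ℕ, ∀ e e' : PrimarySeq lam, IsAdmissible d e.1 → IsAdmissible d e'.1 →
      Transcendental ℚ (future lam e.1) → Transcendental ℚ (past mu e.1) →
      future lam e.1 = future lam e'.1 → past mu e.1 = past mu e'.1 →
      e.1 (-n) = e'.1 (-n) := by
    intro n
    induction n with
    | zero =>
      intro e e' he he' hx hy hxx hyy
      simpa using (hN.digits_eq he he' hx hy hxx hyy).2
    | succ n ih =>
      intro e e' he he' hx hy hxx hyy
      have h1 := (hN.digits_eq he he' hx hy hxx hyy).2
      obtain ⟨f, hf, rfl⟩ := he.exists_shift_eq hlam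
      obtain ⟨f', hf', rfl⟩ := he'.exists_shift_eq hlam
      rw [hN.transcendental_shift.1] at hx
      rw [hN.transcendental_shift.2] at hy
      rw [future_shift hlam, future_shift hlam] at hxx
      rw [past_shift hlam hN.abs_conj, past_shift hlam hN.abs_conj] at hyy
      have h2 : (f.1 1 : ℝ) = f'.1 1 := by
        have : f.1 1 = f'.1 1 := by simpa [shift] using h1
        exact_mod_cast this
      have := ih f f' hf hf' hx hy
        (mul_left_cancel₀ hN.lam_pos.ne' (by linarith)) (mul_left_cancel₀ hN.mu_ne_zero (by linarith))
      simp only [shift]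
      rw [show -((n + 1 : ℕ) : ℤ) + 1 = -(n : ℤ) by push_cast; ring]
      exact this
  apply Subtype.ext
  ext n
  rcases lt_or_ge 0 n with h | h
  · obtain ⟨m, rfl⟩ : ∃ m : ℕ, n = m + 1 := ⟨(n - 1).toNat, by omega⟩
    exact hfwd m e e' he he' hx hy hxx hyy
  · obtain ⟨m, rfl⟩ : ∃ m : ℕ, n = -m := ⟨(-n).toNat, by omega⟩
    exact hbwd m e e' he he' hx hy hxx hyy

/-- For every n ∈ ℤ let (X n, Y n) be the representative in the L of (λ^n x, μ^n y) modulo Λ. Since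
the L is a fundamental domain preserved by the digit map, uniqueness forces consecutive
representatives to be related by that map. This gives a two-sided orbit without inverting the map,
and its digits are the code. -/
theorem exists_code (hN : Numeration lam mu r c d D) {x y : ℝ} (hx : Transcendental ℚ x)
    (hy : Transcendental ℚ y) (hxy : InDomain lam r c x y) :
    ∃ e : PrimarySeq lam, IsAdmissible d e.1 ∧ future lam e.1 = x ∧ past mu e.1 = y := by
  have hlam := hN.one_lt
  have h0 := hN.lam_pos
  have hm0 := hN.mu_ne_zero
  obtain ⟨s, hs, hls⟩ := hN.norm_unit
  have hadd := hN.add_eq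
  have hxn : ∀ n : ℤ, Transcendental ℚ (lam ^ n * x) := fun n =>
    transcendental_of_linear (isAlgebraic_zpow hN.isAlgebraic_lam n).inv isAlgebraic_zero hx
      (by have : lam ^ n ≠ 0 := by positivity
          rw [inv_mul_cancel_left₀ this, add_zero])
  have hyn : ∀ n : ℤ, Transcendental ℚ (mu ^ n * y) := fun n =>
    transcendental_of_linear (isAlgebraic_zpow hN.isAlgebraic_mu n).inv isAlgebraic_zero hy
      (by have : mu ^ n ≠ 0 := zpow_ne_zero _ hm0
          rw [inv_mul_cancel_left₀ this, add_zero])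
  choose p q hpq using fun n => hN.exists_inDomain (hxn n) (hyn n)
  set X : ℤ → ℝ := fun n => lam ^ n * x + (p n + q n * lam) with hX
  set Y : ℤ → ℝ := fun n => mu ^ n * y - (p n + q n * mu) with hY
  have hXY : ∀ n, InDomain lam r c (X n) (Y n) := hpq
  have hXt : ∀ n, Transcendental ℚ (X n) := fun n => hN.transcendental_add (hxn n) _ _
  have hzero : X 0 = x ∧ Y 0 = y := by
    obtain ⟨h1, h2⟩ := hN.eq_of_inDomain hxy (hXY 0) (p := p 0) (q := q 0)
      (by simp [hX]) (by simp [hY])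
    exact ⟨h1.symm, h2.symm⟩
  set k : ℤ → ℤ := fun n => ⌊lam * X n⌋ with hk
  have hklt : ∀ n, (k n : ℝ) < lam * X n := by
    intro n
    refine lt_of_le_of_ne (Int.floor_le _) fun h => ?_
    exact transcendental_of_linear (z := (k n : ℝ)) hN.isAlgebraic_lam.inv isAlgebraic_zero (hXt n)
      (by rw [h]; field_simp; ring) (isAlgebraic_intCast _)
  have hklt' : ∀ n, lam * X n < k n + 1 := fun n => Int.lt_floor_add_one _
  have hrec : ∀ n, X (n + 1) = lam * X n - k n ∧ Y (n + 1) = mu * Y n + k n := by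
    intro n
    have h1 := hN.step _ _ _ (hXY n) (hklt n) (hklt' n)
    -- The coefficients come from λ(p + qλ) = -qs + (p + qr)λ.
    refine hN.eq_of_inDomain (hXY (n + 1)) h1
      (p := -(q n) * s - k n - p (n + 1)) (q := p n + q n * r - q (n + 1)) ?_ ?_
    · simp only [hX]
      rw [zpow_add_one₀ h0.ne']
      push_cast
      linear_combination q n * lam * hadd - q n * hls
    · simp only [hY]
      rw [zpow_add_one₀ hm0]
      push_cast
      linear_combination -(q n * mu) * hadd + q n * hls
  have hk0 : ∀ n, 0 ≤ k n := fun n => Int.floor_nonneg.2 (by have := (hXY n).1.1; positivity)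
  have hkc : ∀ n, k n ≤ c := by
    intro n
    have h1 := hklt n
    have h2 := (hXY n).1.2
    have h3 := hN.lt_digit
    have : (k n : ℝ) < c + 1 := by nlinarith
    have : k n < c + 1 := by exact_mod_cast this
    omega
  -- The index moves by one because the digit in position 1 is the integer part of λ times the
  -- future.
  set e : ℤ → ℕ := fun n => (k (n - 1)).toNat with he
  have hec : ∀ n, e n ≤ c := fun n => by
    have := hkc (n - 1)
    simp only [he]; omega
  have hek : ∀ n, (e (n + 1) : ℝ) = k n := by
    intro n
    have h1 : (e (n + 1) : ℤ) = k n := by simp [he, hk0]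
    exact_mod_cast h1
  obtain ⟨B, hB, hbd⟩ := exists_bound hlam hN.abs_conj c
  set S : ℤ → PrimarySeq lam := hN.translate e hec with hS
  have hbdS : ∀ m, future lam (S m).1 ≤ B ∧ |past mu (S m).1| ≤ B := fun m => hbd _ fun n => hec _
  have hSshift : ∀ m, shift (S m) = S (m + 1) := hN.shift_translate e hec
  have hS1 : ∀ m, ((S m).1 1 : ℝ) = k m := by
    intro m
    rw [← hek, add_comm]; rfl
  have hF : ∀ m, future lam (S (m + 1)).1 = lam * future lam (S m).1 - k m := by
    intro m
    rw [← hSshift, future_shift hlam, hS1]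
  have hP : ∀ m, past mu (S (m + 1)).1 = mu * past mu (S m).1 + k m := by
    intro m
    rw [← hSshift, past_shift hlam hN.abs_conj, hS1]
  refine ⟨S 0, ?_, ?_, ?_⟩
  · rintro N ⟨i, hi, hlt⟩
    have hS0 : ∀ j : ℕ, (S 0).1 (N + j) = e (N + j) := by
      intro j
      simp [hS, translate, ofBounded]
    simp only [hS0] at hi hlt
    have hXrec : ∀ j : ℕ, X (N - 1 + (j + 1 : ℕ)) = lam * X (N - 1 + j) - e (N + j) := by
      intro j
      rw [show N - 1 + (j + 1 : ℕ) = N - 1 + j + 1 by push_cast; ring, (hrec _).1, ← hek]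
      congr 3
      ring
    -- As long as the digits follow `d`, the orbit stays strictly below `D`; a digit above `d i`
    -- would then make the next `X` less than `D (i + 1) - 1 ≤ 0`.
    have h1 : ∀ j ≤ i, X (N - 1 + j) < D j := by
      intro j hj
      induction j with
      | zero => rw [hN.value_zero]; exact (hXY _).1.2
      | succ j ih =>
        rw [hXrec, hN.value_succ, hi j (by omega)]
        have := ih (by omega)
        gcongr
    have h2 := h1 i le_rfl
    have h3 := (hXY (N - 1 + (i + 1 : ℕ))).1.1
    rw [hXrec] at h3
    have h4 := hN.value_succ i
    have h5 := hN.value_le (i + 1)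
    have h6 : (d i : ℝ) + 1 ≤ e (N + i) := by exact_mod_cast hlt
    have h7 : lam * X (N - 1 + i) < lam * D i := by gcongr
    linarith
  -- Errors in the future expand by λ forward in time; for the past, below, they expand by |μ|⁻¹ = λ
  -- backward in time.
  · have := eq_zero_of_bounded_of_expanding (B := B + 1) hlam
      (f := fun n : ℕ => future lam (S n).1 - X n) (fun n => ?_) fun n => ?_
    · simp only [Nat.cast_zero, hzero.1] at this
      linarith
    · rw [Nat.cast_succ, hF, (hrec _).1, show lam * future lam (S n).1 - k n - (lam * X n - k n) =
        lam * (future lam (S n).1 - X n) by ring, abs_mul, abs_of_pos h0]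
    · have h1 := (hbdS n).1
      have h2 := future_nonneg hlam (S n).1
      have h3 := (hXY n).1
      rw [abs_le]
      constructor <;> linarith
  · have := eq_zero_of_bounded_of_expanding (B := B + (1 + r + c + lam)) hlam
      (f := fun n : ℕ => past mu (S (-n)).1 - Y (-n)) (fun n => ?_) fun n => ?_
    · simp only [Nat.cast_zero, neg_zero, hzero.2] at this
      linarith
    · have h1 := hP (-((n + 1 : ℕ) : ℤ))
      have h2 := (hrec (-((n + 1 : ℕ) : ℤ))).2
      rw [show -((n + 1 : ℕ) : ℤ) + 1 = -n by push_cast; ring] at h1 h2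
      rw [h1, h2, show ∀ a b z : ℝ, mu * a + z - (mu * b + z) = mu * (a - b) by intros; ring,
        abs_mul, hN.abs_conj]
      field_simp
    · have h1 := abs_le.1 (hbdS (-n)).2
      have h3 := (hXY (-n)).2.1
      have h4 : (0 : ℝ) ≤ r := by positivity
      have h5 : (0 : ℝ) ≤ c := by positivity
      rw [abs_le]
      constructor <;> linarith

/-- Modulo the lattice of the pairs `(ξ, -ξ')`, with `ξ ∈ ℤ[λ]`, each generic point has a unique
admissible code. -/
theorem existsUnique_code (hN : Numeration lam mu r c d D) {x y : ℝ} (hx : Transcendental ℚ x)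
    (hy : Transcendental ℚ y) :
    ∃! e : PrimarySeq lam, IsAdmissible d e.1 ∧
      ∃ p q : ℤ, future lam e.1 = x + (p + q * lam) ∧ past mu e.1 = y - (p + q * mu) := by
  obtain ⟨p, q, hpq⟩ := hN.exists_inDomain hx hy
  obtain ⟨e, he, h1, h2⟩ := hN.exists_code (hN.transcendental_add hx p q)
    (hN.transcendental_sub hy p q) hpq
  refine ⟨e, ⟨he, p, q, h1, h2⟩, ?_⟩
  rintro e' ⟨he', p', q', h1', h2'⟩
  have hx' : Transcendental ℚ (future lam e'.1) := h1' ▸ hN.transcendental_add hx _ _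
  have hy' : Transcendental ℚ (past mu e'.1) := h2' ▸ hN.transcendental_sub hy _ _
  have h3 := hN.inDomain_of_isAdmissible he' hx' hy'
  obtain ⟨h4, h5⟩ := hN.eq_of_inDomain h3 hpq (p := p - p') (q := q - q')
    (by rw [h1']; push_cast; ring) (by rw [h2']; push_cast; ring)
  exact hN.eq_of_future_eq he' he hx' hy' (h4.trans h1.symm) (h5.trans h2.symm)

end Numeration

/-! ### The torus and the homoclinic points -/

/-- The projection of the plane onto the torus. -/
def proj : (Fin 2 → ℝ) →+ UnitAddTorus (Fin 2) where
  toFun y i := (y i : UnitAddCircle)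
  map_zero' := by ext i; simp
  map_add' x y := by ext i; simp

theorem proj_apply (y : Fin 2 → ℝ) (i : Fin 2) : proj y i = (y i : UnitAddCircle) := rfl

theorem continuous_proj : Continuous proj :=
  continuous_pi fun i => (AddCircle.continuous_mk' (1 : ℝ)).comp (continuous_apply i)

theorem proj_surjective : Function.Surjective proj := by
  intro z
  choose y hy using fun i => QuotientAddGroup.mk_surjective (z i)
  exact ⟨y, funext hy⟩

theorem proj_eq_zero_iff {y : Fin 2 → ℝ} : proj y = 0 ↔ ∃ k : Fin 2 → ℤ, ∀ i, y i = k i := by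
  rw [funext_iff, ← Classical.skolem (p := fun (i : Fin 2) (k : ℤ) => y i = k)]
  refine forall_congr' fun i => ?_
  rw [proj_apply, Pi.zero_apply, AddCircle.coe_eq_zero_iff]
  simp [eq_comm]

theorem proj_eq_iff {y y' : Fin 2 → ℝ} :
    proj y = proj y' ↔ ∃ k : Fin 2 → ℤ, ∀ i, y i = y' i + k i := by
  rw [← sub_eq_zero, ← map_sub, proj_eq_zero_iff]
  simp [sub_eq_iff_eq_add']

theorem toralMap_proj (M : Matrix (Fin 2) (Fin 2) ℤ) (y : Fin 2 → ℝ) :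
    toralMap M (proj y) = proj fun i => ∑ j, (M i j : ℝ) * y j := by
  ext i
  simp only [toralMap, proj_apply, Fin.sum_univ_two, AddCircle.coe_add]
  congr 1 <;> rw [← AddCircle.coe_zsmul, zsmul_eq_mul]

/-- The section of `proj` with values in the unit square carries Haar measure to Lebesgue measure
restricted to the square, so planar null sets pull back to null sets. -/
theorem ae_of_ae_proj {p : UnitAddTorus (Fin 2) → Prop} (h : ∀ᵐ y : Fin 2 → ℝ, p (proj y)) :
    ∀ᵐ z : UnitAddTorus (Fin 2), p z := by
  have h1 : MeasureTheory.MeasurePreserving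
      (fun x : UnitAddCircle => (AddCircle.equivIoc (1 : ℝ) 0 x : ℝ)) MeasureTheory.volume
      (MeasureTheory.volume.restrict (Set.Ioc 0 (0 + 1))) := by
    have h2 := AddCircle.measurePreserving_equivIoc 1 (a := 0)
    refine MeasureTheory.MeasurePreserving.comp ⟨measurable_subtype_coe, ?_⟩ h2
    exact map_comap_subtype_coe measurableSet_Ioc _
  have h3 := MeasureTheory.measurePreserving_pi (ι := Fin 2) _ _ fun _ => h1
  rw [← MeasureTheory.Measure.restrict_pi_pi (fun _ : Fin 2 => MeasureTheory.volume)
    (fun _ => Set.Ioc (0 : ℝ) (0 + 1))] at h3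
  have h4 := h3.quasiMeasurePreserving.mono_right
    MeasureTheory.Measure.restrict_le_self.absolutelyContinuous
  filter_upwards [h4.ae h] with z hz
  convert hz
  ext i
  exact ((AddCircle.equivIoc (1 : ℝ) 0).symm_apply_apply (z i)).symm

/-- A surjective linear functional carries Lebesgue measure to a (possibly infinite) multiple of
Lebesgue measure on the line. -/
theorem ae_functional {ℓ : (Fin 2 → ℝ) →ₗ[ℝ] ℝ} (hℓ : Function.Surjective ℓ) {F : Set ℝ}
    (hF : MeasureTheory.volume F = 0) : ∀ᵐ y : Fin 2 → ℝ, ℓ y ∉ F := by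
  obtain ⟨c, -, -, hc⟩ := ℓ.exists_map_addHaar_eq_smul_addHaar' MeasureTheory.volume
    MeasureTheory.volume hℓ
  have h1 : MeasureTheory.Measure.map ℓ MeasureTheory.volume F = 0 := by
    rw [hc]; simp [hF]
  exact MeasureTheory.ae_of_ae_map ℓ.continuous_of_finiteDimensional.measurable.aemeasurable
    (MeasureTheory.measure_eq_zero_iff_ae_notMem.1 h1)

/-- The conjugate of `homoclinicPoint M u v`. -/
def conjPoint (M : Matrix (Fin 2) (Fin 2) ℤ) (u v : ℤ) : Fin 2 → ℝ := fun i =>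
  -((((![-v, u] i : ℤ) : ℝ) + (((-M.det) • M.mulVec ![-v, u]) i : ℤ) * conjEigen M) /
    √(disc M : ℝ))

/-- The linear map `(x, y) ↦ x t - y t'`, where `t` is a homoclinic point and `t'` its conjugate. -/
def planeMap (M : Matrix (Fin 2) (Fin 2) ℤ) (u v : ℤ) : (Fin 2 → ℝ) →ₗ[ℝ] (Fin 2 → ℝ) where
  toFun x i := x 0 * homoclinicPoint M u v i - x 1 * conjPoint M u v i
  map_add' x y := by ext i; simp only [Pi.add_apply]; ring
  map_smul' a x := by ext i; simp only [Pi.smul_apply, smul_eq_mul, RingHom.id_apply]; ring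

theorem planeMap_apply (M : Matrix (Fin 2) (Fin 2) ℤ) (u v : ℤ) (x : Fin 2 → ℝ) (i : Fin 2) :
    planeMap M u v x i = x 0 * homoclinicPoint M u v i - x 1 * conjPoint M u v i := rfl

/-- A hyperbolic element of `GL(2, ℤ)` with positive trace. -/
structure IsHyperbolicUnit (M : Matrix (Fin 2) (Fin 2) ℤ) : Prop where
  isUnit_det : IsUnit M.det
  isHyperbolic : IsHyperbolic M
  trace_pos : 0 < M.trace

namespace IsHyperbolicUnit

variable {M : Matrix (Fin 2) (Fin 2) ℤ}

theorem one_lt (hM : IsHyperbolicUnit M) : 1 < eigen M :=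
  one_lt_eigen hM.1 hM.2 hM.3

theorem eigen_pos (hM : IsHyperbolicUnit M) : 0 < eigen M := by linarith [hM.one_lt]

theorem mul_eq (hM : IsHyperbolicUnit M) : eigen M * conjEigen M = M.det :=
  eigen_mul_conjEigen hM.1 hM.2 hM.3

theorem sqrt_pos (hM : IsHyperbolicUnit M) : 0 < √(disc M : ℝ) :=
  Real.sqrt_pos.2 (by exact_mod_cast disc_pos hM.1 hM.2 hM.3)

theorem irrational (hM : IsHyperbolicUnit M) : Irrational (eigen M) :=
  irrational_eigen hM.1 hM.2 hM.3

theorem irrational_conj (hM : IsHyperbolicUnit M) : Irrational (conjEigen M) := by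
  rw [conjEigen]
  exact hM.irrational.intCast_sub _

theorem det_mul_det (hM : IsHyperbolicUnit M) : M.det * M.det = 1 := by
  rcases Int.isUnit_iff.1 hM.1 with h | h <;> rw [h] <;> norm_num

theorem det_mul_det_real (hM : IsHyperbolicUnit M) : (M.det : ℝ) * M.det = 1 := by
  exact_mod_cast hM.det_mul_det

theorem abs_conj (hM : IsHyperbolicUnit M) : |conjEigen M| = (eigen M)⁻¹ := by
  have h0 := hM.eigen_pos
  have h1 : |eigen M * conjEigen M| = 1 := by
    rw [hM.mul_eq]
    rcases Int.isUnit_iff.1 hM.1 with h | h <;> rw [h] <;> norm_num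
  rw [abs_mul, abs_of_pos h0] at h1
  field_simp
  linarith

theorem exists_numeration (hM : IsHyperbolicUnit M) :
    ∃ r c d D, Numeration (eigen M) (conjEigen M) r c d D := by
  have hr : ((M.trace.toNat : ℕ) : ℤ) = M.trace := Int.toNat_of_nonneg hM.3.le
  have hadd : eigen M + conjEigen M = (M.trace.toNat : ℕ) := by
    rw [eigen_add_conjEigen]
    exact_mod_cast hr.symm
  rcases Int.isUnit_iff.1 hM.1 with h | h
  · have h3 := three_le_trace hM.2 hM.3 h
    exact ⟨_, _, _, _, numeration_pos (by omega) hM.one_lt hM.irrational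
      (by rw [hM.mul_eq, h]; simp) hadd⟩
  · have h3 := hM.3
    exact ⟨_, _, _, _, numeration_neg (by omega) hM.one_lt hM.irrational
      (by rw [hM.mul_eq, h]; simp) hadd⟩

variable {u v : ℤ}

theorem homoclinicPoint_mul_sqrt (hM : IsHyperbolicUnit M) (u v : ℤ) (i : Fin 2) :
    homoclinicPoint M u v i * (eigen M - conjEigen M) =
      (![-v, u] i : ℤ) - M.det * (M.mulVec ![-v, u] i : ℤ) * eigen M := by
  rw [homoclinicPoint, ← sqrt_disc_eq, div_mul_cancel₀ _ hM.sqrt_pos.ne']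
  simp [sub_eq_add_neg]

theorem conjPoint_mul_sqrt (hM : IsHyperbolicUnit M) (u v : ℤ) (i : Fin 2) :
    conjPoint M u v i * (eigen M - conjEigen M) =
      -((![-v, u] i : ℤ) - M.det * (M.mulVec ![-v, u] i : ℤ) * conjEigen M) := by
  rw [conjPoint, ← sqrt_disc_eq, neg_mul, div_mul_cancel₀ _ hM.sqrt_pos.ne']
  simp [sub_eq_add_neg]

theorem sub_ne_zero (hM : IsHyperbolicUnit M) : eigen M - conjEigen M ≠ 0 := by
  rw [← sqrt_disc_eq]; exact hM.sqrt_pos.ne'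

/-- The Cayley-Hamilton identity, applied to an integral vector. -/
theorem mulVec_mulVec (w : Fin 2 → ℤ) (i : Fin 2) :
    ∑ j, (M i j : ℝ) * ((M.mulVec w j : ℤ) : ℝ) =
      M.trace * (M.mulVec w i : ℤ) - M.det * (w i : ℤ) := by
  rw [Matrix.trace_fin_two, Matrix.det_fin_two]
  fin_cases i <;> simp [Matrix.mulVec, dotProduct, Fin.sum_univ_two] <;> ring

theorem mulVec_cast (w : Fin 2 → ℤ) (i : Fin 2) :
    ∑ j, (M i j : ℝ) * (w j : ℝ) = (M.mulVec w i : ℤ) := by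
  simp [Matrix.mulVec, dotProduct, Fin.sum_univ_two]

theorem mul_homoclinicPoint (hM : IsHyperbolicUnit M) (u v : ℤ) (i : Fin 2) :
    ∑ j, (M i j : ℝ) * homoclinicPoint M u v j = eigen M * homoclinicPoint M u v i := by
  apply mul_right_cancel₀ hM.sub_ne_zero
  rw [Finset.sum_mul, mul_assoc, hM.homoclinicPoint_mul_sqrt]
  have : ∀ j, (M i j : ℝ) * homoclinicPoint M u v j * (eigen M - conjEigen M) =
      M i j * (![-v, u] j : ℤ) - M.det * eigen M * (M i j * (M.mulVec ![-v, u] j : ℤ)) := by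
    intro j
    rw [mul_assoc, hM.homoclinicPoint_mul_sqrt]; ring
  simp only [this]
  rw [Finset.sum_sub_distrib, ← Finset.mul_sum, mulVec_mulVec, mulVec_cast,
    ← eigen_add_conjEigen]
  linear_combination (-(M.det : ℝ) * (M.mulVec ![-v, u] i : ℤ)) * hM.mul_eq +
    (eigen M * (![-v, u] i : ℤ) - (M.mulVec ![-v, u] i : ℤ)) * hM.det_mul_det_real

theorem mul_conjPoint (hM : IsHyperbolicUnit M) (u v : ℤ) (i : Fin 2) :
    ∑ j, (M i j : ℝ) * conjPoint M u v j = conjEigen M * conjPoint M u v i := by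
  apply mul_right_cancel₀ hM.sub_ne_zero
  rw [Finset.sum_mul, mul_assoc, hM.conjPoint_mul_sqrt]
  have : ∀ j, (M i j : ℝ) * conjPoint M u v j * (eigen M - conjEigen M) =
      M.det * conjEigen M * (M i j * (M.mulVec ![-v, u] j : ℤ)) - M i j * (![-v, u] j : ℤ) := by
    intro j
    rw [mul_assoc, hM.conjPoint_mul_sqrt]; ring
  simp only [this]
  rw [Finset.sum_sub_distrib, ← Finset.mul_sum, mulVec_mulVec, mulVec_cast,
    ← eigen_add_conjEigen]
  linear_combination ((M.det : ℝ) * (M.mulVec ![-v, u] i : ℤ)) * hM.mul_eq -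
    (conjEigen M * (![-v, u] i : ℤ) - (M.mulVec ![-v, u] i : ℤ)) * hM.det_mul_det_real

/-- The sum is a Galois trace, hence rational, and dividing by √D makes it integral. So t and -t'
are the same point of the torus while lying on different eigenlines: this is the homoclinic
property. -/
theorem homoclinicPoint_add_conjPoint (hM : IsHyperbolicUnit M) (u v : ℤ) (i : Fin 2) :
    homoclinicPoint M u v i + conjPoint M u v i = -(M.det * (M.mulVec ![-v, u] i : ℤ)) := by
  apply mul_right_cancel₀ hM.sub_ne_zero
  rw [add_mul, hM.conjPoint_mul_sqrt, hM.homoclinicPoint_mul_sqrt]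
  ring

theorem mul_planeMap (hM : IsHyperbolicUnit M) (u v : ℤ) (x : Fin 2 → ℝ) (i : Fin 2) :
    ∑ j, (M i j : ℝ) * planeMap M u v x j =
      planeMap M u v ![eigen M * x 0, conjEigen M * x 1] i := by
  simp only [planeMap_apply, Matrix.cons_val_zero, Matrix.cons_val_one]
  have h1 := hM.mul_homoclinicPoint u v i
  have h2 := hM.mul_conjPoint u v i
  rw [Fin.sum_univ_two] at h1 h2 ⊢
  linear_combination x 0 * h1 - x 1 * h2

theorem vec_eq_planeMap (hM : IsHyperbolicUnit M) (u v : ℤ) (i : Fin 2) :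
    ((![-v, u] i : ℤ) : ℝ) = planeMap M u v ![-conjEigen M, eigen M] i := by
  apply mul_right_cancel₀ hM.sub_ne_zero
  simp only [planeMap_apply, Matrix.cons_val_zero, Matrix.cons_val_one]
  rw [sub_mul, mul_assoc, mul_assoc, hM.homoclinicPoint_mul_sqrt, hM.conjPoint_mul_sqrt]
  ring

theorem mulVec_eq_planeMap (hM : IsHyperbolicUnit M) (u v : ℤ) (i : Fin 2) :
    ((M.mulVec ![-v, u] i : ℤ) : ℝ) = planeMap M u v ![-M.det, M.det] i := by
  simp only [planeMap_apply, Matrix.cons_val_zero, Matrix.cons_val_one]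
  have := hM.homoclinicPoint_add_conjPoint u v i
  linear_combination (M.det : ℝ) * this - (M.mulVec ![-v, u] i : ℤ) * hM.det_mul_det_real

/-- Matches ℤw + ℤMw with ℤ[λ]: aw + bMw has the coordinates (ξ, -ξ') with ξ = -(ar + bσ) + aλ. -/
theorem planeMap_combination (hM : IsHyperbolicUnit M) (u v : ℤ) (a b : ℝ) (i : Fin 2) :
    a * (![-v, u] i : ℤ) + b * (M.mulVec ![-v, u] i : ℤ) =
      planeMap M u v ![(-a * M.trace - b * M.det) + a * eigen M,
        -((-a * M.trace - b * M.det) + a * conjEigen M)] i := by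
  rw [hM.vec_eq_planeMap, hM.mulVec_eq_planeMap, ← eigen_add_conjEigen]
  simp only [planeMap_apply, Matrix.cons_val_zero, Matrix.cons_val_one]
  ring

theorem vec_ne_zero (h : (u, v) ≠ (0, 0)) : ∃ i, (![-v, u] : Fin 2 → ℤ) i ≠ 0 := by
  by_contra! hn
  apply h
  have h0 := hn 0
  have h1 := hn 1
  simp at h0 h1
  simp [h0, h1]

theorem exists_homoclinicPoint_ne_zero (hM : IsHyperbolicUnit M) (h : (u, v) ≠ (0, 0)) :
    ∃ i, homoclinicPoint M u v i ≠ 0 := by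
  obtain ⟨i, hi⟩ := vec_ne_zero h
  refine ⟨i, fun h0 => hi ?_⟩
  have h1 := hM.homoclinicPoint_mul_sqrt u v i
  rw [h0] at h1
  exact (eq_zero_of_intCast_add_mul_irrational hM.irrational
    (q := -(M.det * M.mulVec ![-v, u] i)) (by push_cast at h1 ⊢; linarith)).1

theorem exists_conjPoint_ne_zero (hM : IsHyperbolicUnit M) (h : (u, v) ≠ (0, 0)) :
    ∃ i, conjPoint M u v i ≠ 0 := by
  obtain ⟨i, hi⟩ := vec_ne_zero h
  refine ⟨i, fun h0 => hi ?_⟩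
  have h1 := hM.conjPoint_mul_sqrt u v i
  rw [h0] at h1
  exact (eq_zero_of_intCast_add_mul_irrational hM.irrational_conj
    (q := -(M.det * M.mulVec ![-v, u] i)) (by push_cast at h1 ⊢; linarith)).1

/-- Applying M to a relation x t = y t' multiplies the two sides by λ and μ, so both vanish; t and
t' are nonzero since λ and μ are irrational. -/
theorem planeMap_injective (hM : IsHyperbolicUnit M) (h : (u, v) ≠ (0, 0)) :
    Function.Injective (planeMap M u v) := by
  rw [injective_iff_map_eq_zero]
  intro x hx
  have h1 : planeMap M u v ![eigen M * x 0, conjEigen M * x 1] = 0 := by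
    ext i
    rw [← hM.mul_planeMap, hx]
    simp
  obtain ⟨i, hi⟩ := hM.exists_homoclinicPoint_ne_zero h
  obtain ⟨j, hj⟩ := hM.exists_conjPoint_ne_zero h
  have key : ∀ k, x 0 * homoclinicPoint M u v k = 0 ∧ x 1 * conjPoint M u v k = 0 := by
    intro k
    have h2 := congr_fun hx k
    have h3 := congr_fun h1 k
    simp only [planeMap_apply, Matrix.cons_val_zero, Matrix.cons_val_one, Pi.zero_apply] at h2 h3
    constructor
    · apply mul_right_cancel₀ hM.sub_ne_zero
      linear_combination h3 - conjEigen M * h2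
    · apply mul_right_cancel₀ hM.sub_ne_zero
      linear_combination h3 - eigen M * h2
  have h4 : x 0 = 0 := (mul_eq_zero.1 (key i).1).resolve_right hi
  have h5 : x 1 = 0 := (mul_eq_zero.1 (key j).2).resolve_right hj
  ext k
  fin_cases k
  · exact h4
  · exact h5

/-- The linear equivalence underlying `planeMap`. -/
def planeEquiv (hM : IsHyperbolicUnit M) (h : (u, v) ≠ (0, 0)) : (Fin 2 → ℝ) ≃ₗ[ℝ] (Fin 2 → ℝ) :=
  LinearEquiv.ofInjectiveEndo (planeMap M u v) (hM.planeMap_injective h)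

theorem planeEquiv_apply (hM : IsHyperbolicUnit M) (h : (u, v) ≠ (0, 0)) (x : Fin 2 → ℝ) :
    hM.planeEquiv h x = planeMap M u v x := rfl

/-- Almost every point of the torus has no lift whose `i`-th coordinate with respect to the
eigendirections lies in a given null set. -/
theorem ae_coord (hM : IsHyperbolicUnit M) (h : (u, v) ≠ (0, 0)) (i : Fin 2) {F : Set ℝ}
    (hF : MeasureTheory.volume F = 0) :
    ∀ᵐ z : UnitAddTorus (Fin 2), ∀ x : Fin 2 → ℝ, proj (planeMap M u v x) = z → x i ∉ F := by
  apply ae_of_ae_proj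
  set ℓ : (Fin 2 → ℝ) →ₗ[ℝ] ℝ := (LinearMap.proj i).comp (hM.planeEquiv h).symm.toLinearMap with hℓ
  have hs : Function.Surjective ℓ :=
    (Function.surjective_eval i).comp (hM.planeEquiv h).symm.surjective
  have h1 : ∀ k : Fin 2 → ℤ, ∀ᵐ y : Fin 2 → ℝ,
      ℓ y ∉ (fun t => t + ℓ fun j => (k j : ℝ)) ⁻¹' F := fun k =>
    ae_functional hs (by rw [MeasureTheory.measure_preimage_add_right, hF])
  filter_upwards [MeasureTheory.ae_all_iff.2 h1] with y hy x hx hxF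
  obtain ⟨k, hk⟩ := proj_eq_iff.1 hx
  apply hy k
  rw [Set.mem_preimage, ← map_add]
  have : y + (fun j => (k j : ℝ)) = hM.planeEquiv h x := by
    ext j
    rw [hM.planeEquiv_apply h, hk j]
    rfl
  rw [this, hℓ]
  simpa using hxF

theorem ae_transcendental (hM : IsHyperbolicUnit M) (h : (u, v) ≠ (0, 0)) :
    ∀ᵐ z : UnitAddTorus (Fin 2), ∀ x : Fin 2 → ℝ, proj (planeMap M u v x) = z →
      Transcendental ℚ (x 0) ∧ Transcendental ℚ (x 1) := by
  have h0 : MeasureTheory.volume {x : ℝ | IsAlgebraic ℚ x} = 0 :=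
    (Algebraic.countable ℚ ℝ).measure_zero _
  filter_upwards [hM.ae_coord h 0 h0, hM.ae_coord h 1 h0] with z h1 h2 x hx
  exact ⟨h1 x hx, h2 x hx⟩

/-! ### The associated form -/

/-- The norm of (av - bu) - vλ is b f(u, v), and that of (du - cv) - uλ is -c f(u, v); an element p
- qλ of norm 0 has q = 0. -/
theorem assocForm_ne_zero (hM : IsHyperbolicUnit M) (h : (u, v) ≠ (0, 0)) :
    assocForm M u v ≠ 0 := by
  intro hf
  have key : ∀ p q : ℤ, p * p - M.trace * (p * q) + M.det * (q * q) = 0 → q = 0 := by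
    intro p q hpq
    have h1 : ((p : ℝ) - q * eigen M) * (p - q * conjEigen M) = 0 := by
      have h2 : (p : ℝ) * p - M.trace * (p * q) + M.det * (q * q) = 0 := by exact_mod_cast hpq
      rw [← hM.mul_eq, ← eigen_add_conjEigen] at h2
      linear_combination h2
    rcases mul_eq_zero.1 h1 with h2 | h2
    · have := (eq_zero_of_intCast_add_mul_irrational hM.irrational (p := p) (q := -q)
        (by push_cast; linarith)).2
      omega
    · have := (eq_zero_of_intCast_add_mul_irrational hM.irrational_conj (p := p) (q := -q)
        (by push_cast; linarith)).2
      omega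
  have hv : v = 0 := by
    have := key (M 0 0 * v - M 0 1 * u) v (by
      rw [Matrix.trace_fin_two, Matrix.det_fin_two]
      rw [assocForm] at hf
      linear_combination M 0 1 * hf)
    exact this
  have hu : u = 0 := by
    have := key (M 1 1 * u - M 1 0 * v) u (by
      rw [Matrix.trace_fin_two, Matrix.det_fin_two]
      rw [assocForm] at hf
      linear_combination -(M 1 0) * hf)
    exact this
  exact h (by rw [hu, hv])

/-- The matrix with the columns `w` and `M w`, where `w = (-v, u)`. -/
def latticeMatrix (M : Matrix (Fin 2) (Fin 2) ℤ) (u v : ℤ) : Matrix (Fin 2) (Fin 2) ℤ :=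
  !![-v, M.mulVec ![-v, u] 0; u, M.mulVec ![-v, u] 1]

theorem det_latticeMatrix (M : Matrix (Fin 2) (Fin 2) ℤ) (u v : ℤ) :
    (latticeMatrix M u v).det = -assocForm M u v := by
  rw [latticeMatrix, Matrix.det_fin_two, assocForm]
  simp [Matrix.mulVec, dotProduct, Fin.sum_univ_two]
  ring

theorem latticeMatrix_mulVec (M : Matrix (Fin 2) (Fin 2) ℤ) (u v : ℤ) (a : Fin 2 → ℤ) (i : Fin 2) :
    (latticeMatrix M u v).mulVec a i = a 0 * ![-v, u] i + a 1 * M.mulVec ![-v, u] i := by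
  fin_cases i <;> simp [latticeMatrix, Matrix.mulVec, dotProduct, Fin.sum_univ_two] <;> ring

/-- The index of the image of an injective integral matrix is the absolute value of its determinant,
and det(w, Mw) = -f(u, v). -/
theorem card_quotient (hM : IsHyperbolicUnit M) (h : (u, v) ≠ (0, 0)) :
    Nat.card ((Fin 2 → ℤ) ⧸ LinearMap.range (Matrix.toLin' (latticeMatrix M u v))) =
      (assocForm M u v).natAbs := by
  have hdet : (latticeMatrix M u v).det ≠ 0 := by
    rw [det_latticeMatrix]
    exact neg_ne_zero.2 (hM.assocForm_ne_zero h)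
  have hinj : Function.Injective (Matrix.toLin' (latticeMatrix M u v)) := by
    rw [injective_iff_map_eq_zero]
    intro a ha
    exact Matrix.eq_zero_of_mulVec_eq_zero hdet ha
  rw [← Submodule.natAbs_det_equiv _ (LinearEquiv.ofInjective _ hinj)]
  have : (LinearMap.range (Matrix.toLin' (latticeMatrix M u v))).subtype ∘ₗ
      ((LinearEquiv.ofInjective _ hinj).toLinearMap) = Matrix.toLin' (latticeMatrix M u v) := by
    ext; simp
  have h2 : LinearMap.det (Matrix.toLin' (latticeMatrix M u v)) = -assocForm M u v := by
    rw [LinearMap.det_toLin', det_latticeMatrix]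
  rw [← Int.natAbs_neg (assocForm M u v), ← h2]
  exact congr_arg (fun f => (LinearMap.det f).natAbs) this

end IsHyperbolicUnit

/-! ### Closedness of admissibility and uniqueness of finite expansions. -/

theorem LexLess.trans {x y z : ℕ → ℕ} (h : LexLess x y) (h' : LexLess y z) : LexLess x z := by
  obtain ⟨n, hn, hlt⟩ := h
  obtain ⟨m, hm, hlt'⟩ := h'
  rcases lt_trichotomy n m with h | rfl | h
  · exact ⟨n, fun k hk => (hn k hk).trans (hm k (hk.trans h)), hlt.trans_eq (hm n h)⟩
  · exact ⟨n, fun k hk => (hn k hk).trans (hm k hk), hlt.trans hlt'⟩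
  · exact ⟨m, fun k hk => (hn k (hk.trans h)).trans (hm k hk), (hn m h).trans_lt hlt'⟩

theorem isClosed_setOf_isAdmissible {Z : Type*} [TopologicalSpace Z] {f : Z → ℤ → ℕ}
    (hf : ∀ n, Continuous fun z => f z n) (d : ℕ → ℕ) : IsClosed {z | IsAdmissible d (f z)} := by
  simp only [IsAdmissible, LexLess, not_exists, Set.ofPred_forall]
  refine isClosed_iInter fun N => isClosed_iInter fun i => ?_
  rw [← isOpen_compl_iff]
  have : {z | ¬ ((∀ k < i, d k = f z (N + k)) ∧ d i < f z (N + i))}ᶜ =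
      (⋂ k ∈ Finset.range i, (fun z => f z (N + k)) ⁻¹' {d k}) ∩
        (fun z => f z (N + i)) ⁻¹' Set.Ioi (d i) := by
    ext z
    simp [eq_comm]
  rw [this]
  exact (isOpen_biInter_finset fun k _ => (isOpen_discrete _).preimage (hf _)).inter
    ((isOpen_discrete _).preimage (hf _))

/-- The set of the admissible sequences. -/
def admissibleSet (lam : ℝ) (d : ℕ → ℕ) : Set (PrimarySeq lam) := {e | IsAdmissible d e.1}

namespace Numeration

variable {lam mu : ℝ} {r c : ℕ} {d : ℕ → ℕ} {D : ℕ → ℝ}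

theorem future_sub_value (hN : Numeration lam mu r c d D) (e : PrimarySeq lam) {i : ℕ}
    (h : ∀ k < i, e.1 (k + 1) = d k) :
    future lam (shift^[i] e).1 - D i = lam ^ i * (future lam e.1 - 1) := by
  induction i with
  | zero => simp [hN.value_zero]
  | succ i ih =>
    rw [future_eq_shift_iterate hN.one_lt, hN.value_succ, h i (by omega), pow_succ']
    linear_combination lam * ih fun k hk => h k (by omega)

theorem isAdmissible_shift_iterate {e : PrimarySeq lam} (he : IsAdmissible d e.1) (i : ℕ) :
    IsAdmissible d (shift^[i] e).1 := by
  induction i with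
  | zero => exact he
  | succ i ih => rw [Function.iterate_succ_apply']; exact isAdmissible_shift.2 ih

/-- If the value were 1, the digits would have to follow `d` forever and the tails would have the
values `D i > 0`, against the tail being eventually zero. -/
theorem future_lt_one (hN : Numeration lam mu r c d D) {e : PrimarySeq lam}
    (he : IsAdmissible d e.1) (hfin : ∃ n : ℤ, ∀ m ≥ n, e.1 m = 0) : future lam e.1 < 1 := by
  refine lt_of_le_of_ne (hN.region e he).1 fun h1 => ?_
  have hlam := hN.one_lt
  have hd : ∀ i : ℕ, ∀ k < i, e.1 (k + 1) = d k := by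
    intro i
    induction i with
    | zero => simp
    | succ i ih =>
      intro k hk
      rcases Nat.lt_succ_iff_lt_or_eq.1 hk with hk | rfl
      · exact ih k hk
      · have h2 := hN.future_sub_value e ih
        rw [h1, sub_self, mul_zero, sub_eq_zero] at h2
        have h3 := future_eq_shift_iterate hlam e k
        have h4 := (hN.region _ (isAdmissible_shift_iterate he (k + 1))).1
        have h5 := hN.value_succ k
        have h6 := hN.value_pos (k + 1)
        rw [h2] at h3
        rcases lt_trichotomy (e.1 (k + 1)) (d k) with h | h | h
        · have : (e.1 (k + 1) : ℝ) + 1 ≤ d k := by exact_mod_cast h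
          linarith
        · exact h
        · exfalso
          apply he 1
          refine ⟨k, fun j hj => ?_, ?_⟩
          · rw [← ih j hj, add_comm]
          · simpa [add_comm] using h
  obtain ⟨n, hn⟩ := hfin
  have h2 := hN.future_sub_value e (hd n.toNat)
  rw [h1, sub_self, mul_zero, sub_eq_zero] at h2
  have h3 : future lam (shift^[n.toNat] e).1 = 0 := by
    rw [future, tsum_congr, tsum_zero]
    intro m
    split_ifs with hm
    · rw [shift_iterate_apply, hn _ (by omega)]; simp
    · rfl
  linarith [hN.value_pos n.toNat]

/-- As tails have values in [0, 1), the first digit is the integer part of λ times the value, and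
one proceeds by shifting. -/
theorem eq_of_future_eq_of_finite (hN : Numeration lam mu r c d D) (n : ℕ) :
    ∀ {e e' : PrimarySeq lam}, IsAdmissible d e.1 → IsAdmissible d e'.1 →
    (∃ n : ℤ, ∀ m ≥ n, e.1 m = 0) → (∃ n : ℤ, ∀ m ≥ n, e'.1 m = 0) →
    future lam e.1 = future lam e'.1 → e.1 (n + 1) = e'.1 (n + 1) := by
  have hlam := hN.one_lt
  have hsh : ∀ {e : PrimarySeq lam}, (∃ n : ℤ, ∀ m ≥ n, e.1 m = 0) →
      ∃ n : ℤ, ∀ m ≥ n, (shift e).1 m = 0 := by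
    rintro e ⟨n, hn⟩
    exact ⟨n, fun m hm => hn _ (by omega)⟩
  have hone : ∀ {e e' : PrimarySeq lam}, IsAdmissible d e.1 → IsAdmissible d e'.1 →
      (∃ n : ℤ, ∀ m ≥ n, e.1 m = 0) → (∃ n : ℤ, ∀ m ≥ n, e'.1 m = 0) →
      future lam e.1 = future lam e'.1 → e.1 1 = e'.1 1 := by
    intro e e' he he' hf hf' h
    have h1 := hN.future_lt_one (isAdmissible_shift.2 he) (hsh hf)
    have h2 := hN.future_lt_one (isAdmissible_shift.2 he') (hsh hf')
    have h3 := future_nonneg hlam (shift e).1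
    have h4 := future_nonneg hlam (shift e').1
    rw [future_shift hlam] at h1 h2 h3 h4
    rw [h] at h1 h3
    have h5 : (e.1 1 : ℝ) < e'.1 1 + 1 := by linarith
    have h6 : (e'.1 1 : ℝ) < e.1 1 + 1 := by linarith
    have h5 : e.1 1 < e'.1 1 + 1 := by exact_mod_cast h5
    have h6 : e'.1 1 < e.1 1 + 1 := by exact_mod_cast h6
    omega
  induction n with
  | zero =>
    intro e e' he he' hf hf' h
    simpa using hone he he' hf hf' h
  | succ n ih =>
    intro e e' he he' hf hf' h
    have h1 := hone he he' hf hf' h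
    have := ih (isAdmissible_shift.2 he) (isAdmissible_shift.2 he') (hsh hf) (hsh hf')
      (by rw [future_shift hlam, future_shift hlam, h, h1])
    simpa [shift] using this

theorem ofBounded_mem (hN : Numeration lam mu r c d D) {e : ℤ → ℕ} (he : IsAdmissible d e) :
    ∃ f : PrimarySeq lam, f.1 = e :=
  ⟨ofBounded hN.one_lt e (d 0) he.le, rfl⟩

end Numeration

/-- With bounded digits the series converges uniformly, so continuity holds even for the product
topology, in which the admissible sequences form a compact set. -/
theorem continuousOn_future {lam : ℝ} (hlam : 1 < lam) (c : ℕ) :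
    ContinuousOn (future lam) (Set.univ.pi fun _ => Set.Iic c) := by
  refine continuousOn_tsum (u := fun n : ℤ => (c : ℝ) / lam ^ n.natAbs) (fun n => ?_)
    (summable_weighted (ofBounded hlam (fun _ => c) c fun _ => le_rfl)) fun n e he => ?_
  · split_ifs
    · exact ((continuous_of_discreteTopology.comp (continuous_apply n)).mul
        continuous_const).continuousOn
    · exact continuousOn_const
  · refine (norm_future_term_le hlam _ n).trans ?_
    have h0 : 0 < lam := by linarith
    have : e n ≤ c := he n trivial
    gcongr

theorem continuousOn_past {lam mu : ℝ} (hlam : 1 < lam) (hmu : |mu| = lam⁻¹) (c : ℕ) :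
    ContinuousOn (past mu) (Set.univ.pi fun _ => Set.Iic c) := by
  refine continuousOn_tsum (u := fun n : ℤ => (c : ℝ) / lam ^ n.natAbs) (fun n => ?_)
    (summable_weighted (ofBounded hlam (fun _ => c) c fun _ => le_rfl)) fun n e he => ?_
  · split_ifs
    · exact ((continuous_of_discreteTopology.comp (continuous_apply n)).mul
        continuous_const).continuousOn
    · exact continuousOn_const
  · refine (norm_past_term_le hlam hmu _ n).trans ?_
    have h0 : 0 < lam := by linarith
    have : e n ≤ c := he n trivial
    gcongr

theorem toralMap_injective {M : Matrix (Fin 2) (Fin 2) ℤ} (hdet : IsUnit M.det) :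
    Function.Injective (toralMap M) := by
  have key : ∀ z : UnitAddTorus (Fin 2),
      M 1 1 • toralMap M z 0 - M 0 1 • toralMap M z 1 = M.det • z 0 ∧
      M 0 0 • toralMap M z 1 - M 1 0 • toralMap M z 0 = M.det • z 1 := by
    intro z
    simp only [toralMap, Fin.sum_univ_two, Matrix.det_fin_two]
    constructor <;> module
  have hcancel : ∀ a b : UnitAddCircle, M.det • a = M.det • b → a = b := by
    intro a b h
    rcases Int.isUnit_iff.1 hdet with h1 | h1 <;> simpa [h1] using h
  intro z z' h
  ext i
  apply hcancel
  fin_cases i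
  · rw [Fin.zero_eta, ← (key z).1, ← (key z').1, h]
  · rw [Fin.mk_one, ← (key z).2, ← (key z').2, h]

/-! ### The maps `phi` as arithmetic codings. -/

namespace IsHyperbolicUnit

variable {M : Matrix (Fin 2) (Fin 2) ℤ}

/-- The homomorphism `ε ↦ (∑_n ε_n λ ^ (-n)) t mod ℤ²`, where `t` is the homoclinic point with the
parameters `(u, v)`. The terms with `n ≤ 0` are replaced by their conjugates, which makes the series
converge in the plane. -/
def phi (hM : IsHyperbolicUnit M) (u v : ℤ) : PrimarySeq (eigen M) →+ UnitAddTorus (Fin 2) where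
  toFun e := proj (planeMap M u v ![future (eigen M) e.1, past (conjEigen M) e.1])
  map_zero' := by
    have : (0 : PrimarySeq (eigen M)).1 = 0 := rfl
    rw [this, future_zero, past_zero]
    have : ![(0 : ℝ), 0] = 0 := by ext i; fin_cases i <;> rfl
    rw [this, map_zero, map_zero]
  map_add' e e' := by
    rw [← map_add, ← map_add, future_add hM.one_lt, past_add hM.one_lt hM.abs_conj]
    congr 2

theorem phi_apply (hM : IsHyperbolicUnit M) (u v : ℤ) (e : PrimarySeq (eigen M)) :
    hM.phi u v e = proj (planeMap M u v ![future (eigen M) e.1, past (conjEigen M) e.1]) := rfl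

theorem lattice_combination (hM : IsHyperbolicUnit M) (u v p q : ℤ) (i : Fin 2) :
    planeMap M u v ![p + q * eigen M, -(p + q * conjEigen M)] i =
      ((q * ![-v, u] i + (-(p + q * M.trace) * M.det) * M.mulVec ![-v, u] i : ℤ) : ℝ) := by
  have := hM.planeMap_combination u v q (-(p + q * M.trace) * M.det) i
  rw [Int.cast_add, Int.cast_mul, Int.cast_mul, Int.cast_mul, Int.cast_neg, Int.cast_add,
    Int.cast_mul, this]
  have h1 : -(q : ℝ) * M.trace - -(p + q * M.trace) * M.det * M.det = p := by
    linear_combination ((p : ℝ) + q * M.trace) * hM.det_mul_det_real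
  rw [h1]

theorem proj_planeMap_lattice (hM : IsHyperbolicUnit M) (u v : ℤ) (x y : ℝ) (p q : ℤ) :
    proj (planeMap M u v ![x + (p + q * eigen M), y - (p + q * conjEigen M)]) =
      proj (planeMap M u v ![x, y]) := by
  refine proj_eq_iff.2 ⟨fun i => q * ![-v, u] i +
    (-(p + q * M.trace) * M.det) * M.mulVec ![-v, u] i, fun i => ?_⟩
  rw [← hM.lattice_combination, ← Pi.add_apply, ← map_add]
  congr 2

/-- The digit crossing the origin changes the coordinates by (-ε₁, ε₁), a vector of Λ, which the
torus does not see. -/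
theorem phi_shift (hM : IsHyperbolicUnit M) (u v : ℤ) (e : PrimarySeq (eigen M)) :
    hM.phi u v (shift e) = toralMap M (hM.phi u v e) := by
  rw [phi_apply, phi_apply, toralMap_proj]
  simp only [hM.mul_planeMap, Matrix.cons_val_zero, Matrix.cons_val_one]
  rw [future_shift hM.one_lt, past_shift hM.one_lt hM.abs_conj]
  have := hM.proj_planeMap_lattice u v (eigen M * future (eigen M) e.1)
    (conjEigen M * past (conjEigen M) e.1) (-(e.1 1 : ℤ)) 0
  push_cast at this
  simp only [zero_mul, add_zero, sub_neg_eq_add, ← sub_eq_add_neg] at this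
  exact this

theorem phi_shift_iterate (hM : IsHyperbolicUnit M) (u v : ℤ) (e : PrimarySeq (eigen M)) (n : ℕ) :
    hM.phi u v (shift^[n] e) = (toralMap M)^[n] (hM.phi u v e) := by
  induction n with
  | zero => rfl
  | succ n ih => rw [Function.iterate_succ_apply', Function.iterate_succ_apply', phi_shift, ih]

theorem continuous_phi (hM : IsHyperbolicUnit M) (u v : ℤ) :
    Continuous[seqTopology (eigen M), inferInstance] (hM.phi u v) := by
  let _ := seqTopology (eigen M)
  refine continuous_proj.comp ((planeMap M u v).continuous_of_finiteDimensional.comp ?_)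
  refine continuous_pi fun i => ?_
  fin_cases i
  · exact continuous_future hM.one_lt
  · exact continuous_past hM.one_lt hM.abs_conj

variable {u v : ℤ} {r c : ℕ} {d : ℕ → ℕ} {D : ℕ → ℝ}

/-- The coordinates of an integral vector with respect to the eigendirections. -/
def coords (hM : IsHyperbolicUnit M) (h : (u, v) ≠ (0, 0)) (k : Fin 2 → ℤ) : Fin 2 → ℝ :=
  (hM.planeEquiv h).symm fun i => (k i : ℝ)

theorem planeMap_coords (hM : IsHyperbolicUnit M) (h : (u, v) ≠ (0, 0)) (k : Fin 2 → ℤ) :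
    planeMap M u v (hM.coords h k) = fun i => (k i : ℝ) :=
  (hM.planeEquiv h).apply_symm_apply _

theorem coords_sub (hM : IsHyperbolicUnit M) (h : (u, v) ≠ (0, 0)) (k k' : Fin 2 → ℤ) :
    hM.coords h (k - k') = hM.coords h k - hM.coords h k' := by
  rw [coords, coords, coords, ← map_sub]
  congr 1
  ext i
  simp

theorem proj_planeMap_eq_iff (hM : IsHyperbolicUnit M) (h : (u, v) ≠ (0, 0)) (x x' : Fin 2 → ℝ) :
    proj (planeMap M u v x) = proj (planeMap M u v x') ↔ ∃ k, x = x' + hM.coords h k := by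
  rw [proj_eq_iff]
  refine exists_congr fun k => ⟨fun hk => hM.planeMap_injective h ?_, ?_⟩
  · ext i
    rw [map_add, planeMap_coords, hk]
    rfl
  · rintro rfl i
    rw [map_add, planeMap_coords]
    rfl

theorem sub_mem_range_iff (hM : IsHyperbolicUnit M) (h : (u, v) ≠ (0, 0)) (k k' : Fin 2 → ℤ) :
    k - k' ∈ LinearMap.range (Matrix.toLin' (latticeMatrix M u v)) ↔
      ∃ p q : ℤ, hM.coords h k 0 = hM.coords h k' 0 + (p + q * eigen M) ∧
        hM.coords h k 1 = hM.coords h k' 1 - (p + q * conjEigen M) := by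
  have h1 : (∃ p q : ℤ, hM.coords h k 0 = hM.coords h k' 0 + (p + q * eigen M) ∧
        hM.coords h k 1 = hM.coords h k' 1 - (p + q * conjEigen M)) ↔
      ∃ p q : ℤ, hM.coords h (k - k') = ![p + q * eigen M, -(p + q * conjEigen M)] := by
    refine exists_congr fun p => exists_congr fun q => ?_
    rw [coords_sub, funext_iff, Fin.forall_fin_two]
    simp only [Pi.sub_apply, Matrix.cons_val_zero, Matrix.cons_val_one]
    constructor <;> rintro ⟨a, b⟩ <;> constructor <;> linarith
  rw [h1]
  constructor
  · rintro ⟨a, ha⟩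
    refine ⟨-a 0 * M.trace - a 1 * M.det, a 0, hM.planeMap_injective h ?_⟩
    rw [planeMap_coords]
    ext i
    rw [← ha, Matrix.toLin'_apply, latticeMatrix_mulVec]
    have := hM.planeMap_combination u v (a 0) (a 1) i
    push_cast at this ⊢
    rw [this]
  · rintro ⟨p, q, hpq⟩
    have h2 := hM.planeMap_coords h (k - k')
    rw [hpq] at h2
    refine ⟨![q, -(p + q * M.trace) * M.det], ?_⟩
    ext i
    have h3 := congr_fun h2 i
    rw [hM.lattice_combination] at h3
    rw [Matrix.toLin'_apply, latticeMatrix_mulVec]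
    simpa using Int.cast_injective h3

/-- The lifts of z form one class modulo the coordinates of ℤ², and each class modulo Λ inside it
has exactly one admissible code. So the preimages correspond to ℤ²/(ℤw + ℤMw). -/
theorem encard_preimage (hM : IsHyperbolicUnit M) (hN : Numeration (eigen M) (conjEigen M) r c d D)
    (h : (u, v) ≠ (0, 0)) {z : UnitAddTorus (Fin 2)}
    (hz : ∀ x : Fin 2 → ℝ, proj (planeMap M u v x) = z →
      Transcendental ℚ (x 0) ∧ Transcendental ℚ (x 1)) :
    {e | e ∈ admissibleSet (eigen M) d ∧ hM.phi u v e = z}.encard =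
      ((assocForm M u v).natAbs : ℕ) := by
  obtain ⟨y, rfl⟩ := proj_surjective z
  obtain ⟨x, rfl⟩ := (hM.planeEquiv h).surjective y
  rw [hM.planeEquiv_apply h] at hz ⊢
  have hproj : ∀ k, proj (planeMap M u v (x + hM.coords h k)) = proj (planeMap M u v x) :=
    fun k => (hM.proj_planeMap_eq_iff h _ _).2 ⟨k, rfl⟩
  choose g hg hguniq using fun k =>
    hN.existsUnique_code (hz _ (hproj k)).1 (hz _ (hproj k)).2
  have hmem : ∀ k, g k ∈ {e | e ∈ admissibleSet (eigen M) d ∧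
      hM.phi u v e = proj (planeMap M u v x)} := by
    intro k
    obtain ⟨h1, p, q, h2, h3⟩ := hg k
    refine ⟨h1, ?_⟩
    rw [phi_apply, h2, h3, hM.proj_planeMap_lattice, ← hproj k]
    congr 2
  have hgiff : ∀ k k', g k = g k' ↔
      k - k' ∈ LinearMap.range (Matrix.toLin' (latticeMatrix M u v)) := by
    intro k k'
    rw [hM.sub_mem_range_iff h]
    obtain ⟨h1, p, q, h2, h3⟩ := hg k
    obtain ⟨h1', p', q', h2', h3'⟩ := hg k'
    simp only [Pi.add_apply] at h2 h3 h2' h3'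
    constructor
    · intro heq
      rw [heq] at h2 h3
      refine ⟨p' - p, q' - q, ?_, ?_⟩ <;> push_cast <;> linarith
    · rintro ⟨a, b, h4, h5⟩
      refine hguniq k' _ ⟨h1, a + p, b + q, ?_, ?_⟩ <;> simp only [Pi.add_apply] <;> push_cast <;>
        linarith
  have hsurj : ∀ e, e ∈ admissibleSet (eigen M) d → hM.phi u v e = proj (planeMap M u v x) →
      ∃ k, g k = e := by
    intro e he hez
    rw [phi_apply, hM.proj_planeMap_eq_iff h] at hez
    obtain ⟨k, hk⟩ := hez
    refine ⟨k, (hguniq k e ⟨he, 0, 0, ?_, ?_⟩).symm⟩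
    · simpa using congr_fun hk 0
    · simpa using congr_fun hk 1
  let f : ((Fin 2 → ℤ) ⧸ LinearMap.range (Matrix.toLin' (latticeMatrix M u v))) →
      {e | e ∈ admissibleSet (eigen M) d ∧ hM.phi u v e = proj (planeMap M u v x)} :=
    fun a => ⟨g a.out, hmem _⟩
  have hf : Function.Bijective f := by
    constructor
    · intro a b hab
      have h1 := (hgiff _ _).1 (congr_arg Subtype.val hab)
      rw [← Submodule.Quotient.eq] at h1
      have h2 : ∀ a : (Fin 2 → ℤ) ⧸ LinearMap.range (Matrix.toLin' (latticeMatrix M u v)),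
        Submodule.Quotient.mk a.out = a := fun a => Quotient.out_eq' a
      rwa [h2, h2] at h1
    · rintro ⟨e, he⟩
      obtain ⟨k, rfl⟩ := hsurj e he.1 he.2
      refine ⟨Submodule.Quotient.mk k, Subtype.ext ((hgiff _ _).2 ?_)⟩
      rw [← Submodule.Quotient.eq]
      exact Quotient.out_eq' _
  rw [Set.encard, ← ENat.card_congr (Equiv.ofBijective f hf), ← hM.card_quotient h]
  have : Finite ((Fin 2 → ℤ) ⧸ LinearMap.range (Matrix.toLin' (latticeMatrix M u v))) := by
    apply Nat.finite_of_card_ne_zero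
    rw [hM.card_quotient h]
    exact Int.natAbs_ne_zero.2 (hM.assocForm_ne_zero h)
  exact ENat.card_eq_coe_natCard _

/-- Almost every point has a preimage, so the image of the admissible set is dense; it is also
compact, hence everything. -/
theorem phi_surjOn (hM : IsHyperbolicUnit M) (hN : Numeration (eigen M) (conjEigen M) r c d D)
    (h : (u, v) ≠ (0, 0)) (z : UnitAddTorus (Fin 2)) :
    ∃ e ∈ admissibleSet (eigen M) d, hM.phi u v e = z := by
  set ψ : (ℤ → ℕ) → UnitAddTorus (Fin 2) := fun e =>
    proj (planeMap M u v ![future (eigen M) e, past (conjEigen M) e]) with hψ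
  set A : Set (ℤ → ℕ) := {e | IsAdmissible d e} with hA
  have hsub : A ⊆ Set.univ.pi fun _ => Set.Iic (d 0) := fun e he n _ => he.le n
  have hcomp : IsCompact A :=
    (isCompact_univ_pi fun _ => (Set.finite_Iic (d 0)).isCompact).of_isClosed_subset
      (isClosed_setOf_isAdmissible (fun n => continuous_apply n) d) hsub
  have hcont : ContinuousOn ψ A := by
    refine (continuous_proj.comp (planeMap M u v).continuous_of_finiteDimensional).comp_continuousOn
      (continuousOn_pi.2 fun i => ?_)
    fin_cases i
    · exact (continuousOn_future hM.one_lt _).mono hsub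
    · exact (continuousOn_past hM.one_lt hM.abs_conj _).mono hsub
  have hclosed : IsClosed (ψ '' A) := (hcomp.image_of_continuousOn hcont).isClosed
  have hae : ∀ᵐ z : UnitAddTorus (Fin 2), z ∈ ψ '' A := by
    filter_upwards [hM.ae_transcendental h] with z hz
    have h1 := hM.encard_preimage hN h hz
    have h2 : {e | e ∈ admissibleSet (eigen M) d ∧ hM.phi u v e = z}.encard ≠ 0 := by
      rw [h1]
      exact_mod_cast Int.natAbs_ne_zero.2 (hM.assocForm_ne_zero h)
    obtain ⟨e, he, rfl⟩ := Set.encard_ne_zero.1 h2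
    exact ⟨e.1, he, rfl⟩
  have hdense : Dense (ψ '' A) := MeasureTheory.Measure.dense_of_ae hae
  have huniv : ψ '' A = Set.univ := by rw [← hclosed.closure_eq, hdense.closure_eq]
  obtain ⟨e, he, rfl⟩ : z ∈ ψ '' A := huniv ▸ Set.mem_univ z
  obtain ⟨f, rfl⟩ := hN.ofBounded_mem he
  exact ⟨f, he, rfl⟩

/-- The only point of an eigendirection which projects to `0` is the origin. -/
theorem eq_zero_of_proj_smul (hM : IsHyperbolicUnit M) (h : (u, v) ≠ (0, 0)) {s : ℝ}
    (hs : proj (planeMap M u v ![s, 0]) = 0) : s = 0 := by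
  obtain ⟨k, hk⟩ := proj_eq_zero_iff.1 hs
  simp only [planeMap_apply, Matrix.cons_val_zero, Matrix.cons_val_one, zero_mul, sub_zero] at hk
  -- An integral vector on the eigenline satisfies Mk = λk, impossible for irrational λ unless k =
  -- 0.
  have hk0 : ∀ i, k i = 0 := by
    intro i
    have h1 := hM.mul_homoclinicPoint u v i
    have h2 : (((M.mulVec k i : ℤ) : ℝ)) = eigen M * k i := by
      rw [← mulVec_cast, ← hk i]
      simp only [← hk]
      rw [Fin.sum_univ_two] at h1 ⊢
      linear_combination s * h1
    exact neg_eq_zero.1 (eq_zero_of_intCast_add_mul_irrational hM.irrational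
      (p := M.mulVec k i) (q := -k i) (by push_cast; linarith)).2
  obtain ⟨i, hi⟩ := hM.exists_homoclinicPoint_ne_zero h
  have := hk i
  rw [hk0, Int.cast_zero] at this
  exact (mul_eq_zero.1 this).resolve_right hi

theorem IsFinite.exists_bounds {lam : ℝ} {e : PrimarySeq lam} (he : IsFinite e) :
    ∃ n : ℕ, ∀ m : ℤ, e.1 m ≠ 0 → -n < m ∧ m < n := by
  obtain ⟨a, ha⟩ := he.bddAbove
  obtain ⟨b, hb⟩ := he.bddBelow
  refine ⟨a.natAbs + b.natAbs + 1, fun m hm => ?_⟩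
  have h1 : m ≤ a := ha hm
  have h2 : b ≤ m := hb hm
  constructor <;> omega

/-- Since the torus map is injective, both sequences may be moved to positive positions. Their pasts
then vanish, their images come from a single eigenline on which `proj` is injective, and equal
futures determine finite admissible sequences. -/
theorem injOn_finite (hM : IsHyperbolicUnit M) (hN : Numeration (eigen M) (conjEigen M) r c d D)
    (h : (u, v) ≠ (0, 0)) :
    Set.InjOn (hM.phi u v) {e | e ∈ admissibleSet (eigen M) d ∧ IsFinite e} := by
  rintro e ⟨he, hf⟩ e' ⟨he', hf'⟩ heq
  obtain ⟨n, hn⟩ := IsFinite.exists_bounds hf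
  obtain ⟨n', hn'⟩ := IsFinite.exists_bounds hf'
  set N := n + n' with hNdef
  have hpre : ∀ {e : PrimarySeq (eigen M)}, e ∈ admissibleSet (eigen M) d →
      ∃ f : PrimarySeq (eigen M), f ∈ admissibleSet (eigen M) d ∧ shift^[N] f = e ∧
        ∀ m, f.1 m = e.1 (m - N) := by
    intro e he
    obtain ⟨f, hf⟩ := hN.ofBounded_mem (IsAdmissible.comp_add he (-N))
    refine ⟨f, ?_, ?_, fun m => by rw [hf]; rfl⟩
    · rw [admissibleSet, Set.mem_ofPred_eq, hf]
      exact IsAdmissible.comp_add he (-N)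
    · apply Subtype.ext
      ext m
      rw [shift_iterate_apply, hf]
      simp
  obtain ⟨f, hfa, rfl, hfm⟩ := hpre he
  obtain ⟨f', hfa', rfl, hfm'⟩ := hpre he'
  rw [phi_shift_iterate, phi_shift_iterate] at heq
  have heq := (toralMap_injective hM.1).iterate N heq
  have hzero : ∀ m ≤ 0, f.1 m = 0 := by
    intro m hm
    by_contra h0
    rw [hfm] at h0
    have := hn _ h0
    omega
  have hzero' : ∀ m ≤ 0, f'.1 m = 0 := by
    intro m hm
    by_contra h0
    rw [hfm'] at h0
    have := hn' _ h0
    omega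
  have hend : ∀ m ≥ (n + N : ℤ), f.1 m = 0 := by
    intro m hm
    by_contra h0
    rw [hfm] at h0
    have := hn _ h0
    omega
  have hend' : ∀ m ≥ (n' + N : ℤ), f'.1 m = 0 := by
    intro m hm
    by_contra h0
    rw [hfm'] at h0
    have := hn' _ h0
    omega
  have hfut : future (eigen M) f.1 = future (eigen M) f'.1 := by
    rw [phi_apply, phi_apply, past_eq_zero hzero, past_eq_zero hzero', ← sub_eq_zero, ← map_sub,
      ← map_sub] at heq
    have : ![future (eigen M) f.1, 0] - ![future (eigen M) f'.1, 0] =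
        ![future (eigen M) f.1 - future (eigen M) f'.1, 0] := by
      ext i
      fin_cases i <;> simp
    rw [this] at heq
    exact sub_eq_zero.1 (hM.eq_zero_of_proj_smul h heq)
  congr 1
  apply Subtype.ext
  ext m
  rcases le_or_gt m 0 with hm | hm
  · rw [hzero m hm, hzero' m hm]
  · obtain ⟨j, rfl⟩ : ∃ j : ℕ, m = j + 1 := ⟨(m - 1).toNat, by omega⟩
    exact hN.eq_of_future_eq_of_finite j hfa hfa' ⟨_, hend⟩ ⟨_, hend'⟩ hfut

theorem isArithmeticCoding_phi (hM : IsHyperbolicUnit M)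
    (hN : Numeration (eigen M) (conjEigen M) r c d D) (h : (u, v) ≠ (0, 0)) :
    IsArithmeticCoding M (hM.phi u v) (admissibleSet (eigen M) d) where
  continuous := hM.continuous_phi u v
  equivariant := hM.phi_shift u v
  closed := @isClosed_setOf_isAdmissible _ (seqTopology (eigen M)) _
    (fun n => continuous_coord hM.one_lt n) d
  shift_invariant e := isAdmissible_shift
  total := by
    rintro e he e' ⟨N, hlt⟩ k hk
    exact he N (LexLess.trans hk (hlt k))
  surjective := hM.phi_surjOn hN h
  injective_finite := hM.injOn_finite hN h

end IsHyperbolicUnit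

/-! ### The sequence set of an arbitrary coding. -/

/-- Where a tail of `f` first exceeds `d`, the larger tail of `e` exceeds `d` at the same index or
earlier. -/
theorem IsAdmissible.mono {d : ℕ → ℕ} {e f : ℤ → ℕ} (he : IsAdmissible d e) (h : ∀ n, f n ≤ e n) :
    IsAdmissible d f := by
  rintro N ⟨i, hi, hlt⟩
  by_cases hag : ∀ k < i, d k = e (N + k)
  · exact he N ⟨i, hag, hlt.trans_le (h _)⟩
  · push Not at hag
    classical
    obtain ⟨h1, h2⟩ := Nat.find_spec hag
    refine he N ⟨Nat.find hag, fun k hk => ?_, lt_of_le_of_ne ?_ h2⟩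
    · by_contra hne
      exact Nat.find_min hag hk ⟨hk.trans h1, hne⟩
    · rw [hi _ h1]; exact h _

namespace Numeration

variable {lam mu : ℝ} {r c : ℕ} {d : ℕ → ℕ} {D : ℕ → ℝ}

theorem digit_zero_pos (hN : Numeration lam mu r c d D) : 0 < d 0 := by
  rw [hN.digit_zero]
  have h1 := hN.one_lt
  have h2 := hN.lt_digit
  have : (0 : ℝ) < c := by linarith
  exact_mod_cast this

/-- If the digits vanished from some index on, `D` would grow like a power of λ, although it is at
most 1. -/
theorem exists_digit_ne_zero (hN : Numeration lam mu r c d D) (m : ℕ) : ∃ k ≥ m, d k ≠ 0 := by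
  by_contra! h
  have h1 : ∀ l, D (m + l) = lam ^ l * D m := by
    intro l
    induction l with
    | zero => simp
    | succ l ih => rw [← add_assoc, hN.value_succ, h _ (by omega), ih]; push_cast; ring
  have h2 : D m ≤ 0 := by
    refine le_of_forall_le_add_div_pow (B := 1) hN.one_lt fun l => ?_
    have := hN.value_le (m + l)
    have h0 := hN.lam_pos
    rw [h1] at this
    rw [zero_add, le_div_iff₀ (by positivity)]
    linarith
  linarith [hN.value_pos m]

theorem exists_lt_digit (hN : Numeration lam mu r c d D) {f : ℤ → ℕ} (hf : IsAdmissible d f)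
    {n : ℤ} (hn : ∀ m ≥ n, f m = 0) (k : ℤ) : ∃ j : ℕ, (∀ l < j, f (k + l) = d l) ∧
      f (k + j) < d j := by
  have h1 : ∃ j : ℕ, f (k + j) ≠ d j := by
    obtain ⟨j, hj, hne⟩ := hN.exists_digit_ne_zero (n - k).toNat
    exact ⟨j, by rw [hn _ (by omega)]; exact hne.symm⟩
  classical
  have h2 : ∀ l < Nat.find h1, f (k + l) = d l := fun l hl => not_not.1 (Nat.find_min h1 hl)
  refine ⟨Nat.find h1, h2, lt_of_le_of_ne ?_ (Nat.find_spec h1)⟩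
  by_contra hlt
  exact hf k ⟨Nat.find h1, fun l hl => (h2 l hl).symm, not_le.1 hlt⟩

/-- A finite admissible sequence is uniformly lexicographically less than `d`. -/
theorem exists_uniform_lt_digit (hN : Numeration lam mu r c d D) {f : ℤ → ℕ}
    (hf : IsAdmissible d f) {n : ℕ} (hn : ∀ m : ℤ, f m ≠ 0 → -n < m ∧ m < n) :
    ∃ i : ℕ, ∀ k : ℤ, ∃ j < i, (∀ l < j, f (k + l) = d l) ∧ f (k + j) < d j := by
  have hz : ∀ m ≥ (n : ℤ), f m = 0 := fun m hm => by
    by_contra h0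
    have := hn m h0
    omega
  choose j hj hj' using hN.exists_lt_digit hf hz
  -- Only finitely many starting positions matter: elsewhere the first digit 0 is already below `d
  -- 0`.
  refine ⟨(Finset.Icc (-n : ℤ) n).sup j + 1, fun k => ?_⟩
  by_cases hk : k ∈ Finset.Icc (-n : ℤ) n
  · exact ⟨j k, Nat.lt_succ_of_le (Finset.le_sup (f := j) hk), hj k, hj' k⟩
  · refine ⟨0, Nat.succ_pos _, by simp, ?_⟩
    have : f k = 0 := by
      by_contra h0
      have := hn k h0
      exact hk (Finset.mem_Icc.2 ⟨by omega, by omega⟩)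
    simpa [this] using hN.digit_zero_pos

theorem sum_digits (hN : Numeration lam mu r c d D) (i : ℕ) :
    ∑ k ∈ Finset.range i, (d k : ℝ) / lam ^ (k + 1) = 1 - D i / lam ^ i := by
  have h0 := hN.lam_pos
  induction i with
  | zero => simp [hN.value_zero]
  | succ i ih =>
    rw [Finset.sum_range_succ, ih, hN.value_succ]
    field_simp
    ring

open scoped Pointwise in
/-- If no tail of a sequence in a shift-invariant set agrees with `d` up to the index `i`, then the
values of the futures form a null set. -/
theorem volume_future_eq_zero (hN : Numeration lam mu r c d D) {X : Set (PrimarySeq lam)}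
    (hX : ∀ e ∈ X, shift e ∈ X) {i : ℕ}
    (h : ∀ e ∈ X, ∀ N : ℤ, ∃ k < i, (∀ l < k, e.1 (N + l) = d l) ∧ e.1 (N + k) < d k) :
    MeasureTheory.volume ((fun e : PrimarySeq lam => future lam e.1) '' X) = 0 := by
  have hlam := hN.one_lt
  have h0 := hN.lam_pos
  set F := (fun e : PrimarySeq lam => future lam e.1) '' X with hF
  have hXiter : ∀ n, ∀ e ∈ X, shift^[n] e ∈ X := by
    intro n
    induction n with
    | zero => simp
    | succ n ih => intro e he; rw [Function.iterate_succ_apply]; exact ih _ (hX e he)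
  have hadm : ∀ e ∈ X, IsAdmissible d e.1 := by
    rintro e he N ⟨j, hj, hlt⟩
    obtain ⟨k, -, hk, hlt'⟩ := h e he N
    beta_reduce at hj hlt
    rcases lt_trichotomy j k with hjk | rfl | hjk
    · have := hk j hjk; omega
    · omega
    · have := hj k hjk; omega
  have hfin : MeasureTheory.volume F ≠ ⊤ := by
    have hsub : F ⊆ Set.Icc 0 1 := by
      rintro _ ⟨e, he, rfl⟩
      exact ⟨future_nonneg hlam _, (hN.region e (hadm e he)).1⟩
    exact ((MeasureTheory.measure_mono hsub).trans_lt (by simp)).ne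
  -- Sort the sequences by the index k of the first deviation from `d` and by the digit m < `d k`
  -- found there; each class lies in a copy of `F` scaled by λ^(-(k+1)). The scaling factors add up
  -- to 1 - `D i` / λ^i < 1, so a set of finite measure covered in this way is null.
  have hcover : F ⊆ ⋃ k ∈ Finset.range i, ⋃ m ∈ Finset.range (d k),
      (fun x => (1 - D k / lam ^ k + m / lam ^ (k + 1)) + x) '' ((1 / lam ^ (k + 1)) • F) := by
    rintro _ ⟨e, he, rfl⟩
    obtain ⟨k, hk, hag, hlt⟩ := h e he 1
    simp only [Set.mem_iUnion, Finset.mem_range]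
    refine ⟨k, hk, e.1 (1 + k), hlt, _, ⟨_, ⟨_, hXiter (k + 1) e he, rfl⟩, rfl⟩, ?_⟩
    have h1 := hN.future_sub_value e (i := k) fun l hl => by rw [← hag l hl, add_comm]
    have h2 := future_eq_shift_iterate hlam e k
    simp only [smul_eq_mul]
    rw [h2, add_comm (1 : ℤ)]
    have h3 : future lam (shift^[k] e).1 = D k + lam ^ k * (future lam e.1 - 1) := by linarith
    rw [h3]
    field_simp
    ring
  have hvol : ∀ (k : ℕ) (b : ℝ), MeasureTheory.volume
      ((fun x => b + x) '' ((1 / lam ^ (k + 1)) • F)) =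
      ENNReal.ofReal (1 / lam ^ (k + 1)) * MeasureTheory.volume F := by
    intro k b
    rw [Set.image_add_left, MeasureTheory.measure_preimage_add, MeasureTheory.Measure.addHaar_smul]
    simp [abs_of_pos h0]
  have hle : MeasureTheory.volume F ≤
      ENNReal.ofReal (1 - D i / lam ^ i) * MeasureTheory.volume F := by
    calc MeasureTheory.volume F
        ≤ ∑ k ∈ Finset.range i, ∑ m ∈ Finset.range (d k), MeasureTheory.volume
          ((fun x => (1 - D k / lam ^ k + m / lam ^ (k + 1)) + x) '' ((1 / lam ^ (k + 1)) • F)) :=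
          (MeasureTheory.measure_mono hcover).trans
            ((MeasureTheory.measure_biUnion_finset_le _ _).trans
              (Finset.sum_le_sum fun k _ => MeasureTheory.measure_biUnion_finset_le _ _))
      _ = ∑ k ∈ Finset.range i, ENNReal.ofReal (d k / lam ^ (k + 1)) * MeasureTheory.volume F := by
          refine Finset.sum_congr rfl fun k _ => ?_
          simp only [hvol, Finset.sum_const, Finset.card_range, nsmul_eq_mul]
          rw [← mul_assoc, div_eq_mul_one_div (d k : ℝ), ENNReal.ofReal_mul (by positivity),
            ENNReal.ofReal_natCast]
      _ = ENNReal.ofReal (1 - D i / lam ^ i) * MeasureTheory.volume F := by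
          rw [← Finset.sum_mul, ← ENNReal.ofReal_sum_of_nonneg fun k _ => by positivity,
            hN.sum_digits]
  by_contra hne
  have hlt : ENNReal.ofReal (1 - D i / lam ^ i) < 1 := by
    rw [ENNReal.ofReal_lt_one]
    have := hN.value_pos i
    have : 0 < D i / lam ^ i := by positivity
    linarith
  have := ENNReal.mul_lt_mul_left hne hfin hlt
  rw [one_mul] at this
  exact absurd hle (not_le.2 this)

end Numeration

namespace IsHyperbolicUnit

variable {M : Matrix (Fin 2) (Fin 2) ℤ} {u v : ℤ} {r c : ℕ} {d : ℕ → ℕ} {D : ℕ → ℝ}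
  {X : Set (PrimarySeq (eigen M))}

/-- Otherwise `collision` and totality put into `X` two distinct finite sequences with equal future
and past, hence with the same image. -/
theorem admissible_or_eventually_zero (hM : IsHyperbolicUnit M)
    (hN : Numeration (eigen M) (conjEigen M) r c d D)
    (hX : IsArithmeticCoding M (hM.phi u v) X) {e : PrimarySeq (eigen M)} (he : e ∈ X) :
    e ∈ admissibleSet (eigen M) d ∨ ∃ n : ℤ, ∀ m ≥ n, e.1 m = 0 := by
  by_contra! hn
  obtain ⟨hn1, hn2⟩ := hn
  have : ∃ N, LexLess d fun k => e.1 (N + k) := by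
    by_contra! h
    exact hn1 h
  obtain ⟨N, hlex⟩ := this
  rcases hN.collision e.1 N hlex with ⟨n, hz⟩ | ⟨N', g, h, hg, hh, hne, hg', hh', hfut, hpast⟩
  · obtain ⟨m, hm, hm0⟩ := hn2 n
    exact hm0 (hz m hm)
  · refine hne (hX.injective_finite ⟨hX.total e he g ⟨N', hg'⟩, hg⟩
      ⟨hX.total e he h ⟨N', hh'⟩, hh⟩ ?_)
    rw [phi_apply, phi_apply, hfut, hpast]

/-- If `X` has tails that are not below `d` up to any prescribed index, totality gives all finite
admissible sequences, which are uniformly below `d`, and closedness gives the rest as limits of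
truncations. Otherwise the futures form a null set, and most points of the torus have no preimage.
-/
theorem admissibleSet_subset (hM : IsHyperbolicUnit M)
    (hN : Numeration (eigen M) (conjEigen M) r c d D) (h : (u, v) ≠ (0, 0))
    (hX : IsArithmeticCoding M (hM.phi u v) X) : admissibleSet (eigen M) d ⊆ X := by
  by_cases hA : ∀ i : ℕ, ∃ e ∈ X, ∃ N : ℤ, ∀ k < i, (∀ l < k, e.1 (N + l) = d l) →
      d k ≤ e.1 (N + k)
  · have hfin : ∀ f ∈ admissibleSet (eigen M) d, IsFinite f → f ∈ X := by
      intro f hf hff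
      obtain ⟨n, hn⟩ := IsFinite.exists_bounds hff
      obtain ⟨i, hi⟩ := hN.exists_uniform_lt_digit hf hn
      obtain ⟨e, he, N, heN⟩ := hA i
      refine hX.total e he f ⟨N, fun k => ?_⟩
      obtain ⟨j, hj, hag, hlt⟩ := hi k
      by_cases hag' : ∀ l < j, e.1 (N + l) = d l
      · exact ⟨j, fun l hl => (hag l hl).trans (hag' l hl).symm, hlt.trans_le (heN j hj hag')⟩
      · push Not at hag'
        classical
        obtain ⟨h1, h2⟩ := Nat.find_spec hag'
        have h3 : ∀ l < Nat.find hag', e.1 (N + l) = d l := fun l hl => by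
          by_contra hne
          exact Nat.find_min hag' hl ⟨hl.trans h1, hne⟩
        refine ⟨Nat.find hag', fun l hl => ?_, ?_⟩
        · exact (hag l (hl.trans h1)).trans (h3 l hl).symm
        · exact (hag _ h1).trans_lt (lt_of_le_of_ne (heN _ (h1.trans hj) h3) h2.symm)
    intro e he
    have hmem : ∀ s, restrict e s ∈ X := by
      intro s
      refine hfin _ (IsAdmissible.mono he fun n => ?_) (isFinite_ofFinite _)
      rw [restrict_apply]
      split_ifs <;> omega
    exact @IsClosed.mem_of_tendsto _ (seqTopology (eigen M)) _ _ _ _ _ _ hX.closed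
      (tendsto_restrict e) (Filter.Eventually.of_forall hmem)
  · push Not at hA
    obtain ⟨i, hi⟩ := hA
    have hnull := hN.volume_future_eq_zero (X := X) (fun e he => (hX.shift_invariant e).2 he) hi
    obtain ⟨z, hz⟩ := (hM.ae_coord h 0 hnull).exists
    obtain ⟨e, he, rfl⟩ := hX.surjective z
    exact absurd ⟨e, he, rfl⟩ (hz _ rfl)

/-- Admissible and `X`-preimages of a generic point coincide: an eventually zero sequence has an
algebraic future, which genericity excludes. -/
theorem isKToOne (hM : IsHyperbolicUnit M) (h : (u, v) ≠ (0, 0))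
    (hX : IsArithmeticCoding M (hM.phi u v) X) :
    IsKToOne (hM.phi u v) X (assocForm M u v).natAbs := by
  obtain ⟨r, c, d, D, hN⟩ := hM.exists_numeration
  filter_upwards [hM.ae_transcendental h] with z hz
  rw [← hM.encard_preimage hN h hz]
  congr 1
  ext e
  refine ⟨fun ⟨he, hez⟩ => ⟨?_, hez⟩, fun ⟨he, hez⟩ => ⟨hM.admissibleSet_subset hN h hX he, hez⟩⟩
  rcases hM.admissible_or_eventually_zero hN hX he with h1 | ⟨n, hn⟩
  · exact h1
  · exfalso
    have h1 : Transcendental ℚ (future (eigen M) e.1) := (hz _ hez).1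
    have h2 : ∀ k : ℕ, Transcendental ℚ (future (eigen M) (shift^[k] e).1) := by
      intro k
      induction k with
      | zero => exact h1
      | succ k ih => rw [Function.iterate_succ_apply']; exact hN.transcendental_shift.1.2 ih
    apply h2 n.toNat
    have h3 : future (eigen M) (shift^[n.toNat] e).1 = 0 := by
      rw [future, tsum_congr, tsum_zero]
      intro m
      split_ifs with hm
      · rw [shift_iterate_apply, hn _ (by omega)]; simp
      · rfl
    rw [h3]
    exact isAlgebraic_zero

end IsHyperbolicUnit

/-! ### Classification of the continuous equivariant homomorphisms. -/

theorem shift_unit {lam : ℝ} (n : ℤ) : shift (unit lam n) = unit lam (n - 1) := by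
  ext m
  have h : (shift (unit lam n)).1 m = (unit lam n).1 (m + 1) := rfl
  rw [h, unit_apply, unit_apply]
  simp only [eq_sub_iff_add_eq]

/-- The linear map of the plane given by an integral matrix. -/
def realMap (M : Matrix (Fin 2) (Fin 2) ℤ) : (Fin 2 → ℝ) →ₗ[ℝ] (Fin 2 → ℝ) :=
  Matrix.toLin' (M.map (Int.cast : ℤ → ℝ))

theorem realMap_apply (M : Matrix (Fin 2) (Fin 2) ℤ) (x : Fin 2 → ℝ) (i : Fin 2) :
    realMap M x i = ∑ j, (M i j : ℝ) * x j := by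
  simp [realMap, Matrix.mulVec, dotProduct, Fin.sum_univ_two]

theorem toralMap_proj_eq (M : Matrix (Fin 2) (Fin 2) ℤ) (x : Fin 2 → ℝ) :
    toralMap M (proj x) = proj (realMap M x) := by
  rw [toralMap_proj, ← funext (realMap_apply M x)]

theorem toralMap_iterate_proj {M : Matrix (Fin 2) (Fin 2) ℤ} {x : Fin 2 → ℝ} {a : ℝ}
    (h : realMap M x = a • x) (n : ℕ) : (toralMap M)^[n] (proj x) = proj (a ^ n • x) := by
  induction n with
  | zero => simp
  | succ n ih =>
    rw [Function.iterate_succ_apply', ih, toralMap_proj_eq, map_smul, h, smul_smul, pow_succ]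

theorem realMap_realMap (M : Matrix (Fin 2) (Fin 2) ℤ) (x : Fin 2 → ℝ) :
    realMap M (realMap M x) = (M.trace : ℝ) • realMap M x - (M.det : ℝ) • x := by
  ext i
  rw [Matrix.trace_fin_two, Matrix.det_fin_two]
  fin_cases i <;>
    simp only [realMap_apply, Fin.sum_univ_two, Pi.sub_apply, Pi.smul_apply, smul_eq_mul,
      Fin.zero_eta, Fin.mk_one] <;> push_cast <;> ring

namespace IsHyperbolicUnit

variable {M : Matrix (Fin 2) (Fin 2) ℤ} {u v : ℤ}

theorem realMap_homoclinicPoint (hM : IsHyperbolicUnit M) (u v : ℤ) :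
    realMap M (homoclinicPoint M u v) = eigen M • homoclinicPoint M u v := by
  ext i
  rw [realMap_apply, hM.mul_homoclinicPoint, Pi.smul_apply, smul_eq_mul]

theorem realMap_conjPoint (hM : IsHyperbolicUnit M) (u v : ℤ) :
    realMap M (conjPoint M u v) = conjEigen M • conjPoint M u v := by
  ext i
  rw [realMap_apply, hM.mul_conjPoint, Pi.smul_apply, smul_eq_mul]

/-- The series defining `phi` uses conjugate weights for n ≤ 0. At n = 0 the two choices differ by
the integral vector t + t', and for n < 0 one applies powers of M. -/
theorem phi_unit (hM : IsHyperbolicUnit M) (u v n : ℤ) :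
    hM.phi u v (unit (eigen M) n) = proj (eigen M ^ (-n) • homoclinicPoint M u v) := by
  rcases lt_or_ge 0 n with hn | hn
  · rw [phi_apply, future_unit, past_unit, if_pos hn, if_neg (not_le.2 hn)]
    congr 1
    ext i
    simp [planeMap_apply]
  · obtain ⟨m, rfl⟩ := Int.exists_eq_neg_ofNat hn
    rw [neg_neg, zpow_natCast]
    have h0 : hM.phi u v (unit (eigen M) 0) = proj (homoclinicPoint M u v) := by
      rw [phi_apply, future_unit, past_unit, proj_eq_iff]
      refine ⟨fun i => M.det * M.mulVec ![-v, u] i, fun i => ?_⟩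
      have := hM.homoclinicPoint_add_conjPoint u v i
      simp only [lt_irrefl, le_refl, if_true, if_false, neg_zero, zpow_zero, planeMap_apply,
        Matrix.cons_val_zero, Matrix.cons_val_one]
      rw [Int.cast_mul]
      linarith
    rw [← toralMap_iterate_proj (hM.realMap_homoclinicPoint u v), ← h0, ← phi_shift_iterate]
    congr 1
    ext k
    rw [shift_iterate_apply, unit_apply, unit_apply]
    exact if_congr (by omega) rfl rfl

theorem isGivenBySeries_phi (hM : IsHyperbolicUnit M) (u v : ℤ) :
    IsGivenBySeries (hM.phi u v) (homoclinicPoint M u v) := by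
  intro e
  have h1 : Filter.Tendsto (fun N : ℕ => Finset.Icc (-(N : ℤ)) N) Filter.atTop Filter.atTop := by
    refine Filter.tendsto_atTop_finset_of_monotone
      (fun a b hab => Finset.Icc_subset_Icc (by omega) (by omega)) fun x => ⟨x.natAbs, ?_⟩
    rw [Finset.mem_Icc]
    omega
  refine ((hasSum_of_continuous (hM.continuous_phi u v) e).comp h1).congr fun N => ?_
  have h2 : ∑ n ∈ Finset.Icc (-(N : ℤ)) N, e.1 n • hM.phi u v (unit (eigen M) n) =
      proj ((∑ n ∈ Finset.Icc (-(N : ℤ)) N, (e.1 n : ℝ) * eigen M ^ (-n)) •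
        homoclinicPoint M u v) := by
    rw [Finset.sum_smul, map_sum]
    refine Finset.sum_congr rfl fun n _ => ?_
    rw [hM.phi_unit, ← map_nsmul, mul_smul, Nat.cast_smul_eq_nsmul]
  exact h2

/-- Two eigenvectors for the two eigenvalues that are congruent modulo the integral lattice come
from an integral vector. -/
theorem exists_eq_homoclinicPoint (hM : IsHyperbolicUnit M) {x x' : Fin 2 → ℝ}
    (hx : realMap M x = eigen M • x) (hx' : realMap M x' = conjEigen M • x')
    (h : proj x = proj x') : ∃ u v, x = homoclinicPoint M u v := by
  obtain ⟨k, hk⟩ := proj_eq_iff.1 h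
  have hdet := hM.det_mul_det
  -- The solution of -σM(-v, u) = k, so that t + t' = k. Then x - t = x' + t' is an eigenvector for
  -- both eigenvalues, hence zero.
  refine ⟨M 1 0 * k 0 - M 0 0 * k 1, M 1 1 * k 0 - M 0 1 * k 1, ?_⟩
  set u := M 1 0 * k 0 - M 0 0 * k 1 with hu
  set v := M 1 1 * k 0 - M 0 1 * k 1 with hv
  have h1 : ∀ i, M.det * M.mulVec ![-v, u] i = -k i := by
    intro i
    have h2 : M.mulVec ![-v, u] i = -(M.det * k i) := by
      rw [Matrix.det_fin_two]
      fin_cases i <;> simp [Matrix.mulVec, dotProduct, Fin.sum_univ_two, hu, hv] <;> ring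
    rw [h2, mul_neg, ← mul_assoc, hdet, one_mul]
  have h2 : x - homoclinicPoint M u v = x' + conjPoint M u v := by
    ext i
    have h3 := hM.homoclinicPoint_add_conjPoint u v i
    have h4 : (M.det : ℝ) * (M.mulVec ![-v, u] i : ℤ) = -k i := by exact_mod_cast h1 i
    simp only [Pi.sub_apply, Pi.add_apply]
    linarith [hk i]
  have h3 : realMap M (x - homoclinicPoint M u v) = eigen M • (x - homoclinicPoint M u v) := by
    rw [map_sub, hx, hM.realMap_homoclinicPoint, smul_sub]
  have h4 : realMap M (x - homoclinicPoint M u v) = conjEigen M • (x - homoclinicPoint M u v) := by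
    rw [h2, map_add, hx', hM.realMap_conjPoint, smul_add]
  have h5 : (eigen M - conjEigen M) • (x - homoclinicPoint M u v) = 0 := by
    rw [sub_smul, ← h3, ← h4, sub_self]
  exact sub_eq_zero.1 ((smul_eq_zero.1 h5).resolve_left hM.sub_ne_zero)

/-- Lift each point by its representative nearest to 0. When two consecutive points are small
compared with the entries of M, the vectors s (n + 1) and M (s n) are congruent modulo ℤ² and differ
by less than 1 in each coordinate, so they coincide. -/
theorem exists_lift_orbit {a : ℤ → UnitAddTorus (Fin 2)} (ha : ∀ n, a (n + 1) = toralMap M (a n))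
    (h0 : Filter.Tendsto a Filter.cofinite (𝓝 0)) :
    ∃ (N : ℕ) (s : ℤ → Fin 2 → ℝ), (∀ n, proj (s n) = a n) ∧ (∀ n i, |s n i| ≤ 1) ∧
      ∀ n : ℤ, N ≤ n ∨ n < -N → s (n + 1) = realMap M (s n) := by
  have hlift : ∀ x : UnitAddCircle, ∃ y : ℝ, (y : UnitAddCircle) = x ∧ |y| = ‖x‖ := by
    intro x
    obtain ⟨y, rfl⟩ := QuotientAddGroup.mk_surjective x
    refine ⟨y - round y, ?_, UnitAddCircle.norm_eq.symm⟩
    rw [AddCircle.coe_sub, sub_eq_self, AddCircle.coe_eq_zero_iff]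
    exact ⟨round y, by simp⟩
  choose s hs hs' using fun n i => hlift (a n i)
  set C : ℝ := ∑ i, ∑ j, |(M i j : ℝ)| with hC
  have hC0 : 0 ≤ C := Finset.sum_nonneg fun i _ => Finset.sum_nonneg fun j _ => abs_nonneg _
  have hev : ∀ᶠ n in Filter.cofinite, ‖a n‖ < 1 / (C + 1) :=
    (tendsto_zero_iff_norm_tendsto_zero.1 h0).eventually_lt_const (by positivity)
  rw [Filter.eventually_cofinite] at hev
  obtain ⟨N, hN⟩ : ∃ N : ℕ, ∀ n : ℤ, N ≤ n.natAbs → ‖a n‖ < 1 / (C + 1) := by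
    refine ⟨hev.toFinset.sup Int.natAbs + 1, fun n hn => ?_⟩
    by_contra hlt
    have := Finset.le_sup (f := Int.natAbs) (hev.mem_toFinset.2 hlt)
    omega
  refine ⟨N, s, fun n => funext (hs n), fun n i => ?_, fun n hn => ?_⟩
  · rw [hs']
    exact (AddCircle.norm_le_half_period (1 : ℝ) one_ne_zero).trans (by norm_num)
  · have h1 := hN n (by omega)
    have h2 := hN (n + 1) (by omega)
    have hsmall : ∀ m, ‖a m‖ < 1 / (C + 1) → ∀ i, |s m i| < 1 / (C + 1) := fun m hm i => by
      rw [hs']; exact (norm_le_pi_norm (a m) i).trans_lt hm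
    have h3 : proj (s (n + 1)) = proj (realMap M (s n)) := by
      rw [← toralMap_proj_eq]
      exact (funext (hs (n + 1)) : proj (s (n + 1)) = _).trans
        ((ha n).trans (congrArg _ (funext (hs n)).symm))
    obtain ⟨k, hk⟩ := proj_eq_iff.1 h3
    ext i
    have h4 : |(k i : ℝ)| < 1 := by
      have h5 : |realMap M (s n) i| ≤ C * (1 / (C + 1)) := by
        rw [realMap_apply]
        calc |∑ j, (M i j : ℝ) * s n j| ≤ ∑ j, |(M i j : ℝ)| * (1 / (C + 1)) := by
              refine (Finset.abs_sum_le_sum_abs _ _).trans (Finset.sum_le_sum fun j _ => ?_)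
              rw [abs_mul]
              exact mul_le_mul_of_nonneg_left (hsmall n h1 j).le (abs_nonneg _)
          _ ≤ C * (1 / (C + 1)) := by
              rw [← Finset.sum_mul]
              refine mul_le_mul_of_nonneg_right ?_ (by positivity)
              exact Finset.single_le_sum (f := fun i => ∑ j, |(M i j : ℝ)|)
                (fun i _ => Finset.sum_nonneg fun j _ => abs_nonneg _) (Finset.mem_univ i)
      have h6 := hsmall _ h2 i
      have h7 : (k i : ℝ) = s (n + 1) i - realMap M (s n) i := by rw [hk]; ring
      have h8 : C * (1 / (C + 1)) + 1 / (C + 1) = 1 := by field_simp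
      rw [h7]
      exact (abs_sub _ _).trans_lt (by linarith)
    have h5 : k i = 0 := Int.abs_lt_one_iff.1 (by exact_mod_cast h4)
    rw [hk, h5]
    simp

/-- Every point of the torus that is homoclinic to zero is the projection of a homoclinic
vector. -/
theorem exists_eq_proj_homoclinicPoint (hM : IsHyperbolicUnit M) {a : ℤ → UnitAddTorus (Fin 2)}
    (ha : ∀ n, a (n + 1) = toralMap M (a n)) (h0 : Filter.Tendsto a Filter.cofinite (𝓝 0)) :
    ∃ u v, a 0 = proj (homoclinicPoint M u v) := by
  obtain ⟨N, s, hs, hs1, hstep⟩ := exists_lift_orbit ha h0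
  have hiter : ∀ (m : ℕ) (n : ℤ), a (n + m) = (toralMap M)^[m] (a n) := by
    intro m n
    induction m with
    | zero => simp
    | succ m ih => rw [Function.iterate_succ_apply', ← ih, ← ha]; push_cast; rw [add_assoc]
  have hsum : (M.trace : ℝ) = eigen M + conjEigen M := (eigen_add_conjEigen M).symm
  have hmul := hM.mul_eq
  have hlam := hM.eigen_pos
  have hmu : conjEigen M ≠ 0 := fun h => by
    have := hM.det_mul_det_real
    rw [← hmul, h] at this
    simp at this
  have hmap : ∀ n i, |realMap M (s n) i| ≤ ∑ j, |(M i j : ℝ)| := fun n i => by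
    rw [realMap_apply]
    refine (Finset.abs_sum_le_sum_abs _ _).trans (Finset.sum_le_sum fun j _ => ?_)
    rw [abs_mul]
    exact mul_le_of_le_one_right (abs_nonneg _) (hs1 n j)
  have hbound : ∀ n i (y : ℝ), |realMap M (s n) i - y * s n i| ≤ ∑ j, |(M i j : ℝ)| + |y| := by
    intro n i y
    refine (abs_sub _ _).trans (add_le_add (hmap n i) ?_)
    rw [abs_mul]
    exact mul_le_of_le_one_right (abs_nonneg _) (hs1 n i)
  -- By Cayley-Hamilton, (M - μ)s expands by λ along the lifted forward orbit, yet stays bounded, so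
  -- it vanishes. Backward in time the same holds for (M - λ)s.
  have hfwd : realMap M (s N) = conjEigen M • s N := by
    ext i
    have := eq_zero_of_bounded_of_expanding hM.one_lt
      (f := fun m : ℕ => realMap M (s (N + m)) i - conjEigen M * s (N + m) i)
      (B := ∑ j, |(M i j : ℝ)| + |conjEigen M|) (fun m => ?_) fun m => hbound _ _ _
    · simpa [sub_eq_zero] using this
    · have h1 := hstep (N + m) (by omega)
      have h2 : ((N : ℤ) + (m + 1 : ℕ)) = N + m + 1 := by push_cast; ring
      simp only [h2, h1, realMap_realMap, Pi.sub_apply, Pi.smul_apply, smul_eq_mul]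
      have h3 : ∀ y z : ℝ, M.trace * y - M.det * z - conjEigen M * y =
          eigen M * (y - conjEigen M * z) := fun y z => by rw [hsum, ← hmul]; ring
      rw [h3, abs_mul, abs_of_pos hlam]
  have hbwd : realMap M (s (-N)) = eigen M • s (-N) := by
    ext i
    have := eq_zero_of_bounded_of_expanding hM.one_lt
      (f := fun m : ℕ => realMap M (s (-N - m)) i - eigen M * s (-N - m) i)
      (B := ∑ j, |(M i j : ℝ)| + |eigen M|) (fun m => ?_) fun m => hbound _ _ _
    · simpa [sub_eq_zero] using this
    · have h1 := hstep (-N - (m + 1 : ℕ)) (by omega)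
      have h2 : (-(N : ℤ) - (m + 1 : ℕ)) + 1 = -N - m := by push_cast; ring
      rw [h2] at h1
      simp only [h1, realMap_realMap, Pi.sub_apply, Pi.smul_apply, smul_eq_mul]
      have h3 : ∀ y z : ℝ, M.trace * y - M.det * z - eigen M * y =
          conjEigen M * (y - eigen M * z) := fun y z => by rw [hsum, ← hmul]; ring
      rw [h3, abs_mul, hM.abs_conj, ← mul_assoc, mul_inv_cancel₀ hlam.ne', one_mul]
  have h1 : a 0 = proj (eigen M ^ N • s (-N)) := by
    rw [← toralMap_iterate_proj hbwd, hs, ← hiter]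
    simp
  have h2 : a 0 = proj ((conjEigen M ^ N)⁻¹ • s N) := by
    apply (toralMap_injective hM.1).iterate N
    rw [← hiter, toralMap_iterate_proj (a := conjEigen M), smul_smul,
      mul_inv_cancel₀ (pow_ne_zero _ hmu), one_smul, hs, zero_add]
    rw [map_smul, hfwd, smul_comm]
  obtain ⟨u, v, huv⟩ := hM.exists_eq_homoclinicPoint (x := eigen M ^ N • s (-N))
    (x' := (conjEigen M ^ N)⁻¹ • s N) (by rw [map_smul, hbwd, smul_comm])
    (by rw [map_smul, hfwd, smul_comm]) (h1.symm.trans h2)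
  exact ⟨u, v, by rw [h1, huv]⟩

/-- Every continuous equivariant homomorphism to the torus is given by a homoclinic vector. -/
theorem exists_eq_phi (hM : IsHyperbolicUnit M)
    {φ : PrimarySeq (eigen M) →+ UnitAddTorus (Fin 2)}
    (hφ : Continuous[seqTopology (eigen M), inferInstance] φ)
    (heq : ∀ e, φ (shift e) = toralMap M (φ e)) : ∃ u v, φ = hM.phi u v := by
  have ha : ∀ n : ℤ, φ (unit _ (-(n + 1))) = toralMap M (φ (unit _ (-n))) := fun n => by
    rw [← heq, shift_unit]
    congr 2
    ring
  -- The image of the constant sequence 1 is the unconditional sum of the images of the units, so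
  -- these tend to 0. The sign is reversed because the shift lowers the position of the 1.
  have h0 : Filter.Tendsto (fun n : ℤ => φ (unit (eigen M) (-n))) Filter.cofinite (𝓝 0) := by
    have h1 := (hasSum_of_continuous hφ
      (ofBounded hM.one_lt (fun _ => 1) 1 fun _ => le_rfl)).summable.tendsto_cofinite_zero
    have h2 : (fun n : ℤ => (ofBounded hM.one_lt (fun _ => 1) 1 fun _ => le_rfl).1 n •
        φ (unit (eigen M) n)) = fun n => φ (unit (eigen M) n) := by
      ext1 n; simp [ofBounded]
    rw [h2] at h1
    exact h1.comp neg_injective.tendsto_cofinite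
  obtain ⟨u, v, huv⟩ := hM.exists_eq_proj_homoclinicPoint ha h0
  refine ⟨u, v, ?_⟩
  have hzero : φ (unit _ 0) = hM.phi u v (unit _ 0) := by
    rw [hM.phi_unit]
    simpa using huv
  have hiter : ∀ (e : PrimarySeq (eigen M)) (n : ℕ), φ (shift^[n] e) = (toralMap M)^[n] (φ e) := by
    intro e n
    induction n with
    | zero => rfl
    | succ n ih => rw [Function.iterate_succ_apply', Function.iterate_succ_apply', heq, ih]
  have hshift : ∀ (n : ℕ) (m : ℤ), shift^[n] (unit (eigen M) m) = unit _ (m - n) := by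
    intro n m
    induction n with
    | zero => simp
    | succ n ih => rw [Function.iterate_succ_apply', ih, shift_unit]; congr 1; push_cast; ring
  have hunit : ∀ n, φ (unit _ n) = hM.phi u v (unit _ n) := by
    intro n
    rcases le_or_gt n 0 with hn | hn
    · obtain ⟨m, rfl⟩ := Int.exists_eq_neg_ofNat hn
      rw [← zero_sub, ← hshift, hiter, hzero, phi_shift_iterate]
    · lift n to ℕ using hn.le
      apply (toralMap_injective hM.1).iterate n
      rw [← hiter, ← phi_shift_iterate, hshift, sub_self, hzero]
  ext1 e
  refine (hasSum_of_continuous hφ e).unique ?_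
  simp only [hunit]
  exact hasSum_of_continuous (hM.continuous_phi u v) e

theorem phi_zero (hM : IsHyperbolicUnit M) : hM.phi 0 0 = 0 := by
  ext1 e
  rw [phi_apply]
  have : planeMap M 0 0 ![future (eigen M) e.1, past (conjEigen M) e.1] = 0 := by
    ext i
    have h1 : (![0, 0] : Fin 2 → ℤ) = 0 := by ext i; fin_cases i <;> rfl
    simp [planeMap_apply, homoclinicPoint, conjPoint, h1]
  rw [this, map_zero]
  rfl

/-- Zero parameters give the zero map, which misses the point (1/2, 1/2). -/
theorem exists_eq_phi_of_coding (hM : IsHyperbolicUnit M)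
    {φ : PrimarySeq (eigen M) →+ UnitAddTorus (Fin 2)} {X : Set (PrimarySeq (eigen M))}
    (hX : IsArithmeticCoding M φ X) : ∃ u v, (u, v) ≠ (0, 0) ∧ φ = hM.phi u v := by
  obtain ⟨u, v, rfl⟩ := hM.exists_eq_phi hX.continuous hX.equivariant
  refine ⟨u, v, fun h => ?_, rfl⟩
  obtain ⟨rfl, rfl⟩ := Prod.mk_inj.1 h
  obtain ⟨e, -, he⟩ := hX.surjective (proj fun _ => 2⁻¹)
  rw [hM.phi_zero] at he
  obtain ⟨k, hk⟩ := proj_eq_zero_iff.1 he.symm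
  have h2 : (1 : ℝ) = 2 * k 0 := by rw [← hk 0]; norm_num
  have h3 : (1 : ℤ) = 2 * k 0 := by exact_mod_cast h2
  omega

theorem homoclinicPoint_sub (M : Matrix (Fin 2) (Fin 2) ℤ) (u v u' v' : ℤ) :
    homoclinicPoint M (u - u') (v - v') = homoclinicPoint M u v - homoclinicPoint M u' v' := by
  ext i
  fin_cases i <;>
    simp [homoclinicPoint] <;> ring

/-- The difference of two homoclinic vectors lies on one eigenline, where `proj` is injective. -/
theorem phi_injective (hM : IsHyperbolicUnit M) :
    Function.Injective fun p : ℤ × ℤ => hM.phi p.1 p.2 := by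
  rintro ⟨u, v⟩ ⟨u', v'⟩ h
  have h1 : hM.phi u v (unit _ 1) = hM.phi u' v' (unit _ 1) := DFunLike.congr_fun h _
  rw [hM.phi_unit, hM.phi_unit, ← sub_eq_zero, ← map_sub, ← smul_sub, ← homoclinicPoint_sub] at h1
  by_contra hne
  have h2 : (u - u', v - v') ≠ (0, 0) := fun h0 => hne (by
    rw [Prod.mk.injEq] at h0 ⊢
    omega)
  refine zpow_ne_zero (-1) hM.eigen_pos.ne' (hM.eq_zero_of_proj_smul h2 (Eq.trans ?_ h1))
  congr 1
  ext i
  simp [planeMap_apply]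

/-! ### Minimal codings. -/

theorem isKToOne_unique {lam : ℝ} {φ : PrimarySeq lam →+ UnitAddTorus (Fin 2)}
    {X : Set (PrimarySeq lam)} {K K' : ℕ} (h : IsKToOne φ X K) (h' : IsKToOne φ X K') :
    K = K' := by
  obtain ⟨z, hz, hz'⟩ := (Filter.Eventually.and h h').exists
  exact_mod_cast hz.symm.trans hz'

theorem preimageNumbers_eq (hM : IsHyperbolicUnit M) : preimageNumbers M =
    {k : ℕ | ∃ u v : ℤ, (u, v) ≠ (0, 0) ∧ k = (assocForm M u v).natAbs} := by
  ext k
  constructor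
  · rintro ⟨φ, X, hX, hk⟩
    obtain ⟨u, v, h, rfl⟩ := hM.exists_eq_phi_of_coding hX
    exact ⟨u, v, h, isKToOne_unique hk (hM.isKToOne h hX)⟩
  · rintro ⟨u, v, h, rfl⟩
    obtain ⟨r, c, d, D, hN⟩ := hM.exists_numeration
    exact ⟨_, _, hM.isArithmeticCoding_phi hN h, hM.isKToOne h (hM.isArithmeticCoding_phi hN h)⟩

theorem isLeast_minPreimages (hM : IsHyperbolicUnit M) :
    IsLeast (preimageNumbers M) (minPreimages M) := by
  refine ⟨Nat.sInf_mem ?_, fun k hk => Nat.sInf_le hk⟩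
  rw [hM.preimageNumbers_eq]
  exact ⟨_, 1, 0, by simp, rfl⟩

theorem bijOn_phi (hM : IsHyperbolicUnit M) :
    Set.BijOn (fun p : ℤ × ℤ => hM.phi p.1 p.2)
      {p | assocForm M p.1 p.2 = (minPreimages M : ℤ) ∨
        assocForm M p.1 p.2 = -(minPreimages M : ℤ)} {φ | ∃ X, IsMinimalCoding M φ X} := by
  have hiff : ∀ p : ℤ × ℤ, (assocForm M p.1 p.2 = (minPreimages M : ℤ) ∨
      assocForm M p.1 p.2 = -(minPreimages M : ℤ)) ↔
      (assocForm M p.1 p.2).natAbs = minPreimages M := fun p => by omega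
  simp only [hiff]
  obtain ⟨u₀, v₀, h₀, hm⟩ := hM.preimageNumbers_eq ▸ hM.isLeast_minPreimages.1
  refine ⟨?_, hM.phi_injective.injOn, ?_⟩
  · rintro ⟨u, v⟩ hp
    -- The origin is not a solution because the minimum is a nonzero value of the form.
    have h : (u, v) ≠ (0, 0) := by
      rintro h
      obtain ⟨rfl, rfl⟩ := Prod.mk_inj.1 h
      refine hM.assocForm_ne_zero h₀ (Int.natAbs_eq_zero.1 (hm.symm.trans (hp.symm.trans ?_)))
      simp [assocForm]
    obtain ⟨r, c, d, D, hN⟩ := hM.exists_numeration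
    have hX := hM.isArithmeticCoding_phi hN h
    exact ⟨_, hX, hp ▸ hM.isKToOne h hX⟩
  · rintro φ ⟨X, hX, hk⟩
    obtain ⟨u, v, h, rfl⟩ := hM.exists_eq_phi_of_coding hX
    exact ⟨(u, v), isKToOne_unique (hM.isKToOne h hX) hk, rfl⟩

end IsHyperbolicUnit

end ArithCoding

end

theorem corollary3p2 (M : Matrix (Fin 2) (Fin 2) ℤ) (hdet : IsUnit M.det)
    (hhyp : ArithCoding.IsHyperbolic M) (htr : 0 < M.trace) :
    -- the number of preimages of an arithmetic coding is well defined and depends on `φ` only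
    (∀ φ, ∃ K : ℕ, ∀ X, ArithCoding.IsArithmeticCoding M φ X → ArithCoding.IsKToOne φ X K) ∧
    -- `m(T)` is attained and equals the integral minimum of the associated form
    IsLeast (ArithCoding.preimageNumbers M) (ArithCoding.minPreimages M) ∧
    IsLeast {k : ℕ | ∃ u v : ℤ, (u, v) ≠ (0, 0) ∧ k = (ArithCoding.assocForm M u v).natAbs}
      (ArithCoding.minPreimages M) ∧
    -- the minimal codings are in bijection with the solutions of `f(u, v) = ± m(T)`
    ∃ Φ : ℤ × ℤ → (ArithCoding.PrimarySeq (ArithCoding.eigen M) →+ UnitAddTorus (Fin 2)),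
      (∀ u v : ℤ, ArithCoding.IsGivenBySeries (Φ (u, v)) (ArithCoding.homoclinicPoint M u v)) ∧
      Set.BijOn Φ
        {p | ArithCoding.assocForm M p.1 p.2 = (ArithCoding.minPreimages M : ℤ) ∨
          ArithCoding.assocForm M p.1 p.2 = -(ArithCoding.minPreimages M : ℤ)}
        {φ | ∃ X, ArithCoding.IsMinimalCoding M φ X} := by
  have hM : ArithCoding.IsHyperbolicUnit M := ⟨hdet, hhyp, htr⟩
  refine ⟨fun φ => ?_, hM.isLeast_minPreimages, hM.preimageNumbers_eq ▸ hM.isLeast_minPreimages,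
    fun p => hM.phi p.1 p.2, hM.isGivenBySeries_phi, hM.bijOn_phi⟩
  by_cases hX : ∃ X, ArithCoding.IsArithmeticCoding M φ X
  · obtain ⟨X, hX⟩ := hX
    obtain ⟨u, v, h, rfl⟩ := hM.exists_eq_phi_of_coding hX
    exact ⟨_, fun X hX => hM.isKToOne h hX⟩
  -- A homomorphism without any coding satisfies the condition vacuously, and 0 is an arbitrary
  -- value.
  · exact ⟨0, fun X h => absurd ⟨X, h⟩ hX⟩
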